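/- **Corollary (Hochster).** Let $K$ be a field, let $\Delta$ be a simplicial complex on the vertex set $[n]=\{1,\dots,n\}$ (a collection of subsets of $[n]$ closed under taking subsets; the sets $\{j\}$ need not be faces, and $\Delta=\emptyset$ is allowed), and let $K[\Delta]=K[X_1,\dots,X_n]/I_\Delta$ be its Stanley–Reisner ring, where $I_\Delta$ is generated by the monomials $\prod_{j\in F}X_j$ with $F\subseteq[n]$, $F\notin\Delta$. Let $x_j$ be the residue class of $X_j$, let $\mathfrak m=(x_1,\dots,x_n)$, and let $i\ge 0$ be an integer. Then the local cohomology module $H^i_{\mathfrak m}(K[\Delta])=\varinjlim_t \operatorname{Ext}^i_{K[\Delta]}(K[\Delta]/\mathfrak m^t,K[\Delta])$ is isomorphic, as a $K[\Delta]$-module, to the cohomology $H^i(C^\bullet)$ of the Čech complex $$C^t=\bigoplus_{F\subseteq[n],\,|F|=t}K[\Delta]_{x_F},\qquad x_F=\prod_{j\in F}x_j,$$ whose differential has the component $(-1)^s$ times the natural map $K[\Delta]_{x_{G\setminus\{j_s\}}}\to K[\Delta]_{x_G}$ for $G=\{j_0<\dots<j_t\}$ and $0\le s\le t$. The $\mathbb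 Z^n$-grading of the polynomial ring induces a grading of the localizations, of $C^\bullet$ and of $H^i(C^\bullet)$; through any such isomorphism $H^i_{\mathfrak m}(K[\Delta])$ becomes a $\mathbb Z^n$-graded $K$-vector space, the direct sum of its components $H^i_{\mathfrak m}(K[\Delta])_a$, $a\in\mathbb Z^n$, all of which are finite-dimensional over $K$. Its multigraded Hilbert series $\operatorname{Hilb}(M,\mathbf t)=\sum_{a\in\mathbb Z^n}(\dim_K M_a)\,\mathbf t^a$ is $$\operatorname{Hilb}\bigl(H^i_{\mathfrak m}(K[\Delta]),\mathbf t\bigr)=\sum_{F\in\Delta}\dim_K\widetilde H_{i-|F|-1}(\operatorname{lk}_\Delta F;K)\prod_{j\in F}\frac{t_j^{-1}}{1-t_j^{-1}},$$ where the right-hand side is expanded as a formal power series in $t_1^{-1},\dots,t_n^{-1}$. Here $\operatorname{lk}_\Delta F=\{G\subseteq[n] : F\cup G\in\Delta,\ F\cap G=\emptyset\}$, and $\widetilde H_d(\Gamma;K)$, $d\in\mathbb Z$, is the homology of the augmented oriented simplicial chain complex of $\Gamma$ with coefficients in $K$, in which the empty face, if it belongs to $\Gamma$, has dimension $-1$.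 -/

import Mathlib

universe u

/-- A simplicial complex on the vertex set `Fin n`: a collection of subsets closed under taking
subsets. Vertices `{i}` need not be faces, and the collection may be empty. -/
@[ext]
structure FinSimplicialComplex (n : ℕ) where
  /-- the faces -/
  faces : Finset (Finset (Fin n))
  /-- every subset of a face is a face -/
  down_closed : ∀ {F G : Finset (Fin n)}, F ⊆ G → G ∈ faces → F ∈ faces

namespace FinSimplicialComplex

/-- The link `lk_Δ F = {G | F ∪ G ∈ Δ, F ∩ G = ∅}`. -/
def link {n : ℕ} (Δ : FinSimplicialComplex n) (F : Finset (Fin n)) : FinSimplicialComplex n where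
  faces := Finset.univ.filter fun G => F ∪ G ∈ Δ.faces ∧ F ∩ G = ∅
  down_closed := by
    intro G H hGH hH
    simp only [Finset.mem_filter, Finset.mem_univ, true_and] at hH ⊢
    exact ⟨Δ.down_closed (Finset.union_subset_union_right hGH) hH.1,
      Finset.subset_empty.mp (hH.2 ▸ Finset.inter_subset_inter_left hGH)⟩

/-! ### Reduced simplicial homology -/

/-- The faces of dimension `d`, i.e. those with `d + 1` elements; for `d = -1` the only candidate
is the empty face. -/
abbrev Face {n : ℕ} (Δ : FinSimplicialComplex n) (d : ℤ) : Type :=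
  {F : Finset (Fin n) // F ∈ Δ.faces ∧ (F.card : ℤ) = d + 1}

/-- The position (counted from `0`) of `v` in the increasing list of elements of `F`. -/
def position {n : ℕ} (F : Finset (Fin n)) (v : Fin n) : ℕ :=
  (F.filter fun u => u < v).card

/-- The face of dimension `e` obtained from a face of dimension `e + 1` by deleting a vertex. -/
def Face.delete {n : ℕ} {Δ : FinSimplicialComplex n} {d e : ℤ} (h : e + 1 = d) (F : Δ.Face d)
    (v : {v : Fin n // v ∈ F.1}) : Δ.Face e :=
  ⟨F.1.erase v.1, Δ.down_closed (Finset.erase_subset _ _) F.2.1, by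
    have h1 := Finset.card_erase_add_one v.2
    have h2 := F.2.2
    omega⟩

/-- The boundary map `∂ : 𝒞_d → 𝒞_e`, `e = d - 1`, of the augmented oriented chain complex with
coefficients in `K`, where a chain is given by its family of coefficients:
`∂ {i₀ < ⋯ < i_d} = ∑ⱼ (-1)ʲ {i₀, …, îⱼ, …, i_d}`. -/
noncomputable def boundary (K : Type u) [Field K] {n : ℕ} (Δ : FinSimplicialComplex n) (d e : ℤ)
    (h : e + 1 = d) : (Δ.Face d → K) →ₗ[K] (Δ.Face e → K) :=
  Fintype.linearCombination K fun F : Δ.Face d =>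
    ∑ v : {v : Fin n // v ∈ F.1},
      (-1 : K) ^ position F.1 v.1 • Pi.single (F.delete h v) (1 : K)

/-- The cycles in degree `d`. -/
noncomputable def cycles (K : Type u) [Field K] {n : ℕ} (Δ : FinSimplicialComplex n) (d : ℤ) :
    Submodule K (Δ.Face d → K) :=
  LinearMap.ker (Δ.boundary K d (d - 1) (sub_add_cancel d 1))

/-- The boundaries in degree `d`. -/
noncomputable def boundaries (K : Type u) [Field K] {n : ℕ} (Δ : FinSimplicialComplex n) (d : ℤ) :
    Submodule K (Δ.Face d → K) :=
  LinearMap.range (Δ.boundary K (d + 1) d rfl)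

/-- The reduced simplicial homology `H̃_d(Δ; K)`, for every integer `d`. -/
abbrev reducedHomology (K : Type u) [Field K] {n : ℕ} (Δ : FinSimplicialComplex n) (d : ℤ) :
    Type u :=
  Δ.cycles K d ⧸ (Δ.boundaries K d).submoduleOf (Δ.cycles K d)

/-! ### The Stanley–Reisner ring -/

/-- The Stanley–Reisner ideal, generated by the squarefree monomials of the nonfaces. -/
noncomputable def stanleyReisnerIdeal (K : Type u) [Field K] {n : ℕ} (Δ : FinSimplicialComplex n) :
    Ideal (MvPolynomial (Fin n) K) :=
  Ideal.span {p | ∃ F : Finset (Fin n), F ∉ Δ.faces ∧ p = ∏ j ∈ F, MvPolynomial.X j}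

/-- The Stanley–Reisner ring `K[Δ]`. -/
abbrev stanleyReisnerRing (K : Type u) [Field K] {n : ℕ} (Δ : FinSimplicialComplex n) : Type u :=
  MvPolynomial (Fin n) K ⧸ Δ.stanleyReisnerIdeal K

/-- The residue class `x_j` of the variable `X_j` in `K[Δ]`. -/
noncomputable def x (K : Type u) [Field K] {n : ℕ} (Δ : FinSimplicialComplex n) (j : Fin n) :
    Δ.stanleyReisnerRing K :=
  Ideal.Quotient.mk _ (MvPolynomial.X j)

/-- The graded maximal ideal `𝔪 = (x_1, …, x_n)` of `K[Δ]`. -/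
noncomputable def maxIdeal (K : Type u) [Field K] {n : ℕ} (Δ : FinSimplicialComplex n) :
    Ideal (Δ.stanleyReisnerRing K) :=
  Ideal.span (Set.range (Δ.x K))

/-! ### Local cohomology -/

/-- The local cohomology module `H^i_𝔪(K[Δ])`. -/
def LocalCoh (K : Type u) [Field K] {n : ℕ} (Δ : FinSimplicialComplex n) (i : ℕ) : Type u :=
  (localCohomology (Δ.maxIdeal K) i).obj
    (ModuleCat.of (Δ.stanleyReisnerRing K) (Δ.stanleyReisnerRing K))

noncomputable instance (K : Type u) [Field K] {n : ℕ} (Δ : FinSimplicialComplex n) (i : ℕ) :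
    AddCommGroup (Δ.LocalCoh K i) :=
  inferInstanceAs (AddCommGroup ((localCohomology (Δ.maxIdeal K) i).obj
    (ModuleCat.of (Δ.stanleyReisnerRing K) (Δ.stanleyReisnerRing K))))

noncomputable instance (K : Type u) [Field K] {n : ℕ} (Δ : FinSimplicialComplex n) (i : ℕ) :
    Module (Δ.stanleyReisnerRing K) (Δ.LocalCoh K i) :=
  inferInstanceAs (Module (Δ.stanleyReisnerRing K) ((localCohomology (Δ.maxIdeal K) i).obj
    (ModuleCat.of (Δ.stanleyReisnerRing K) (Δ.stanleyReisnerRing K))))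

/-- `H^i_𝔪(K[Δ])` as a `K`-vector space, through `K → K[Δ]`. -/
noncomputable instance (K : Type u) [Field K] {n : ℕ} (Δ : FinSimplicialComplex n) (i : ℕ) :
    Module K (Δ.LocalCoh K i) :=
  Module.compHom _ (algebraMap K (Δ.stanleyReisnerRing K))

instance (K : Type u) [Field K] {n : ℕ} (Δ : FinSimplicialComplex n) (i : ℕ) :
    IsScalarTower K (Δ.stanleyReisnerRing K) (Δ.LocalCoh K i) :=
  ⟨fun c r y => by
    change (c • r) • y = algebraMap K (Δ.stanleyReisnerRing K) c • r • y
    rw [← mul_smul, ← Algebra.smul_def]⟩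

/-! ### The Čech complex and its `ℤⁿ`-grading -/

/-- The element `x_F = ∏_{j ∈ F} x_j` of `K[Δ]`. -/
noncomputable def xProd (K : Type u) [Field K] {n : ℕ} (Δ : FinSimplicialComplex n) (F : Finset (Fin n)) :
    Δ.stanleyReisnerRing K :=
  ∏ j ∈ F, Δ.x K j

/-- The localization `K[Δ]_{x_F}`. -/
abbrev loc (K : Type u) [Field K] {n : ℕ} (Δ : FinSimplicialComplex n) (F : Finset (Fin n)) :
    Type u :=
  Localization.Away (Δ.xProd K F)

lemma isUnit_algebraMap_loc (K : Type u) [Field K] {n : ℕ} (Δ : FinSimplicialComplex n)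
    {F G : Finset (Fin n)} (h : F ⊆ G) (y : Submonoid.powers (Δ.xProd K F)) :
    IsUnit (Algebra.ofId (Δ.stanleyReisnerRing K) (Δ.loc K G) y) := by
  obtain ⟨_, m, rfl⟩ := y
  have hG : IsUnit (algebraMap (Δ.stanleyReisnerRing K) (Δ.loc K G) (Δ.xProd K G)) :=
    IsLocalization.Away.algebraMap_isUnit _
  have hd : Δ.xProd K F ∣ Δ.xProd K G := Finset.prod_dvd_prod_of_subset _ _ _ h
  have hF := isUnit_of_dvd_unit
    (map_dvd (algebraMap (Δ.stanleyReisnerRing K) (Δ.loc K G)) hd) hG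
  simpa [Algebra.ofId_apply] using hF.pow m

/-- The natural map `K[Δ]_{x_F} → K[Δ]_{x_G}` for `F ⊆ G`. -/
noncomputable def nat (K : Type u) [Field K] {n : ℕ} (Δ : FinSimplicialComplex n)
    {F G : Finset (Fin n)} (h : F ⊆ G) :
    Δ.loc K F →ₐ[Δ.stanleyReisnerRing K] Δ.loc K G :=
  IsLocalization.liftAlgHom (M := Submonoid.powers (Δ.xProd K F))
    (f := Algebra.ofId (Δ.stanleyReisnerRing K) (Δ.loc K G)) (Δ.isUnit_algebraMap_loc K h)

/-- The `t`-th term `C^t = ⨁_{|F| = t} K[Δ]_{x_F}` of the Čech complex on `x_1, …, x_n`. -/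
abbrev cech (K : Type u) [Field K] {n : ℕ} (Δ : FinSimplicialComplex n) (t : ℕ) : Type u :=
  (F : {F : Finset (Fin n) // F.card = t}) → Δ.loc K F.1

/-- Deleting an element of a set with `t + 1` elements. -/
def deleteVertex {n t : ℕ} (G : {G : Finset (Fin n) // G.card = t + 1})
    (v : {v : Fin n // v ∈ G.1}) : {F : Finset (Fin n) // F.card = t} :=
  ⟨G.1.erase v.1, by have := Finset.card_erase_add_one v.2; have := G.2; omega⟩

/-- The Čech differential `C^t → C^{t+1}`: on the components `F`, `G` with
`G = {j₀ < ⋯ < j_t}` and `F = {j₀, …, ĵₛ, …, j_t}` it is `(-1)ˢ` times the natural map. -/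
noncomputable def cechD (K : Type u) [Field K] {n : ℕ} (Δ : FinSimplicialComplex n) (t : ℕ) :
    Δ.cech K t →ₗ[Δ.stanleyReisnerRing K] Δ.cech K (t + 1) :=
  LinearMap.pi fun G => ∑ v : {v : Fin n // v ∈ G.1},
    (-1 : Δ.stanleyReisnerRing K) ^ position G.1 v.1 •
      ((Δ.nat K (F := (deleteVertex G v).1) (Finset.erase_subset v.1 G.1)).toLinearMap ∘ₗ
        LinearMap.proj (deleteVertex G v))

/-- The coboundaries in `C^i`: the image of `C^{i-1}`, which is zero for `i = 0`. -/
noncomputable def cechCoboundaries (K : Type u) [Field K] {n : ℕ} (Δ : FinSimplicialComplex n) :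
    (i : ℕ) → Submodule (Δ.stanleyReisnerRing K) (Δ.cech K i)
  | 0 => ⊥
  | i + 1 => LinearMap.range (Δ.cechD K i)

/-- The cohomology `H^i(C^•)` of the Čech complex. -/
abbrev cechCohomology (K : Type u) [Field K] {n : ℕ} (Δ : FinSimplicialComplex n) (i : ℕ) :
    Type u :=
  LinearMap.ker (Δ.cechD K i) ⧸
    (Δ.cechCoboundaries K i).submoduleOf (LinearMap.ker (Δ.cechD K i))

/-- The homogeneous component of degree `a ∈ ℤⁿ` of `K[Δ]_{x_F}`: the `K`-span of the fractions
`x^b / x_F^m` with `b - m • 1_F = a`. -/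
noncomputable def locDegree (K : Type u) [Field K] {n : ℕ} (Δ : FinSimplicialComplex n) (F : Finset (Fin n))
    (a : Fin n → ℤ) : Submodule K (Δ.loc K F) :=
  Submodule.span K {y | ∃ (b : Fin n →₀ ℕ) (m : ℕ),
    (∀ j, a j = (b j : ℤ) - if j ∈ F then (m : ℤ) else 0) ∧
    y = Localization.mk (Ideal.Quotient.mk (Δ.stanleyReisnerIdeal K) (MvPolynomial.monomial b 1))
      ⟨Δ.xProd K F ^ m, pow_mem (Submonoid.mem_powers _) m⟩}

/-- The homogeneous component of degree `a` of `C^t`. -/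
noncomputable def cechDegree (K : Type u) [Field K] {n : ℕ} (Δ : FinSimplicialComplex n) (t : ℕ)
    (a : Fin n → ℤ) : Submodule K (Δ.cech K t) :=
  Submodule.pi Set.univ fun F => Δ.locDegree K F.1 a

/-- The homogeneous component of degree `a` of `H^i(C^•)`: the classes of the cocycles that are
homogeneous of degree `a`. -/
noncomputable def cechCohomologyDegree (K : Type u) [Field K] {n : ℕ} (Δ : FinSimplicialComplex n) (i : ℕ)
    (a : Fin n → ℤ) : Submodule K (Δ.cechCohomology K i) :=
  ((Δ.cechDegree K i a).comap ((LinearMap.ker (Δ.cechD K i)).subtype.restrictScalars K)).map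
    (((Δ.cechCoboundaries K i).submoduleOf (LinearMap.ker (Δ.cechD K i))).mkQ.restrictScalars K)

/-- The homogeneous component `H^i_𝔪(K[Δ])_a` for the `ℤⁿ`-grading that an isomorphism
`H^i_𝔪(K[Δ]) ≅ H^i(C^•)` carries over from the Čech complex. -/
noncomputable def localCohDegree (K : Type u) [Field K] {n : ℕ} (Δ : FinSimplicialComplex n) (i : ℕ)
    (φ : Δ.LocalCoh K i ≃ₗ[Δ.stanleyReisnerRing K] Δ.cechCohomology K i) (a : Fin n → ℤ) :
    Submodule K (Δ.LocalCoh K i) :=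
  (Δ.cechCohomologyDegree K i a).comap (φ.toLinearMap.restrictScalars K)

end FinSimplicialComplex

/-! ### Formal series -/

/-- The multigraded Hilbert series `∑_{a ∈ ℤⁿ} (dim_K M_a) t^a` of a `ℤⁿ`-graded vector space with
components `M a`, as the function that sends `a` to the coefficient of `t^a`. -/
noncomputable def hilbertSeries (K : Type u) [Field K] {n : ℕ} {V : Type u} [AddCommGroup V]
    [Module K V] (M : (Fin n → ℤ) → Submodule K V) : (Fin n → ℤ) → ℚ :=
  fun a => (Module.finrank K (M a) : ℚ)

/-- A formal power series in `n` variables, read as a formal series in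
`t_1⁻¹, …, t_n⁻¹`: the variable `X_j` becomes `t_j⁻¹`. The value at `a ∈ ℤⁿ` is the coefficient of
`t^a`. -/
noncomputable def seriesInInverses {n : ℕ} (f : MvPowerSeries (Fin n) ℚ) : (Fin n → ℤ) → ℚ :=
  fun a => if ∀ j, a j ≤ 0 then
    MvPowerSeries.coeff (Finsupp.equivFunOnFinite.symm fun j => (-a j).toNat) f else 0

/-! Two independent facts are combined.

The first concerns a Noetherian ring `R` and finitely many elements `x`: local cohomology at the
ideal they generate is Čech cohomology (`Cech.nonempty_localCohomology_equiv`). In degree 0 both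
theories give the torsion submodule. If `M` is embedded in an injective module `E` with cokernel
`N`, then in both theories degree `i + 1` of `M` is the cokernel of degree `i` of `E` mapping to
degree `i` of `N`, as soon as degree `i + 1` of `E` vanishes; induction on `i` does the rest. For
the direct limit of Ext modules the vanishing is immediate, and the connecting map comes from
`Ext_covariant_sequence`. For the Čech complex it is `Cech.exists_totalD_eq`, an induction on the
variables. That induction rests on `exists_torsion_pow_smul_eq`: the torsion submodule of an
injective module surjects onto its localization at any element, by Artin–Rees and the extension
property. The isomorphism is not asked to be canonical, because the grading is defined on the Čech
side and the series is computed for an arbitrary isomorphism.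

The second fact is a count of monomials. The degree `a` part of `K[Δ]_{x_F}` is spanned by one
monomial. It is nonzero exactly when `F` contains the negative support of `a` and `F ∪ supp a` is a
face (`IsDegree`). Vanishing is seen after multiplying numerator and denominator by `x_F`;
nonvanishing is detected in the Laurent polynomial ring after killing the variables outside the
face. Hence the degree `a` strand of the Čech complex is a finite complex of functions on such sets
`F`, with incidence numbers as matrix entries. If some `a v > 0`, the condition on `F` does not see
`v`, and toggling `v` gives a contracting homotopy (`eq_sum_degreeHomotopy`). If `a ≤ 0` with
support `S`, the sets are `S ∪ G` with `G` in the link of `S`. After the change of signs `linkSign`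
the differentials become the transposes of the boundary maps of the link (`finrank_range_degreeD`).
Comparing ranks gives the reduced homology of the link in degree `i - |S| - 1`.

On the other side, the coefficient of a monomial in the product indexed by `F` is 1 if its support
is `F` and 0 otherwise (`MvPowerSeries.coeff_prod_X_mul_inv`), so only `F = supp a` contributes. -/

open CategoryTheory Limits

/-! ### Connecting morphisms for a short exact sequence of functors -/

namespace CategoryTheory

section LeftDerivedDelta

variable {C : Type*} [Category* C] {D : Type*} [Category* D] [Abelian C]
  [Abelian D] {F₁ F₂ F₃ : C ⥤ D} [F₁.Additive] [F₂.Additive]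
  [F₃.Additive] (α : F₁ ⟶ F₂) (β : F₂ ⟶ F₃) (zero : α ≫ β = 0)

/-- The short complex of chain complexes obtained by applying three functors to a complex. -/
@[simps]
def mapChainShortComplex (P : ChainComplex C ℕ) : ShortComplex (ChainComplex D ℕ) where
  X₁ := (F₁.mapHomologicalComplex _).obj P
  X₂ := (F₂.mapHomologicalComplex _).obj P
  X₃ := (F₃.mapHomologicalComplex _).obj P
  f := (NatTrans.mapHomologicalComplex α _).app P
  g := (NatTrans.mapHomologicalComplex β _).app P
  zero := by
    ext i
    exact congr_app zero (P.X i)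

/-- Functoriality of `mapChainShortComplex` in the complex. -/
@[simps]
def mapChainShortComplexMap {P Q : ChainComplex C ℕ} (φ : P ⟶ Q) :
    mapChainShortComplex α β zero P ⟶ mapChainShortComplex α β zero Q where
  τ₁ := (F₁.mapHomologicalComplex _).map φ
  τ₂ := (F₂.mapHomologicalComplex _).map φ
  τ₃ := (F₃.mapHomologicalComplex _).map φ
  comm₁₂ := ((NatTrans.mapHomologicalComplex α _).naturality φ)
  comm₂₃ := ((NatTrans.mapHomologicalComplex β _).naturality φ)

lemma mapChainShortComplex_shortExact (h : ∀ (X : C) [Projective X],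
    (ShortComplex.mk (α.app X) (β.app X) (congr_app zero X)).ShortExact)
    {X : C} (P : ProjectiveResolution X) :
    (mapChainShortComplex α β zero P.complex).ShortExact :=
  HomologicalComplex.shortExact_of_degreewise_shortExact _ fun i =>
    have := P.projective i
    h (P.complex.X i)

variable (h : ∀ (X : C) [Projective X],
  (ShortComplex.mk (α.app X) (β.app X) (congr_app zero X)).ShortExact)

/-- The connecting morphism of `mapChainShortComplex` for a projective resolution. -/
noncomputable def resolutionDelta {X : C} (P : ProjectiveResolution X) (n : ℕ) :
    (HomologicalComplex.homologyFunctor D _ (n + 1)).obj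
      ((F₃.mapHomologicalComplex (ComplexShape.down ℕ)).obj P.complex) ⟶
    (HomologicalComplex.homologyFunctor D _ n).obj
      ((F₁.mapHomologicalComplex (ComplexShape.down ℕ)).obj P.complex) :=
  (mapChainShortComplex_shortExact α β zero h P).δ (n + 1) n (by simp)

lemma resolutionDelta_naturality {X Y : C} (P : ProjectiveResolution X)
    (Q : ProjectiveResolution Y) (φ : P.complex ⟶ Q.complex) (n : ℕ) :
    (F₃.mapHomologicalComplex _ ⋙ HomologicalComplex.homologyFunctor _ _ (n + 1)).map φ ≫
      resolutionDelta α β zero h Q n =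
    resolutionDelta α β zero h P n ≫
      (F₁.mapHomologicalComplex _ ⋙ HomologicalComplex.homologyFunctor _ _ n).map φ :=
  (HomologicalComplex.HomologySequence.δ_naturality (mapChainShortComplexMap α β zero φ)
    (mapChainShortComplex_shortExact α β zero h P)
    (mapChainShortComplex_shortExact α β zero h Q) (n + 1) n (by simp)).symm

lemma resolutionDelta_comp {X : C} (P : ProjectiveResolution X) (n : ℕ) :
    resolutionDelta α β zero h P n ≫
      (HomologicalComplex.homologyFunctor D (ComplexShape.down ℕ) n).map
        ((NatTrans.mapHomologicalComplex α _).app P.complex) = 0 :=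
  (mapChainShortComplex_shortExact α β zero h P).δ_comp (n + 1) n (by simp)

lemma resolutionDelta_exact {X : C} (P : ProjectiveResolution X) (n : ℕ) :
    (ShortComplex.mk _ _ (resolutionDelta_comp α β zero h P n)).Exact :=
  (mapChainShortComplex_shortExact α β zero h P).homology_exact₁ (n + 1) n (by simp)

variable [HasProjectiveResolutions C]

/-- The connecting morphism between left derived functors of a sequence of functors that is short
exact on projective objects. -/
noncomputable def leftDerivedDelta (n : ℕ) : F₃.leftDerived (n + 1) ⟶ F₁.leftDerived n where
  app X := ((projectiveResolution X).isoLeftDerivedObj F₃ (n + 1)).hom ≫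
    resolutionDelta α β zero h (projectiveResolution X) n ≫
      ((projectiveResolution X).isoLeftDerivedObj F₁ n).inv
  naturality X Y f := by
    have hφ := ProjectiveResolution.lift_commutes_zero f (projectiveResolution X)
      (projectiveResolution Y)
    rw [ProjectiveResolution.isoLeftDerivedObj_hom_naturality_assoc f _ _ _ hφ F₃ (n + 1),
      reassoc_of% resolutionDelta_naturality, Category.assoc, Category.assoc,
      ProjectiveResolution.isoLeftDerivedObj_inv_naturality f _ _ _ hφ F₁ n]
    rfl

lemma leftDerivedDelta_comp (n : ℕ) :
    leftDerivedDelta α β zero h n ≫ NatTrans.leftDerived α n = 0 := by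
  ext X
  rw [NatTrans.comp_app, ProjectiveResolution.leftDerived_app_eq α (projectiveResolution X)]
  simp only [leftDerivedDelta, Category.assoc, Iso.inv_hom_id_assoc]
  rw [reassoc_of% resolutionDelta_comp]
  simp

lemma leftDerivedDelta_exact (n : ℕ) (X : C) :
    (ShortComplex.mk ((leftDerivedDelta α β zero h n).app X) ((NatTrans.leftDerived α n).app X)
      (congr_app (leftDerivedDelta_comp α β zero h n) X)).Exact := by
  refine (ShortComplex.exact_iff_of_iso ?_).2
    (resolutionDelta_exact α β zero h (projectiveResolution X) n)
  refine ShortComplex.isoMk ((projectiveResolution X).isoLeftDerivedObj F₃ (n + 1))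
    ((projectiveResolution X).isoLeftDerivedObj F₁ n)
    ((projectiveResolution X).isoLeftDerivedObj F₂ n) ?_ ?_
  · simp only [leftDerivedDelta, Category.assoc, Iso.inv_hom_id, Category.comp_id]
  · simp only [ProjectiveResolution.leftDerived_app_eq α (projectiveResolution X),
      Category.assoc, Iso.inv_hom_id, Category.comp_id]

/-- The term preceding the connecting morphism in the long exact sequence is the one assumed to
vanish. In the opposite category this becomes surjectivity of the connecting map of Ext. -/
lemma leftDerivedDelta_mono (n : ℕ) (X : C) (h0 : IsZero ((F₂.leftDerived (n + 1)).obj X)) :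
    Mono ((leftDerivedDelta α β zero h n).app X) := by
  have : Mono (resolutionDelta α β zero h (projectiveResolution X) n) :=
    ShortComplex.ShortExact.mono_δ _ _ _ _
      (h0.of_iso ((projectiveResolution X).isoLeftDerivedObj F₂ (n + 1)).symm)
  dsimp only [leftDerivedDelta]
  infer_instance

/-- The transformation `F.leftDerived 0 ⟶ F` is natural in `F`. -/
lemma leftDerived_comp_fromLeftDerivedZero :
    NatTrans.leftDerived α 0 ≫ F₂.fromLeftDerivedZero = F₁.fromLeftDerivedZero ≫ α := by
  ext X
  let P := projectiveResolution X
  have h : HomologicalComplex.opcyclesMap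
      ((NatTrans.mapHomologicalComplex α (ComplexShape.down ℕ)).app P.complex) 0 ≫
        P.fromLeftDerivedZero' F₂ = P.fromLeftDerivedZero' F₁ ≫ α.app X := by
    rw [← cancel_epi (HomologicalComplex.pOpcycles _ _), HomologicalComplex.p_opcyclesMap_assoc,
      P.pOpcycles_comp_fromLeftDerivedZero', P.pOpcycles_comp_fromLeftDerivedZero'_assoc]
    exact (α.naturality _).symm
  have h' : (HomologicalComplex.homologyFunctor D (ComplexShape.down ℕ) 0).map
      ((NatTrans.mapHomologicalComplex α _).app P.complex) ≫
        (ChainComplex.isoHomologyι₀ _).hom = (ChainComplex.isoHomologyι₀ _).hom ≫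
      HomologicalComplex.opcyclesMap
        ((NatTrans.mapHomologicalComplex α (ComplexShape.down ℕ)).app P.complex) 0 :=
    HomologicalComplex.homologyι_naturality _ 0
  rw [NatTrans.comp_app, NatTrans.comp_app, P.leftDerived_app_eq α, P.fromLeftDerivedZero_eq,
    P.fromLeftDerivedZero_eq]
  simp only [Category.assoc, Iso.inv_hom_id_assoc]
  refine congrArg (fun z => (P.isoLeftDerivedObj F₁ 0).hom ≫ z) ?_
  exact (Category.assoc _ _ _).symm.trans ((congrArg (fun z => z ≫ P.fromLeftDerivedZero' F₂)
    h').trans ((Category.assoc _ _ _).trans ((congrArg (fun z =>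
      (ChainComplex.isoHomologyι₀ _).hom ≫ z) h).trans (Category.assoc _ _ _).symm)))

end LeftDerivedDelta

end CategoryTheory

open CategoryTheory Limits Opposite

/-! ### Exactness of filtered colimits of modules -/

section ColimitQuotient

instance ModuleCat.forget_preservesFilteredColimitsOfSize_zero (R : Type u) [CommRing R] :
    PreservesFilteredColimitsOfSize.{0, 0} (forget (ModuleCat.{u} R)) :=
  preservesSmallestFilteredColimits_of_preservesFilteredColimits _

variable {R : Type u} [CommRing R] {J : Type} [SmallCategory J] [IsFiltered J]
  {A B C : J ⥤ ModuleCat.{u} R} (a : A ⟶ B) (b : B ⟶ C)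

lemma colimMap_surjective (hb : ∀ j, Function.Surjective (b.app j)) :
    Function.Surjective (colimMap b) := by
  intro z
  obtain ⟨j, y, rfl⟩ := Concrete.colimit_exists_rep C z
  obtain ⟨x, rfl⟩ := hb j y
  refine ⟨colimit.ι B j x, ?_⟩
  rw [← ConcreteCategory.comp_apply, ι_colimMap, ConcreteCategory.comp_apply]

/-- Every element of the colimit comes from a stage, and a relation that holds in the colimit
already holds at some later stage, where exactness applies. -/
lemma colimMap_ker (h : ∀ j, Function.Exact (a.app j) (b.app j)) :
    LinearMap.ker (colimMap b).hom = LinearMap.range (colimMap a).hom := by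
  ext z
  constructor
  · intro hz
    obtain ⟨j, y, rfl⟩ := Concrete.colimit_exists_rep B z
    have hz' : colimit.ι C j (b.app j y) = colimit.ι C j 0 := by
      rw [map_zero, ← ConcreteCategory.comp_apply, ← ι_colimMap]
      exact hz
    obtain ⟨k, f, g, hk⟩ := Concrete.colimit_exists_of_rep_eq C _ _ hz'
    rw [map_zero, ← ConcreteCategory.comp_apply, ← b.naturality, ConcreteCategory.comp_apply] at hk
    obtain ⟨x, hx⟩ := (h k _).1 hk
    refine ⟨colimit.ι A k x, ?_⟩
    change (colimMap a) _ = _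
    rw [← ConcreteCategory.comp_apply, ι_colimMap, ConcreteCategory.comp_apply, hx,
      ← ConcreteCategory.comp_apply, colimit.w]
  · rintro ⟨w, rfl⟩
    obtain ⟨j, x, rfl⟩ := Concrete.colimit_exists_rep A w
    have h1 : colimMap a (colimit.ι A j x) = colimit.ι B j (a.app j x) := by
      rw [← ConcreteCategory.comp_apply, ι_colimMap, ConcreteCategory.comp_apply]
    have h2 : colimMap b (colimit.ι B j (a.app j x)) = colimit.ι C j (b.app j (a.app j x)) := by
      rw [← ConcreteCategory.comp_apply, ι_colimMap, ConcreteCategory.comp_apply]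
    change (colimMap b) ((colimMap a) _) = 0
    rw [h1, h2, (h j _).2 ⟨x, rfl⟩, map_zero]

/-- Filtered colimits of modules commute with cokernels. -/
lemma nonempty_colimit_equiv_quotient (h : ∀ j, Function.Exact (a.app j) (b.app j))
    (hb : ∀ j, Function.Surjective (b.app j)) :
    Nonempty ((colimit C : ModuleCat.{u} R) ≃ₗ[R]
      (colimit B : ModuleCat.{u} R) ⧸ LinearMap.range (colimMap a).hom) :=
  ⟨((Submodule.quotEquivOfEq _ _ (colimMap_ker a b h).symm).trans
    ((colimMap b).hom.quotKerEquivOfSurjective (colimMap_surjective b hb))).symm⟩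

end ColimitQuotient

/-! ### The long exact sequence of Ext in the second variable -/

section ExtSequence

variable {R : Type u} [CommRing R]

/-- The functor `Hom(-, M)`, with values in the opposite category. -/
noncomputable abbrev homOp (M : ModuleCat.{u} R) : ModuleCat.{u} R ⥤ (ModuleCat.{u} R)ᵒᵖ :=
  ((linearYoneda R (ModuleCat.{u} R)).obj M).rightOp

/-- The transformation `Hom(-, N) ⟶ Hom(-, M)` in the opposite category induced by `M ⟶ N`. -/
noncomputable abbrev homOpMap {M N : ModuleCat.{u} R} (f : M ⟶ N) : homOp N ⟶ homOp M :=
  NatTrans.rightOp ((linearYoneda R (ModuleCat.{u} R)).map f)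

lemma homOpMap_comp_zero (S : ShortComplex (ModuleCat.{u} R)) :
    homOpMap S.g ≫ homOpMap S.f = 0 := by
  ext X
  apply Quiver.Hom.unop_inj
  ext (φ : X ⟶ S.X₁)
  change (φ ≫ S.f) ≫ S.g = 0
  simp

lemma homOp_shortExact {S : ShortComplex (ModuleCat.{u} R)} (hS : S.ShortExact)
    (X : ModuleCat.{u} R) [Projective X] :
    (ShortComplex.mk ((homOpMap S.g).app X) ((homOpMap S.f).app X)
      (congr_app (homOpMap_comp_zero S) X)).ShortExact := by
  have := hS.mono_f
  have := hS.epi_g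
  have key : (ShortComplex.mk (((linearYoneda R (ModuleCat.{u} R)).map S.f).app (op X))
      (((linearYoneda R (ModuleCat.{u} R)).map S.g).app (op X))
      (congrArg Quiver.Hom.unop (congr_app (homOpMap_comp_zero S) X))).ShortExact := by
    refine { exact := ?_, mono_f := ?_, epi_g := ?_ }
    · rw [ShortComplex.moduleCat_exact_iff]
      intro (φ : X ⟶ S.X₂) (hφ : φ ≫ S.g = 0)
      exact ⟨hS.exact.lift φ hφ, hS.exact.lift_f φ hφ⟩
    · rw [ModuleCat.mono_iff_injective]
      intro (φ : X ⟶ S.X₁) (ψ : X ⟶ S.X₁) (h : φ ≫ S.f = ψ ≫ S.f)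
      exact (cancel_mono S.f).1 h
    · rw [ModuleCat.epi_iff_surjective]
      intro (φ : X ⟶ S.X₃)
      exact ⟨Projective.factorThru φ S.g, Projective.factorThru_comp φ S.g⟩
  exact key.op

/-- Ext is computed here from a projective resolution of the first argument. A cocycle vanishes on
the image of the next differential, so by exactness and injectivity of `E` it extends along the
previous one and is a coboundary. -/
lemma isZero_Ext_succ_of_injective (X E : ModuleCat.{u} R) [Injective E] (n : ℕ) :
    IsZero (((Ext R (ModuleCat.{u} R) (n + 1)).obj (op X)).obj E) := by
  let P := projectiveResolution X
  refine IsZero.of_iso ?_ (P.isoExt (R := R) (n + 1) E)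
  rw [← HomologicalComplex.exactAt_iff_isZero_homology,
    HomologicalComplex.exactAt_iff' _ n (n + 1) (n + 2) (by simp) (by simp),
    ShortComplex.moduleCat_exact_iff]
  intro (φ : P.complex.X (n + 1) ⟶ E) (hφ : P.complex.d (n + 2) (n + 1) ≫ φ = 0)
  have hP := P.exact_succ n
  exact ⟨hP.descToInjective φ hφ, hP.comp_descToInjective φ hφ⟩

/-- Ext is the left derived functor of `Hom(-, M)` with values in the opposite category. A short
exact sequence in the second variable is therefore a sequence of functors, short exact on
projectives, and its connecting morphism is natural in the first variable. That naturality is what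
makes `δ` a map of directed systems. -/
lemma Ext_covariant_sequence {S : ShortComplex (ModuleCat.{u} R)} (hS : S.ShortExact)
    [Injective S.X₂] (n : ℕ) :
    ∃ δ : (Ext R (ModuleCat.{u} R) n).flip.obj S.X₃ ⟶
        (Ext R (ModuleCat.{u} R) (n + 1)).flip.obj S.X₁,
      ∀ X, Function.Exact (((Ext R (ModuleCat.{u} R) n).flip.map S.g).app X) (δ.app X) ∧
        Function.Surjective (δ.app X) := by
  refine ⟨NatTrans.leftOp (leftDerivedDelta (homOpMap S.g) (homOpMap S.f) (homOpMap_comp_zero S)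
    (homOp_shortExact hS) n), fun X => ⟨?_, ?_⟩⟩
  · have := (leftDerivedDelta_exact (homOpMap S.g) (homOpMap S.f) (homOpMap_comp_zero S)
      (homOp_shortExact hS) n X.unop).unop
    exact (ShortComplex.ShortExact.moduleCat_exact_iff_function_exact _).1 this
  · have h0 : IsZero (((homOp S.X₂).leftDerived (n + 1)).obj X.unop) :=
      (isZero_Ext_succ_of_injective X.unop S.X₂ n).op
    have := leftDerivedDelta_mono (homOpMap S.g) (homOpMap S.f) (homOpMap_comp_zero S)
      (homOp_shortExact hS) n X.unop h0
    rw [← ModuleCat.epi_iff_surjective]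
    exact unop_epi_of_mono ((leftDerivedDelta (homOpMap S.g) (homOpMap S.f) (homOpMap_comp_zero S)
      (homOp_shortExact hS) n).app X.unop)

end ExtSequence

/-! ### Ext in degree zero -/

section ExtZero

variable {R : Type u} [CommRing R]

instance linearYoneda_obj_preservesLimits (M : ModuleCat.{u} R) :
    PreservesLimits ((linearYoneda R (ModuleCat.{u} R)).obj M) :=
  have : PreservesLimits ((linearYoneda R (ModuleCat.{u} R)).obj M ⋙ forget (ModuleCat.{u} R)) :=
    (inferInstance : PreservesLimits (yoneda.obj M))
  preservesLimits_of_reflects_of_preserves _ (forget _)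

/-- Viewed in the opposite category, `Hom(-, M)` is right exact; this makes the comparison
`fromLeftDerivedZero` an isomorphism. -/
instance homOp_preservesFiniteColimits (M : ModuleCat.{u} R) :
    PreservesFiniteColimits (homOp M) :=
  preservesFiniteColimits_rightOp _

/-- The comparison `Hom(X, M) ⟶ Ext⁰(X, M)`. -/
noncomputable def homToExtZero (M : ModuleCat.{u} R) :
    (linearYoneda R (ModuleCat.{u} R)).obj M ⟶ (Ext R (ModuleCat.{u} R) 0).flip.obj M :=
  NatTrans.leftOp (homOp M).fromLeftDerivedZero

instance homToExtZero_isIso (M : ModuleCat.{u} R) : IsIso (homToExtZero M) := by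
  have h (X) : IsIso ((homToExtZero M).app X) := by
    have : IsIso ((homOp M).fromLeftDerivedZero.app X.unop) := inferInstance
    exact (isIso_unop_iff ((homOp M).fromLeftDerivedZero.app X.unop)).2 this
  exact NatIso.isIso_of_isIso_app _

lemma homToExtZero_naturality {M N : ModuleCat.{u} R} (f : M ⟶ N) :
    homToExtZero M ≫ (Ext R (ModuleCat.{u} R) 0).flip.map f =
      (linearYoneda R (ModuleCat.{u} R)).map f ≫ homToExtZero N := by
  ext X : 2
  exact congrArg Quiver.Hom.unop
    (congr_app (leftDerived_comp_fromLeftDerivedZero (homOpMap f)) X.unop)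

end ExtZero

/-! ### Local cohomology as a direct limit, and torsion in degree zero -/

namespace localCohomology

variable {R : Type u} [CommRing R] (J : Ideal R)

/-- The directed system of the modules `Extⁱ(R/Jᵗ, M)`. -/
noncomputable abbrev extSystem (i : ℕ) (M : ModuleCat.{u} R) : (ℕᵒᵖ)ᵒᵖ ⥤ ModuleCat.{u} R :=
  (ringModIdeals (idealPowersDiagram J)).op ⋙ (Ext R (ModuleCat.{u} R) i).flip.obj M

/-- The map of directed systems induced by a linear map. -/
noncomputable abbrev extSystemMap (i : ℕ) {M N : ModuleCat.{u} R} (f : M ⟶ N) :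
    extSystem J i M ⟶ extSystem J i N :=
  Functor.whiskerLeft _ ((Ext R (ModuleCat.{u} R) i).flip.map f)

/-- Local cohomology of `M` is the direct limit of the `Extⁱ(R/Jᵗ, M)`. -/
noncomputable def objIsoColimit (i : ℕ) (M : ModuleCat.{u} R) :
    (localCohomology J i).obj M ≅ colimit (extSystem J i M) :=
  colimitObjIsoColimitCompEvaluation (diagram (idealPowersDiagram J) i) M

lemma nonempty_colimit_extSystem_succ {S : ShortComplex (ModuleCat.{u} R)} (hS : S.ShortExact)
    [Injective S.X₂] (i : ℕ) :
    Nonempty ((colimit (extSystem J (i + 1) S.X₁) : ModuleCat.{u} R) ≃ₗ[R]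
      (colimit (extSystem J i S.X₃) : ModuleCat.{u} R) ⧸
        LinearMap.range (colimMap (extSystemMap J i S.g)).hom) := by
  obtain ⟨δ, hδ⟩ := Ext_covariant_sequence hS i
  exact nonempty_colimit_equiv_quotient (extSystemMap J i S.g) (Functor.whiskerLeft _ δ)
    (fun j => (hδ _).1) (fun j => (hδ _).2)

lemma subsingleton_colimit_extSystem_succ (E : ModuleCat.{u} R) [Injective E] (i : ℕ) :
    Subsingleton (colimit (extSystem J (i + 1) E) : ModuleCat.{u} R) := by
  refine subsingleton_of_forall_eq 0 fun z => ?_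
  obtain ⟨j, y, rfl⟩ := Concrete.colimit_exists_rep _ z
  have := ModuleCat.subsingleton_of_isZero (isZero_Ext_succ_of_injective
    ((ringModIdeals (idealPowersDiagram J)).obj j.unop) E i)
  have hy : y = 0 := Subsingleton.elim (α := (((Ext R (ModuleCat.{u} R) (i + 1)).obj
    (op ((ringModIdeals (idealPowersDiagram J)).obj j.unop))).obj E)) _ _
  rw [hy, map_zero]

/-- The directed system of the modules `Hom(R/Jᵗ, M)`. -/
noncomputable abbrev homSystem (M : ModuleCat.{u} R) : (ℕᵒᵖ)ᵒᵖ ⥤ ModuleCat.{u} R :=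
  (ringModIdeals (idealPowersDiagram J)).op ⋙ (linearYoneda R (ModuleCat.{u} R)).obj M

/-- Evaluation at `1` on the modules `Hom(R/Jᵗ, M)`. -/
noncomputable def evalOneCocone (M : ModuleCat.{u} R) : Cocone (homSystem J M) where
  pt := M
  ι :=
    { app := fun t => ModuleCat.ofHom
        { toFun := fun (φ : (ringModIdeals (idealPowersDiagram J)).obj t.unop ⟶ M) =>
            φ (Ideal.Quotient.mk _ 1)
          map_add' := fun _ _ => rfl
          map_smul' := fun _ _ => rfl }
      naturality := fun s t f => by
        ext
        rfl }

/-- Evaluation at `1` on `Hom(R/Jᵗ, M)`. -/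
noncomputable def evalOneAt (M : ModuleCat.{u} R) (t : (ℕᵒᵖ)ᵒᵖ) : (homSystem J M).obj t ⟶ M :=
  (evalOneCocone J M).ι.app t

/-- The map from the direct limit of the `Hom(R/Jᵗ, M)` to `M`. -/
noncomputable def evalOne (M : ModuleCat.{u} R) : colimit (homSystem J M) ⟶ M :=
  colimit.desc _ (evalOneCocone J M)

lemma ι_evalOne (M : ModuleCat.{u} R) (t : (ℕᵒᵖ)ᵒᵖ) :
    colimit.ι (homSystem J M) t ≫ evalOne J M = evalOneAt J M t :=
  colimit.ι_desc _ _

lemma evalOne_ι (M : ModuleCat.{u} R) (t : (ℕᵒᵖ)ᵒᵖ)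
    (φ : (homSystem J M).obj t) :
    evalOne J M (colimit.ι (homSystem J M) t φ) = evalOneAt J M t φ := by
  rw [← ConcreteCategory.comp_apply, ι_evalOne]

/-- The elements killed by a power of `J`. -/
def torsion (M : Type*) [AddCommGroup M] [Module R M] : Submodule R M where
  carrier := {m | ∃ t : ℕ, ∀ r ∈ J ^ t, r • m = 0}
  zero_mem' := ⟨0, fun r _ => smul_zero r⟩
  add_mem' := by
    rintro a b ⟨s, hs⟩ ⟨t, ht⟩
    refine ⟨s + t, fun r hr => ?_⟩
    rw [smul_add, hs r (Ideal.pow_le_pow_right (Nat.le_add_right _ _) hr),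
      ht r (Ideal.pow_le_pow_right (Nat.le_add_left _ _) hr), add_zero]
  smul_mem' := by
    rintro c a ⟨s, hs⟩
    exact ⟨s, fun r hr => by rw [smul_comm, hs r hr, smul_zero]⟩

lemma evalOneAt_injective (M : ModuleCat.{u} R) (t : (ℕᵒᵖ)ᵒᵖ) :
    Function.Injective (evalOneAt J M t) := by
  intro (φ : ModuleCat.of R (R ⧸ J ^ t.unop.unop) ⟶ M) (ψ : ModuleCat.of R (R ⧸ J ^ t.unop.unop) ⟶ M)
    (h : φ (Ideal.Quotient.mk _ 1) = ψ (Ideal.Quotient.mk _ 1))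
  apply ModuleCat.hom_ext
  apply LinearMap.ext
  intro x
  obtain ⟨r, rfl⟩ := Ideal.Quotient.mk_surjective x
  have hr : (Ideal.Quotient.mk (J ^ t.unop.unop) r) = r • Ideal.Quotient.mk (J ^ t.unop.unop) 1 := by
    rw [← Ideal.Quotient.mkₐ_eq_mk R, ← map_smul, smul_eq_mul, mul_one]
  rw [hr, map_smul, map_smul]
  exact congrArg (r • ·) h

lemma range_evalOneAt (M : ModuleCat.{u} R) (t : (ℕᵒᵖ)ᵒᵖ) (m : M) :
    m ∈ LinearMap.range (evalOneAt J M t).hom ↔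
      ∀ r ∈ J ^ t.unop.unop, r • m = 0 := by
  constructor
  · rintro ⟨(φ : ModuleCat.of R (R ⧸ J ^ t.unop.unop) ⟶ M), rfl⟩ r hr
    change r • φ (Ideal.Quotient.mk _ 1) = 0
    rw [← map_smul]
    have : r • Ideal.Quotient.mk (J ^ t.unop.unop) 1 = 0 := by
      rw [← Ideal.Quotient.mkₐ_eq_mk R, ← map_smul, smul_eq_mul, mul_one]
      exact Ideal.Quotient.eq_zero_iff_mem.2 hr
    exact (congrArg φ this).trans (map_zero _)
  · intro h
    refine ⟨ModuleCat.ofHom (X := R ⧸ J ^ t.unop.unop) (Submodule.liftQ (J ^ t.unop.unop)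
      (LinearMap.toSpanSingleton R M m) fun r hr => h r hr), ?_⟩
    exact one_smul R m

/-- A map out of `R/Jᵗ` is determined by its value at 1, so the cocone is injective at every stage,
and hence on the direct limit. -/
lemma evalOne_injective (M : ModuleCat.{u} R) : Function.Injective (evalOne J M) := by
  rw [injective_iff_map_eq_zero]
  intro z hz
  obtain ⟨t, φ, rfl⟩ := Concrete.colimit_exists_rep _ z
  rw [evalOne_ι] at hz
  rw [(injective_iff_map_eq_zero _).1 (evalOneAt_injective J M t) φ hz, map_zero]

lemma range_evalOne (M : ModuleCat.{u} R) :
    LinearMap.range (evalOne J M).hom = torsion J M := by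
  ext m
  constructor
  · rintro ⟨z, rfl⟩
    obtain ⟨t, φ, rfl⟩ := Concrete.colimit_exists_rep _ z
    refine ⟨t.unop.unop, (range_evalOneAt J M t _).1 ⟨φ, ?_⟩⟩
    exact (evalOne_ι J M t φ).symm
  · rintro ⟨t, ht⟩
    obtain ⟨φ, hφ⟩ := (range_evalOneAt J M (op (op t)) m).2 ht
    exact ⟨colimit.ι (homSystem J M) _ φ, (evalOne_ι J M _ φ).trans hφ⟩

/-- The map from `colim Ext⁰(R/Jᵗ, M)` to `M`. -/
noncomputable def extZeroEval (M : ModuleCat.{u} R) : colimit (extSystem J 0 M) ⟶ M :=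
  colimMap (Functor.whiskerLeft _ (inv (homToExtZero M))) ≫ evalOne J M

lemma ι_extZeroEval (M : ModuleCat.{u} R) (t : (ℕᵒᵖ)ᵒᵖ) :
    colimit.ι (extSystem J 0 M) t ≫ extZeroEval J M =
      (inv (homToExtZero M)).app ((ringModIdeals (idealPowersDiagram J)).op.obj t) ≫
        evalOneAt J M t := by
  rw [extZeroEval, ι_colimMap_assoc, ι_evalOne]
  rfl

/-- Needed in the step from degree 0 to degree 1 of the comparison, where the induced map itself,
and not only its source and target, has to be identified on both sides. -/
lemma extZeroEval_naturality {M N : ModuleCat.{u} R} (f : M ⟶ N) :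
    colimMap (extSystemMap J 0 f) ≫ extZeroEval J N = extZeroEval J M ≫ f := by
  apply colimit.hom_ext
  intro t
  have h : (Ext R (ModuleCat.{u} R) 0).flip.map f ≫ inv (homToExtZero N) =
      inv (homToExtZero M) ≫ (linearYoneda R (ModuleCat.{u} R)).map f := by
    rw [IsIso.comp_inv_eq, Category.assoc, ← homToExtZero_naturality, IsIso.inv_hom_id_assoc]
  have h' := congr_app h ((ringModIdeals (idealPowersDiagram J)).op.obj t)
  rw [ι_colimMap_assoc, ι_extZeroEval, ← Category.assoc (colimit.ι _ _), ι_extZeroEval]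
  exact congrArg (fun z => z ≫ evalOneAt J N t) h'

lemma colimMap_inv_homToExtZero_bijective (M : ModuleCat.{u} R) :
    Function.Bijective (colimMap (Functor.whiskerLeft (ringModIdeals (idealPowersDiagram J)).op
      (inv (homToExtZero M)))) :=
  have : IsIso (colimMap (Functor.whiskerLeft (ringModIdeals (idealPowersDiagram J)).op
      (inv (homToExtZero M)))) :=
    inferInstanceAs (IsIso (colim.map (Functor.whiskerLeft
      (ringModIdeals (idealPowersDiagram J)).op (inv (homToExtZero M)))))
  ConcreteCategory.bijective_of_isIso _

lemma extZeroEval_injective (M : ModuleCat.{u} R) : Function.Injective (extZeroEval J M) :=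
  (evalOne_injective J M).comp (colimMap_inv_homToExtZero_bijective J M).1

lemma range_extZeroEval (M : ModuleCat.{u} R) :
    LinearMap.range (extZeroEval J M).hom = torsion J M := by
  rw [← range_evalOne]
  exact LinearMap.range_comp_of_range_eq_top _
    (LinearMap.range_eq_top.2 (colimMap_inv_homToExtZero_bijective J M).2)

end localCohomology

/-! ### Signs and the Čech complex of a module -/

namespace FinSimplicialComplex

lemma position_erase {n : ℕ} {G : Finset (Fin n)} {v : Fin n} (hv : v ∈ G) (u : Fin n) :
    position G u = position (G.erase v) u + if v < u then 1 else 0 := by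
  unfold position
  rw [Finset.filter_erase]
  split_ifs with h
  · exact (Finset.card_erase_add_one (Finset.mem_filter.2 ⟨hv, h⟩)).symm
  · rw [Finset.erase_eq_of_notMem (show v ∉ G.filter (· < u) from
      fun h' => h (Finset.mem_filter.1 h').2), add_zero]

/-- Deleting the smaller of two vertices lowers the position of the larger by one, while deleting
the larger leaves the smaller in place; this one shift gives the minus sign. -/
lemma sign_erase_comm {A : Type*} [CommRing A] {n : ℕ} {G : Finset (Fin n)} {u v : Fin n}
    (hu : u ∈ G) (hv : v ∈ G) (huv : u ≠ v) :
    (-1 : A) ^ position G v * (-1) ^ position (G.erase v) u =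
      -((-1) ^ position G u * (-1) ^ position (G.erase u) v) := by
  rw [position_erase hu v, position_erase hv u]
  rcases lt_or_gt_of_ne huv with h | h
  · rw [if_pos h, if_neg (not_lt.2 h.le)]
    ring
  · rw [if_neg (not_lt.2 h.le), if_pos h]
    ring

end FinSimplicialComplex

namespace Cech

open FinSimplicialComplex

variable {R : Type u} [CommRing R] {n : ℕ} (x : Fin n → R)

/-- The product over `F` divides the product over `G`, and a factor of an invertible endomorphism is
invertible when the factors commute. -/
lemma isUnit_end_of_subset {F G : Finset (Fin n)} (h : F ⊆ G) {M N : Type*} [AddCommGroup M]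
    [Module R M] [AddCommGroup N] [Module R N] (g : M →ₗ[R] N)
    [IsLocalizedModule (Submonoid.powers (∏ j ∈ G, x j)) g]
    (y : Submonoid.powers (∏ j ∈ F, x j)) : IsUnit (algebraMap R (Module.End R N) y) := by
  obtain ⟨_, m, rfl⟩ := y
  have hG : IsUnit (algebraMap R (Module.End R N) (∏ j ∈ G, x j)) :=
    IsLocalizedModule.map_units g (⟨_, Submonoid.mem_powers _⟩ :
      Submonoid.powers (∏ j ∈ G, x j))
  change IsUnit (algebraMap R (Module.End R N) ((∏ j ∈ F, x j) ^ m))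
  rw [map_pow]
  obtain ⟨c, hc⟩ := Finset.prod_dvd_prod_of_subset F G x h
  rw [hc, map_mul] at hG
  exact ((Commute.isUnit_mul_iff (Algebra.commutes _ _)).1 hG).1.pow m

lemma smul_injective_of_subset {F G : Finset (Fin n)} (h : F ⊆ G) {M N : Type*} [AddCommGroup M]
    [Module R M] [AddCommGroup N] [Module R N] (g : M →ₗ[R] N)
    [IsLocalizedModule (Submonoid.powers (∏ j ∈ G, x j)) g] (p : ℕ) :
    Function.Injective fun y : N => (∏ j ∈ F, x j) ^ p • y :=
  ((Module.End.isUnit_iff _).1 (isUnit_end_of_subset x h g ⟨_, p, rfl⟩)).1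

section Family

variable {M : Type*} [AddCommGroup M] [Module R M] {L : Finset (Fin n) → Type*}
  [∀ F, AddCommGroup (L F)] [∀ F, Module R (L F)] (f : ∀ F, M →ₗ[R] L F)
  [∀ F, IsLocalizedModule (Submonoid.powers (∏ j ∈ F, x j)) (f F)]

/-- The natural map `M_{x_F} → M_{x_G}` for `F ⊆ G`. -/
noncomputable def res {F G : Finset (Fin n)} (h : F ⊆ G) : L F →ₗ[R] L G :=
  IsLocalizedModule.lift (Submonoid.powers (∏ j ∈ F, x j)) (f F) (f G)
    (isUnit_end_of_subset x h (f G))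

lemma res_apply {F G : Finset (Fin n)} (h : F ⊆ G) (m : M) : res x f h (f F m) = f G m :=
  IsLocalizedModule.lift_apply _ _ _ _ m

lemma hom_ext_of_subset {F G : Finset (Fin n)} (h : F ⊆ G) {M' N : Type*} [AddCommGroup M']
    [Module R M'] [AddCommGroup N] [Module R N] (g : M' →ₗ[R] N)
    [IsLocalizedModule (Submonoid.powers (∏ j ∈ G, x j)) g] {φ ψ : L F →ₗ[R] N}
    (hφ : ∀ m, φ (f F m) = ψ (f F m)) : φ = ψ :=
  IsLocalizedModule.ext (Submonoid.powers (∏ j ∈ F, x j)) (f F) (isUnit_end_of_subset x h g)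
    (LinearMap.ext hφ)

lemma res_res {F G H : Finset (Fin n)} (h : F ⊆ G) (h' : G ⊆ H) (y : L F) :
    res x f h' (res x f h y) = res x f (h.trans h') y := by
  have : res x f h' ∘ₗ res x f h = res x f (h.trans h') :=
    hom_ext_of_subset x f (h.trans h') (f H) fun m => by
      rw [LinearMap.comp_apply, res_apply, res_apply, res_apply]
  exact LinearMap.congr_fun this y

open Classical in
/-- The map `M_{x_F} → M_{x_G}`, taken to be zero unless `F ⊆ G`. -/
noncomputable def resOrZero (F G : Finset (Fin n)) : L F →ₗ[R] L G :=
  if h : F ⊆ G then res x f h else 0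

lemma resOrZero_of_subset {F G : Finset (Fin n)} (h : F ⊆ G) :
    resOrZero x f F G = res x f h := dif_pos h

/-- The Čech differential on the product of all localizations. -/
noncomputable def totalD : (∀ F, L F) →ₗ[R] ∀ F, L F :=
  LinearMap.pi fun G => ∑ v ∈ G, (-1 : R) ^ position G v •
    (resOrZero x f (G.erase v) G ∘ₗ LinearMap.proj (G.erase v))

lemma totalD_apply (c : ∀ F, L F) (G : Finset (Fin n)) :
    totalD x f c G = ∑ v ∈ G, (-1 : R) ^ position G v •
      resOrZero x f (G.erase v) G (c (G.erase v)) := by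
  simp [totalD]

/-- The terms that delete `v` and `u` in the two possible orders cancel by `sign_erase_comm`. -/
lemma totalD_totalD (c : ∀ F, L F) : totalD x f (totalD x f c) = 0 := by
  funext G
  rw [totalD_apply]
  have h : ∀ v ∈ G, (-1 : R) ^ position G v •
      resOrZero x f (G.erase v) G (totalD x f c (G.erase v)) =
      ∑ u ∈ G.erase v, ((-1 : R) ^ position G v * (-1) ^ position (G.erase v) u) •
        resOrZero x f ((G.erase v).erase u) G (c ((G.erase v).erase u)) := by
    intro v hv
    rw [totalD_apply, map_sum, Finset.smul_sum]
    refine Finset.sum_congr rfl fun u hu => ?_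
    rw [map_smul, smul_smul, resOrZero_of_subset x f (Finset.erase_subset v G),
      resOrZero_of_subset x f (Finset.erase_subset u _), res_res,
      resOrZero_of_subset x f ((Finset.erase_subset u _).trans (Finset.erase_subset v G))]
  rw [Finset.sum_congr rfl h, Finset.sum_sigma']
  refine Finset.sum_involution (fun p _ => ⟨p.2, p.1⟩) ?_ ?_ ?_ ?_
  · rintro ⟨v, u⟩ hp
    simp only [Finset.mem_sigma, Finset.mem_erase] at hp
    dsimp only
    rw [sign_erase_comm hp.2.2 hp.1 hp.2.1, Finset.erase_right_comm, neg_smul, neg_add_cancel]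
  · rintro ⟨v, u⟩ hp _ heq
    simp only [Finset.mem_sigma, Finset.mem_erase] at hp
    exact hp.2.1 (congrArg Sigma.fst heq)
  · rintro ⟨v, u⟩ hp
    simp only [Finset.mem_sigma, Finset.mem_erase] at hp ⊢
    exact ⟨hp.2.2, hp.2.1.symm, hp.1⟩
  · rintro ⟨v, u⟩ _
    rfl

/-- The differential at `G` only sees subsets of `G`. Hence cocycle and coboundary conditions can be
imposed on the subsets of a fixed `T`, which is the form needed for induction on `T`. -/
lemma totalD_congr {c c' : ∀ F, L F} {G : Finset (Fin n)} (h : ∀ F ⊆ G, c F = c' F) :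
    totalD x f c G = totalD x f c' G := by
  rw [totalD_apply, totalD_apply]
  exact Finset.sum_congr rfl fun v _ => by rw [h _ (Finset.erase_subset v G)]

/-- The differential at `F ∪ {v}` of a cochain that vanishes on the sets containing `v`. -/
lemma totalD_insert {b : ∀ F, L F} {v : Fin n} {F : Finset (Fin n)} (hv : v ∉ F)
    (hb : ∀ H, v ∈ H → b H = 0) :
    totalD x f b (insert v F) =
      (-1 : R) ^ position (insert v F) v • res x f (Finset.subset_insert v F) (b F) := by
  rw [totalD_apply, Finset.sum_eq_single v]
  · rw [Finset.erase_insert hv, resOrZero_of_subset]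
  · intro u _ huv
    rw [hb _ (Finset.mem_erase.2 ⟨huv.symm, Finset.mem_insert_self v F⟩), map_zero, smul_zero]
  · exact fun h => (h (Finset.mem_insert_self v F)).elim

/-- The term of degree `t` of the Čech complex. -/
abbrev Cochain (L : Finset (Fin n) → Type*) (t : ℕ) : Type _ :=
  (F : {F : Finset (Fin n) // F.card = t}) → L F.1

/-- The Čech differential in degree `t`. -/
noncomputable def d (t : ℕ) : Cochain L t →ₗ[R] Cochain L (t + 1) :=
  LinearMap.pi fun G => ∑ v : {v : Fin n // v ∈ G.1}, (-1 : R) ^ position G.1 v.1 •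
    (res x f (F := (deleteVertex G v).1) (Finset.erase_subset v.1 G.1) ∘ₗ
      LinearMap.proj (deleteVertex G v))

open Classical in
/-- Extension of a cochain of degree `t` by zero. -/
noncomputable def extendZero {t : ℕ} (c : Cochain L t) (F : Finset (Fin n)) : L F :=
  if h : F.card = t then c ⟨F, h⟩ else 0

/-- Passing to the ungraded differential removes the cardinality proofs from the index sets. -/
lemma d_eq_totalD {t : ℕ} (c : Cochain L t) (b : ∀ F, L F) (h : ∀ F, c F = b F.1)
    (G : {F : Finset (Fin n) // F.card = t + 1}) : d x f t c G = totalD x f b G.1 := by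
  rw [totalD_apply, ← Finset.sum_coe_sort, d, LinearMap.pi_apply, LinearMap.sum_apply]
  refine Finset.sum_congr rfl fun v _ => ?_
  rw [LinearMap.smul_apply, LinearMap.comp_apply, LinearMap.proj_apply, h,
    resOrZero_of_subset x f (Finset.erase_subset v.1 G.1)]
  rfl

lemma extendZero_apply {t : ℕ} (c : Cochain L t) (F : {F : Finset (Fin n) // F.card = t}) :
    c F = extendZero c F.1 := by
  rw [extendZero, dif_pos F.2]

lemma extendZero_of_ne {t : ℕ} (c : Cochain L t) {F : Finset (Fin n)} (h : F.card ≠ t) :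
    extendZero c F = 0 := dif_neg h

lemma totalD_extendZero {t : ℕ} (c : Cochain L t) : 
    totalD x f (extendZero c) = extendZero (d x f t c) := by
  funext G
  by_cases h : G.card = t + 1
  · rw [← extendZero_apply _ ⟨G, h⟩]
    exact (d_eq_totalD x f c _ (extendZero_apply c) ⟨G, h⟩).symm
  · rw [extendZero_of_ne _ h, totalD_apply]
    refine Finset.sum_eq_zero fun v hv => ?_
    rw [extendZero_of_ne _ (by have := Finset.card_erase_add_one hv; omega), map_zero, smul_zero]

lemma d_comp_d (t : ℕ) (c : Cochain L t) : d x f (t + 1) (d x f t c) = 0 := by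
  funext G
  rw [d_eq_totalD x f _ _ (extendZero_apply _), ← totalD_extendZero, totalD_totalD]
  rfl

end Family

section Map

variable {M M' : Type*} [AddCommGroup M] [Module R M] [AddCommGroup M'] [Module R M']
  {L L' : Finset (Fin n) → Type*}
  [∀ F, AddCommGroup (L F)] [∀ F, Module R (L F)] (f : ∀ F, M →ₗ[R] L F)
  [∀ F, IsLocalizedModule (Submonoid.powers (∏ j ∈ F, x j)) (f F)]
  [∀ F, AddCommGroup (L' F)] [∀ F, Module R (L' F)] (f' : ∀ F, M' →ₗ[R] L' F)
  [∀ F, IsLocalizedModule (Submonoid.powers (∏ j ∈ F, x j)) (f' F)] (g : M →ₗ[R] M')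

/-- The map of localizations induced by a linear map. -/
noncomputable def locMap (F : Finset (Fin n)) : L F →ₗ[R] L' F :=
  IsLocalizedModule.map (Submonoid.powers (∏ j ∈ F, x j)) (f F) (f' F) g

lemma locMap_apply (F : Finset (Fin n)) (m : M) : locMap x f f' g F (f F m) = f' F (g m) :=
  IsLocalizedModule.map_apply _ _ _ _ m

lemma locMap_res {F G : Finset (Fin n)} (h : F ⊆ G) (y : L F) :
    locMap x f f' g G (res x f h y) = res x f' h (locMap x f f' g F y) := by
  have : locMap x f f' g G ∘ₗ res x f h = res x f' h ∘ₗ locMap x f f' g F :=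
    hom_ext_of_subset x f h (f' G) fun m => by
      simp only [LinearMap.comp_apply, res_apply, locMap_apply]
  exact LinearMap.congr_fun this y

lemma locMap_totalD (c : ∀ F, L F) (G : Finset (Fin n)) :
    locMap x f f' g G (totalD x f c G) =
      totalD x f' (fun F => locMap x f f' g F (c F)) G := by
  rw [totalD_apply, totalD_apply, map_sum]
  refine Finset.sum_congr rfl fun v _ => ?_
  rw [map_smul, resOrZero_of_subset x f (Finset.erase_subset v G),
    resOrZero_of_subset x f' (Finset.erase_subset v G), locMap_res]

/-- The map of Čech complexes induced by a linear map. -/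
noncomputable def cochainMap (t : ℕ) : Cochain L t →ₗ[R] Cochain L' t :=
  LinearMap.pi fun F => locMap x f f' g F.1 ∘ₗ LinearMap.proj F

lemma cochainMap_d (t : ℕ) (c : Cochain L t) :
    cochainMap x f f' g (t + 1) (d x f t c) = d x f' t (cochainMap x f f' g t c) := by
  funext G
  rw [d_eq_totalD x f' _ (fun F => locMap x f f' g F (extendZero c F))
    (fun F => by rw [← extendZero_apply]; rfl), ← locMap_totalD,
    ← d_eq_totalD x f c _ (extendZero_apply c)]
  rfl

lemma cochainMap_injective (hg : Function.Injective g) (t : ℕ) :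
    Function.Injective (cochainMap x f f' g t) := fun _ _ h =>
  funext fun F => IsLocalizedModule.map_injective _ _ _ g hg (congrFun h F)

lemma cochainMap_surjective (hg : Function.Surjective g) (t : ℕ) :
    Function.Surjective (cochainMap x f f' g t) := fun c => by
  choose b hb using fun F : {F : Finset (Fin n) // F.card = t} =>
    IsLocalizedModule.map_surjective (Submonoid.powers (∏ j ∈ F.1, x j)) (f F.1) (f' F.1) g hg (c F)
  exact ⟨b, funext hb⟩

lemma cochainMap_exact {M'' : Type*} [AddCommGroup M''] [Module R M'']
    {L'' : Finset (Fin n) → Type*} [∀ F, AddCommGroup (L'' F)] [∀ F, Module R (L'' F)]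
    (f'' : ∀ F, M'' →ₗ[R] L'' F)
    [∀ F, IsLocalizedModule (Submonoid.powers (∏ j ∈ F, x j)) (f'' F)] (g' : M' →ₗ[R] M'')
    (h : Function.Exact g g') (t : ℕ) :
    Function.Exact (cochainMap x f f' g t) (cochainMap x f' f'' g' t) := fun c => by
  have key := fun F : {F : Finset (Fin n) // F.card = t} => IsLocalizedModule.map_exact
    (Submonoid.powers (∏ j ∈ F.1, x j)) (f F.1) (f' F.1) (f'' F.1) g g' h (c F)
  constructor
  · intro hc
    choose b hb using fun F => (key F).1 (congrFun hc F)
    exact ⟨b, funext hb⟩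
  · rintro ⟨b, rfl⟩
    exact funext fun F => (key F).2 ⟨b F, rfl⟩

end Map

end Cech

/-! ### Torsion in injective modules over a Noetherian ring -/

section InjectiveTorsion

open localCohomology

/-- Artin–Rees for the principal ideal generated by `z`. -/
lemma Ideal.exists_pow_inf_span_le {R : Type*} [CommRing R] [IsNoetherianRing R] (I : Ideal R)
    (z : R) (a : ℕ) : ∃ N, I ^ N ⊓ Ideal.span {z} ≤ I ^ a * Ideal.span {z} := by
  obtain ⟨c, hc⟩ := I.exists_pow_inf_eq_pow_smul (Ideal.span {z} : Submodule R R)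
  refine ⟨c + a, ?_⟩
  have h := hc (c + a) (Nat.le_add_right _ _)
  rw [smul_eq_mul, Ideal.mul_top, Nat.add_sub_cancel_left] at h
  rw [h, smul_eq_mul]
  exact Ideal.mul_mono_right inf_le_right

/-- The annihilators of the powers of `y` form an ascending chain. -/
lemma exists_pow_mul_eq_zero_stable {R : Type*} [CommRing R] [IsNoetherianRing R] (y : R) :
    ∃ m, ∀ k r, y ^ (m + k) * r = 0 → y ^ m * r = 0 := by
  have hmono : Monotone fun m : ℕ => LinearMap.ker (LinearMap.mulLeft R (y ^ m)) := by
    intro a b hab r hr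
    rw [LinearMap.mem_ker, LinearMap.mulLeft_apply] at hr ⊢
    obtain ⟨c, rfl⟩ := Nat.exists_eq_add_of_le hab
    rw [pow_add, mul_right_comm, hr, zero_mul]
  obtain ⟨m, hm⟩ := monotone_stabilizes_iff_noetherian.2 ‹_› ⟨_, hmono⟩
  refine ⟨m, fun k r h => ?_⟩
  have h1 : r ∈ LinearMap.ker (LinearMap.mulLeft R (y ^ (m + k))) := h
  have h2 := hm (m + k) (Nat.le_add_right _ _)
  simp only [OrderHom.coe_mk] at h2
  rw [← h2] at h1
  exact h1

/-- Over a Noetherian ring, the map from the torsion submodule of an injective module to its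
localization away from an element is surjective. -/
lemma exists_torsion_pow_smul_eq {R : Type u} [CommRing R] [IsNoetherianRing R] {E : Type u}
    [AddCommGroup E] [Module R E] [Module.Injective R E] (I : Ideal R) (y : R) {e : E}
    (he : e ∈ torsion I E) (k : ℕ) :
    ∃ e' ∈ torsion I E, ∃ m, y ^ (m + k) • e' = y ^ m • e := by
  obtain ⟨a, ha⟩ := he
  obtain ⟨m, hm⟩ := exists_pow_mul_eq_zero_stable y
  obtain ⟨N, hN⟩ := I.exists_pow_inf_span_le (y ^ (m + k)) a
  -- The rule `y ^ (m + k) * r + s ↦ r • y ^ m • e` is to be a map on the ideal `(y ^ (m + k)) + I ^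
  -- N`, the image of `p`. Its extension to `R` sends 1 to the required `e'`, which is torsion
  -- because the rule kills `I ^ N`.
  let p : R × ↥(I ^ N) →ₗ[R] R :=
    (LinearMap.mulLeft R (y ^ (m + k))).coprod (Submodule.subtype (I ^ N))
  let g : R × ↥(I ^ N) →ₗ[R] E := (LinearMap.toSpanSingleton R E (y ^ m • e)).comp
    (LinearMap.fst R R ↥(I ^ N))
  -- Well-definedness. If `y ^ (m + k) * r` lies in `I ^ N`, Artin–Rees replaces `r` by some `z` in
  -- `I ^ a` with the same multiple; the choice of `m` gives `y ^ m * r = y ^ m * z`, and `z` kills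
  -- `e`.
  have hpg : LinearMap.ker p ≤ LinearMap.ker g := by
    rintro ⟨r, s⟩ hrs
    have hrs' : y ^ (m + k) * r + s = 0 := hrs
    have hmem : y ^ (m + k) * r ∈ I ^ N ⊓ Ideal.span {y ^ (m + k)} := by
      refine ⟨?_, Ideal.mul_mem_right _ _ (Ideal.mem_span_singleton_self _)⟩
      rw [eq_neg_of_add_eq_zero_left hrs']
      exact neg_mem s.2
    obtain ⟨z, hz, hz'⟩ := Ideal.mem_mul_span_singleton.1 (hN hmem)
    have h0 : y ^ m * (r - z) = 0 := hm k _ (by rw [mul_sub, ← hz']; ring)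
    change r • y ^ m • e = 0
    rw [smul_smul, mul_comm, show y ^ m * r = y ^ m * z by linear_combination h0, mul_smul,
      ha z hz, smul_zero]
  obtain ⟨h, hh⟩ := Module.Injective.out (R := R) (Q := E) ((LinearMap.ker p).liftQ p le_rfl)
    (LinearMap.ker_eq_bot.1 (Submodule.ker_liftQ_eq_bot _ _ _ le_rfl))
    ((LinearMap.ker p).liftQ g hpg)
  have hh' : ∀ r s, h (y ^ (m + k) * r + (s : ↥(I ^ N))) = r • y ^ m • e := fun r s =>
    hh (Submodule.Quotient.mk (r, s))
  refine ⟨h 1, ⟨N, fun r hr => ?_⟩, m, ?_⟩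
  · have := hh' 0 ⟨r, hr⟩
    rw [mul_zero, zero_add, zero_smul] at this
    rw [← map_smul, smul_eq_mul, mul_one]
    exact this
  · have := hh' 1 0
    rw [one_smul] at this
    rw [← map_smul, smul_eq_mul, ← this]
    simp

end InjectiveTorsion

/-! ### Acyclicity of the Čech complex of an injective module -/

namespace Cech

open localCohomology FinSimplicialComplex

variable {R : Type u} [CommRing R] {n : ℕ} (x : Fin n → R)

section Step

variable {M : Type*} [AddCommGroup M] [Module R M] {L : Finset (Fin n) → Type*}
  [∀ F, AddCommGroup (L F)] [∀ F, Module R (L F)] (f : ∀ F, M →ₗ[R] L F)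
  [∀ F, IsLocalizedModule (Submonoid.powers (∏ j ∈ F, x j)) (f F)]

lemma exists_pow_smul_eq (F : Finset (Fin n)) (y : L F) :
    ∃ (p : ℕ) (m : M), (∏ j ∈ F, x j) ^ p • y = f F m := by
  obtain ⟨⟨m, ⟨_, p, rfl⟩⟩, h⟩ := IsLocalizedModule.surj
    (Submonoid.powers (∏ j ∈ F, x j)) (f F) y
  exact ⟨p, m, h⟩

lemma exists_pow_smul_eq_zero {F : Finset (Fin n)} {m : M} (h : f F m = 0) :
    ∃ p : ℕ, (∏ j ∈ F, x j) ^ p • m = 0 := by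
  obtain ⟨⟨_, p, rfl⟩, h⟩ :=
    (IsLocalizedModule.eq_zero_iff (Submonoid.powers (∏ j ∈ F, x j)) (f F)).1 h
  exact ⟨p, h⟩

/-- If `M → M_{x_v}` is surjective then so is `M_{x_F} → M_{x_F x_v}`. -/
lemma res_surjective {v : Fin n} {F : Finset (Fin n)} (hv : v ∉ F)
    (h : ∀ (m : M) (k : ℕ), ∃ m' : M, ∃ q, x v ^ (q + k) • m' = x v ^ q • m) :
    Function.Surjective (res x f (Finset.subset_insert v F)) := by
  intro y
  -- Write `y` as `m / (x_F x_v) ^ p`. The hypothesis trades `m / x_v ^ p` for an element `m'` of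
  -- `M`, and `m' / x_F ^ p` is a preimage.
  obtain ⟨p, m, hp⟩ := exists_pow_smul_eq x f _ y
  obtain ⟨m', q, hq⟩ := h m p
  obtain ⟨z, hz⟩ := ((Module.End.isUnit_iff _).1 (isUnit_end_of_subset x
    (Finset.Subset.refl F) (f F) ⟨_, p, rfl⟩)).2 (f F m')
  have hz' : (∏ j ∈ F, x j) ^ p • z = f F m' := hz
  refine ⟨z, ?_⟩
  have hvF : ({v} : Finset (Fin n)) ⊆ insert v F :=
    Finset.singleton_subset_iff.2 (Finset.mem_insert_self v F)
  apply smul_injective_of_subset x (Finset.subset_insert v F) (f _) p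
  apply smul_injective_of_subset x hvF (f _) (q + p)
  dsimp only
  rw [← map_smul, hz', res_apply, Finset.prod_singleton, ← map_smul, hq, map_smul, ← hp,
    Finset.prod_insert hv, smul_smul, smul_smul]
  congr 1
  ring

/-- If `b` vanishes on the sets containing `v`, its differential at `F ∪ {v}` is a single signed
restriction, so the equations for different `F` decouple and `res_surjective` solves each. -/
lemma exists_totalD_insert_eq {v : Fin n} 
    (h : ∀ (m : M) (k : ℕ), ∃ m' : M, ∃ q, x v ^ (q + k) • m' = x v ^ q • m) (c : ∀ F, L F) :
    ∃ b : ∀ F, L F, ∀ F, v ∉ F → totalD x f b (insert v F) = c (insert v F) := by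
  have : ∀ F : Finset (Fin n), ∃ y : L F, (v ∈ F → y = 0) ∧ (v ∉ F →
      (-1 : R) ^ position (insert v F) v • res x f (Finset.subset_insert v F) y =
        c (insert v F)) := by
    intro F
    by_cases hv : v ∈ F
    · exact ⟨0, fun _ => rfl, fun h' => (h' hv).elim⟩
    · obtain ⟨y, hy⟩ := res_surjective x f hv h
        ((-1 : R) ^ position (insert v F) v • c (insert v F))
      refine ⟨y, fun h' => (hv h').elim, fun _ => ?_⟩
      rw [hy, smul_smul, ← mul_pow]
      simp
  choose b hb0 hb using this
  exact ⟨b, fun F hF => by rw [totalD_insert x f hF hb0, hb F hF]⟩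

end Step

section Torsion

variable {M M' : Type*} [AddCommGroup M] [Module R M] [AddCommGroup M'] [Module R M']
  {L L' : Finset (Fin n) → Type*}
  [∀ F, AddCommGroup (L F)] [∀ F, Module R (L F)] (f : ∀ F, M →ₗ[R] L F)
  [∀ F, IsLocalizedModule (Submonoid.powers (∏ j ∈ F, x j)) (f F)]
  [∀ F, AddCommGroup (L' F)] [∀ F, Module R (L' F)] (f' : ∀ F, M' →ₗ[R] L' F)
  [∀ F, IsLocalizedModule (Submonoid.powers (∏ j ∈ F, x j)) (f' F)] (g : M' →ₗ[R] M)

/-- The kernel of `M_{x_F} → M_{x_F x_v}` is the localization of the `x_v`-power torsion of `M`,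
which by `hg` lies in the range of `g`. -/
lemma exists_locMap_eq_of_res_eq_zero {v : Fin n} {F : Finset (Fin n)} (hv : v ∉ F)
    (hg : ∀ (m : M) (k : ℕ), x v ^ k • m = 0 → m ∈ LinearMap.range g) (y : L F)
    (hy : res x f (Finset.subset_insert v F) y = 0) : ∃ z, locMap x f' f g F z = y := by
  obtain ⟨p, m, hp⟩ := exists_pow_smul_eq x f F y
  have h0 : f (insert v F) m = 0 := by
    rw [← res_apply x f (Finset.subset_insert v F), ← hp, map_smul, hy, smul_zero]
  obtain ⟨q, hq⟩ := exists_pow_smul_eq_zero x f h0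
  rw [Finset.prod_insert hv, mul_pow, mul_smul] at hq
  obtain ⟨m', hm'⟩ := hg _ q hq
  obtain ⟨z, hz⟩ := ((Module.End.isUnit_iff _).1 (isUnit_end_of_subset x
    (Finset.Subset.refl F) (f' F) ⟨_, q + p, rfl⟩)).2 (f' F m')
  have hz' : (∏ j ∈ F, x j) ^ (q + p) • z = f' F m' := hz
  refine ⟨z, smul_injective_of_subset x (Finset.Subset.refl F) (f F) (q + p) ?_⟩
  dsimp only
  rw [← map_smul, hz', locMap_apply, hm', map_smul, ← hp, smul_smul, pow_add]

lemma res_locMap_eq_zero {v : Fin n} {F : Finset (Fin n)}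
    (hg : ∀ m, ∃ k : ℕ, x v ^ k • g m = 0) (z : L' F) :
    res x f (Finset.subset_insert v F) (locMap x f' f g F z) = 0 := by
  obtain ⟨p, m, hp⟩ := exists_pow_smul_eq x f' F z
  obtain ⟨k, hk⟩ := hg m
  have hvF : ({v} : Finset (Fin n)) ⊆ insert v F :=
    Finset.singleton_subset_iff.2 (Finset.mem_insert_self v F)
  apply smul_injective_of_subset x (Finset.subset_insert v F) (f _) p
  apply smul_injective_of_subset x hvF (f _) k
  dsimp only
  rw [← map_smul (res x f _), ← map_smul (locMap x f' f g F), hp, locMap_apply, res_apply, Finset.prod_singleton, ← map_smul, hk,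
    map_zero, smul_zero, smul_zero]

end Torsion

/-- A sufficiently high power of the sum, with exponent `s + k`, lies in `I ^ s + (y) ^ k`. -/
lemma mem_torsion_sup_span {M : Type*} [AddCommGroup M] [Module R M] (I : Ideal R) (y : R) (m : M) :
    m ∈ torsion (I ⊔ Ideal.span {y}) M ↔ m ∈ torsion I M ∧ ∃ k : ℕ, y ^ k • m = 0 := by
  constructor
  · rintro ⟨t, ht⟩
    exact ⟨⟨t, fun r hr => ht r (Ideal.pow_right_mono le_sup_left t hr)⟩, t,
      ht _ (Ideal.pow_mem_pow (Ideal.mem_sup_right (Ideal.mem_span_singleton_self y)) t)⟩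
  · rintro ⟨⟨s, hs⟩, k, hk⟩
    refine ⟨s + k, fun r hr => ?_⟩
    have h := Ideal.sup_pow_add_le_pow_sup_pow hr
    rw [Ideal.span_singleton_pow] at h
    obtain ⟨a, ha, b, hb, rfl⟩ := Submodule.mem_sup.1 h
    obtain ⟨c, rfl⟩ := Ideal.mem_span_singleton'.1 hb
    rw [add_smul, hs a ha, mul_smul, hk, smul_zero, add_zero]

/-- Induction on the set `T` of variables used. The module varies through the torsion submodules of
`E`, up to isomorphism: removing the variable `v` replaces `I`-torsion by torsion for `I + (x_v)`.
The condition at `∅` excludes cocycles of degree 0, which need not be coboundaries. -/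
lemma exists_totalD_eq [IsNoetherianRing R] {E : Type u} [AddCommGroup E] [Module R E]
    [Module.Injective R E] (T : Finset (Fin n)) : ∀ (I : Ideal R) {M : Type u} [AddCommGroup M]
    [Module R M] (ι : M →ₗ[R] E), Function.Injective ι → LinearMap.range ι = torsion I E →
    ∀ {L : Finset (Fin n) → Type u} [∀ F, AddCommGroup (L F)] [∀ F, Module R (L F)]
      (f : ∀ F, M →ₗ[R] L F)
      [∀ F, IsLocalizedModule (Submonoid.powers (∏ j ∈ F, x j)) (f F)] (c : ∀ F, L F),
      (∀ F ⊆ T, totalD x f c F = 0) → c ∅ = 0 → ∃ b, ∀ F ⊆ T, totalD x f b F = c F := by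
  induction T using Finset.induction_on with
  | empty =>
    intro I M _ _ ι _ _ L _ _ f _ c _ hc
    refine ⟨0, fun F hF => ?_⟩
    obtain rfl := Finset.subset_empty.1 hF
    rw [map_zero, hc]
    rfl
  | insert v T hvT ih =>
    intro I M _ _ ι hι hr L _ _ f _ c hc hc0
    have hsurj : ∀ (m : M) (k : ℕ), ∃ m' : M, ∃ q, x v ^ (q + k) • m' = x v ^ q • m := by
      intro m k
      obtain ⟨e', he', q, hq⟩ := exists_torsion_pow_smul_eq I (x v)
        (hr ▸ LinearMap.mem_range_self ι m) k
      obtain ⟨m', rfl⟩ := hr.symm ▸ he'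
      exact ⟨m', q, hι (by rw [map_smul, map_smul, hq])⟩
    -- Subtracting the differential of `b₁` makes the cocycle vanish on all subsets of `T ∪ {v}`
    -- that contain `v`.
    obtain ⟨b₁, hb₁⟩ := exists_totalD_insert_eq x f hsurj c
    let M' := (torsion (I ⊔ Ideal.span {x v}) E).comap ι
    let g : M' →ₗ[R] M := M'.subtype
    let f' : ∀ F : Finset (Fin n), M' →ₗ[R] LocalizedModule (Submonoid.powers (∏ j ∈ F, x j)) M' :=
      fun F => LocalizedModule.mkLinearMap _ _
    have hM' : ∀ m : M, m ∈ M' ↔ ∃ k : ℕ, x v ^ k • m = 0 := by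
      intro m
      rw [Submodule.mem_comap, mem_torsion_sup_span, ← hr]
      simp only [LinearMap.mem_range, exists_apply_eq_apply, true_and, ← map_smul]
      exact exists_congr fun k => ⟨fun h => hι (h.trans (map_zero ι).symm), fun h => by
        rw [h, map_zero]⟩
    have hg : ∀ (m : M) (k : ℕ), x v ^ k • m = 0 → m ∈ LinearMap.range g := fun m k h => by
      rw [Submodule.range_subtype]
      exact (hM' m).2 ⟨k, h⟩
    have hg' : ∀ m, ∃ k : ℕ, x v ^ k • g m = 0 := fun m => (hM' m).1 m.2
    have hginj : ∀ F, Function.Injective (locMap x f' f g F) := fun F =>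
      IsLocalizedModule.map_injective _ _ _ g Subtype.val_injective
    have hnot : ∀ {F}, F ⊆ T → v ∉ F := fun hF h => hvT (hF h)
    let c₁ := c - totalD x f b₁
    have hc₁_def : ∀ F, c₁ F = c F - totalD x f b₁ F := fun _ => rfl
    have hc₁ : ∀ F ⊆ insert v T, totalD x f c₁ F = 0 := fun F hF => by
      rw [map_sub, totalD_totalD, sub_zero, hc F hF]
    have hc₁v : ∀ F ⊆ T, c₁ (insert v F) = 0 := fun F hF => by
      rw [hc₁_def, hb₁ F (hnot hF), sub_self]
    -- In the cocycle equation at `F ∪ {v}` every term but the one deleting `v` is a value of `c₁`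
    -- on a set containing `v`, hence zero. So `c₁ F` comes from the localization of the
    -- `x_v`-torsion submodule `M'`.
    have hres : ∀ F ⊆ T, res x f (Finset.subset_insert v F) (c₁ F) = 0 := by
      intro F hF
      have h := hc₁ (insert v F) (Finset.insert_subset_insert v hF)
      let c₂ : ∀ H, L H := fun H => if v ∈ H then 0 else c₁ H
      have hc₂ : totalD x f c₁ (insert v F) = totalD x f c₂ (insert v F) := by
        rw [totalD_apply, totalD_apply]
        refine Finset.sum_congr rfl fun u hu => ?_
        by_cases huv : u = v
        · subst huv
          simp only [c₂, if_neg (Finset.notMem_erase u _)]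
        · have hv' : v ∈ (insert v F).erase u :=
            Finset.mem_erase.2 ⟨fun h => huv h.symm, Finset.mem_insert_self v F⟩
          have h0 : c₁ ((insert v F).erase u) = 0 := by
            rw [Finset.erase_insert_of_ne (fun h => huv h.symm)]
            exact hc₁v _ ((Finset.erase_subset u F).trans hF)
          simp only [c₂, if_pos hv', h0]
      rw [hc₂, totalD_insert x f (hnot hF) (fun H hH => if_pos hH)] at h
      have h2 := congrArg (fun z => (-1 : R) ^ position (insert v F) v • z) h
      simpa only [smul_smul, ← mul_pow, neg_mul_neg, one_mul, one_pow, one_smul, smul_zero, c₂,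
        if_neg (hnot hF)] using h2
    have hlift : ∀ F, ∃ z, F ⊆ T → locMap x f' f g F z = c₁ F := by
      intro F
      by_cases hF : F ⊆ T
      · obtain ⟨z, hz⟩ := exists_locMap_eq_of_res_eq_zero x f f' g (hnot hF) hg _ (hres F hF)
        exact ⟨z, fun _ => hz⟩
      · exact ⟨0, fun h => (hF h).elim⟩
    choose c' hc' using hlift
    obtain ⟨b', hb'⟩ := ih (I ⊔ Ideal.span {x v}) (ι ∘ₗ g) (hι.comp Subtype.val_injective) (by
        rw [LinearMap.range_comp, Submodule.range_subtype, Submodule.map_comap_eq, hr]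
        exact inf_eq_right.2 fun e he => ((mem_torsion_sup_span I (x v) e).1 he).1) f' c'
      (fun F hF => hginj F (by
        rw [locMap_totalD, map_zero, ← hc₁ F (hF.trans (Finset.subset_insert v T))]
        exact totalD_congr x f fun H hH => hc' H (hH.trans hF)))
      (hginj ∅ (by
        rw [hc' ∅ (Finset.empty_subset T), map_zero, hc₁_def, hc0, totalD_apply,
          Finset.sum_empty, sub_zero]))
    -- Extending by zero is harmless: at sets containing `v` the differential of `b₂` is a
    -- restriction from the localization of `M'`, and that dies once `x_v` is inverted.
    let b₂ : ∀ F, L F := fun F => if v ∈ F then 0 else locMap x f' f g F (b' F)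
    refine ⟨b₁ + b₂, fun F hF => ?_⟩
    rw [map_add, Pi.add_apply]
    have key : totalD x f b₂ F = c₁ F := by
      by_cases hvF : v ∈ F
      · obtain ⟨H, hvH, rfl⟩ : ∃ H, v ∉ H ∧ insert v H = F :=
          ⟨F.erase v, Finset.notMem_erase v F, Finset.insert_erase hvF⟩
        have hH : H ⊆ T := (Finset.insert_subset_insert_iff hvH).1 hF
        rw [totalD_insert x f hvH (fun H hH => if_pos hH), hc₁v H hH]
        simp only [if_neg hvH]
        rw [res_locMap_eq_zero x f f' g hg', smul_zero]
      · have hFT : F ⊆ T := (Finset.subset_insert_iff_of_notMem hvF).1 hF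
        rw [← hc' F hFT, ← hb' F hFT, locMap_totalD]
        exact totalD_congr x f fun H hH => if_neg fun h => hvF (hH h)
    rw [key, hc₁_def, add_sub_cancel]

/-- The Čech complex of an injective module over a Noetherian ring is acyclic in positive
degrees. -/
lemma ker_d_le_range_of_injective [IsNoetherianRing R] {E : Type u} [AddCommGroup E] [Module R E]
    [Module.Injective R E] {L : Finset (Fin n) → Type u} [∀ F, AddCommGroup (L F)]
    [∀ F, Module R (L F)] (f : ∀ F, E →ₗ[R] L F)
    [∀ F, IsLocalizedModule (Submonoid.powers (∏ j ∈ F, x j)) (f F)] (i : ℕ) :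
    LinearMap.ker (d x f (i + 1)) ≤ LinearMap.range (d x f i) := by
  intro c hc
  -- Torsion for the zero ideal is all of `E`, and the extended cochain vanishes at `∅` because its
  -- degree `i + 1` is positive.
  obtain ⟨b, hb⟩ := exists_totalD_eq x (E := E) Finset.univ ⊥ LinearMap.id Function.injective_id
    (by
      rw [LinearMap.range_id, eq_comm, eq_top_iff]
      refine fun e _ => ⟨1, fun r hr => ?_⟩
      rw [pow_one, Ideal.mem_bot] at hr
      rw [hr, zero_smul]) f (extendZero c)
    (fun F _ => by
      rw [totalD_extendZero, LinearMap.mem_ker.1 hc]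
      by_cases h : F.card = i + 1 + 1
      · exact (extendZero_apply (0 : Cochain L (i + 1 + 1)) ⟨F, h⟩).symm
      · exact extendZero_of_ne _ h)
    (extendZero_of_ne _ (by simp))
  refine ⟨fun F => b F.1, funext fun G => ?_⟩
  rw [d_eq_totalD x f _ b (fun _ => rfl), hb _ (Finset.subset_univ _), ← extendZero_apply]

end Cech

/-! ### Cohomology of sequences of linear maps and dimension shifting -/

section CohomologyOfSequence

variable {R : Type*} [CommRing R]

/-- The coboundaries of a sequence of linear maps indexed by `ℕ`. -/
noncomputable def seqCoboundaries {C : ℕ → Type*} [∀ t, AddCommGroup (C t)] [∀ t, Module R (C t)]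
    (d : ∀ t, C t →ₗ[R] C (t + 1)) : (i : ℕ) → Submodule R (C i)
  | 0 => ⊥
  | i + 1 => LinearMap.range (d i)

/-- The cohomology of a sequence of linear maps indexed by `ℕ`. -/
abbrev seqCohomology {C : ℕ → Type*} [∀ t, AddCommGroup (C t)] [∀ t, Module R (C t)]
    (d : ∀ t, C t →ₗ[R] C (t + 1)) (i : ℕ) : Type _ :=
  LinearMap.ker (d i) ⧸ (seqCoboundaries d i).submoduleOf (LinearMap.ker (d i))

variable {A B C : ℕ → Type*} [∀ t, AddCommGroup (A t)] [∀ t, Module R (A t)]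
  [∀ t, AddCommGroup (B t)] [∀ t, Module R (B t)] [∀ t, AddCommGroup (C t)] [∀ t, Module R (C t)]
  (dA : ∀ t, A t →ₗ[R] A (t + 1)) (dB : ∀ t, B t →ₗ[R] B (t + 1)) (dC : ∀ t, C t →ₗ[R] C (t + 1))
  (j : ∀ t, A t →ₗ[R] B t) (q : ∀ t, B t →ₗ[R] C t)

/-- The map from cocycles to cohomology induced by a map of complexes. -/
noncomputable def seqCohomologyMap (hq : ∀ t b, q (t + 1) (dB t b) = dC t (q t b)) (i : ℕ) :
    LinearMap.ker (dB i) →ₗ[R] seqCohomology dC i :=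
  Submodule.mkQ _ ∘ₗ LinearMap.codRestrict (LinearMap.ker (dC i))
    (q i ∘ₗ (LinearMap.ker (dB i)).subtype) (fun b => by
      have : dB i b = 0 := b.2
      rw [LinearMap.mem_ker, LinearMap.comp_apply, Submodule.subtype_apply, ← hq, this, map_zero])

lemma seqCohomologyMap_range_eq_bot (hq : ∀ t b, q (t + 1) (dB t b) = dC t (q t b)) (i : ℕ)
    (h : LinearMap.ker (dB (i + 1)) ≤ LinearMap.range (dB i)) :
    LinearMap.range (seqCohomologyMap dB dC q hq (i + 1)) = ⊥ := by
  rw [LinearMap.range_eq_bot]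
  ext b
  obtain ⟨b', hb'⟩ := h b.2
  refine (Submodule.Quotient.mk_eq_zero _).2 ?_
  exact ⟨q i b', by rw [← hq, hb']; rfl⟩

lemma exists_cocycle_of_mem_seqCoboundaries (hq : ∀ t b, q (t + 1) (dB t b) = dC t (q t b))
    (hBB : ∀ t b, dB (t + 1) (dB t b) = 0) (hs : ∀ t, Function.Surjective (q t)) (i : ℕ) (c : C i)
    (hc : c ∈ seqCoboundaries dC i) : ∃ b, dB i b = 0 ∧ q i b = c := by
  cases i with
  | zero => exact ⟨0, map_zero _, by rw [map_zero, (Submodule.mem_bot R).1 hc]⟩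
  | succ i =>
    obtain ⟨c', rfl⟩ := hc
    obtain ⟨b, rfl⟩ := hs i c'
    exact ⟨dB i b, hBB i b, hq i b⟩

/-- Dimension shifting: if the middle term of a short exact sequence of complexes is exact in
degree `i + 1`, then `Hⁱ⁺¹(A)` is the cokernel of `Hⁱ(B) → Hⁱ(C)`. -/
lemma nonempty_seqCohomology_succ_equiv (hj : ∀ t a, j (t + 1) (dA t a) = dB t (j t a))
    (hq : ∀ t b, q (t + 1) (dB t b) = dC t (q t b)) (hBB : ∀ t b, dB (t + 1) (dB t b) = 0)
    (hinj : ∀ t, Function.Injective (j t)) (hex : ∀ t, Function.Exact (j t) (q t))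
    (hs : ∀ t, Function.Surjective (q t)) (i : ℕ)
    (hB : LinearMap.ker (dB (i + 1)) ≤ LinearMap.range (dB i)) :
    Nonempty (seqCohomology dA (i + 1) ≃ₗ[R]
      seqCohomology dC i ⧸ LinearMap.range (seqCohomologyMap dB dC q hq i)) := by
  -- Both sides are quotients of `Z`, the cochains of `B` lying over cocycles of `C`: one sends `z`
  -- to the class of the preimage of `dB z` under `j`, the other to the class of `q z`. In both
  -- cases the kernel consists of the `z` whose differential agrees with that of an element of `A`,
  -- so no connecting map has to be shown well defined.
  let Z := LinearMap.ker (dC i ∘ₗ q i)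
  have hZ : ∀ z : Z, dB i z ∈ LinearMap.range (j (i + 1)) := fun z =>
    (hex (i + 1) _).1 ((hq i _).trans z.2)
  let κ : Z →ₗ[R] A (i + 1) := (LinearEquiv.ofInjective (j (i + 1)) (hinj _)).symm.toLinearMap ∘ₗ
    LinearMap.codRestrict _ (dB i ∘ₗ Z.subtype) hZ
  have hκ : ∀ z : Z, j (i + 1) (κ z) = dB i z := fun z => congrArg Subtype.val
    ((LinearEquiv.ofInjective (j (i + 1)) (hinj _)).apply_symm_apply ⟨dB i z, hZ z⟩)
  have hκ' : ∀ z : Z, κ z ∈ LinearMap.ker (dA (i + 1)) := fun z => hinj _ (by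
    rw [hj, hκ, hBB, map_zero])
  let β : Z →ₗ[R] seqCohomology dA (i + 1) :=
    Submodule.mkQ _ ∘ₗ LinearMap.codRestrict _ κ hκ'
  let γ : Z →ₗ[R] LinearMap.ker (dC i) := LinearMap.codRestrict _ (q i ∘ₗ Z.subtype) fun z => z.2
  let α : Z →ₗ[R] seqCohomology dC i ⧸ LinearMap.range (seqCohomologyMap dB dC q hq i) :=
    Submodule.mkQ _ ∘ₗ Submodule.mkQ _ ∘ₗ γ
  have hβ : Function.Surjective β := by
    refine (Submodule.mkQ_surjective _).comp ?_
    rintro ⟨a, ha⟩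
    obtain ⟨b, hb⟩ := hB (show j (i + 1) a ∈ LinearMap.ker (dB (i + 1)) by
      rw [LinearMap.mem_ker, ← hj, LinearMap.mem_ker.1 ha, map_zero])
    refine ⟨⟨b, ?_⟩, Subtype.ext (hinj _ ((hκ _).trans hb))⟩
    rw [LinearMap.mem_ker, LinearMap.comp_apply, ← hq, hb]
    exact (hex (i + 1) _).2 ⟨a, rfl⟩
  have hα : Function.Surjective α := by
    refine (Submodule.mkQ_surjective _).comp ((Submodule.mkQ_surjective _).comp ?_)
    rintro ⟨c, hc⟩
    obtain ⟨b, rfl⟩ := hs i c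
    exact ⟨⟨b, hc⟩, rfl⟩
  have hβker : ∀ z : Z, β z = 0 ↔ ∃ a, dB i z = dB i (j i a) := fun z => by
    refine (Submodule.Quotient.mk_eq_zero _).trans ?_
    constructor
    · rintro ⟨a, ha⟩
      exact ⟨a, by rw [← hκ, ← hj, ha]; rfl⟩
    · rintro ⟨a, ha⟩
      exact ⟨a, hinj _ (by rw [hj, ← ha, ← hκ]; rfl)⟩
  have hαker : ∀ z : Z, α z = 0 ↔ ∃ a, dB i z = dB i (j i a) := fun z => by
    refine (Submodule.Quotient.mk_eq_zero _).trans ?_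
    constructor
    · rintro ⟨b, hb⟩
      have hb' := (Submodule.Quotient.eq _).1 hb
      obtain ⟨b', hb'0, hb'⟩ := exists_cocycle_of_mem_seqCoboundaries dB dC q hq hBB hs i _ hb'
      have hb'' : q i b' = q i b - q i z := hb'
      obtain ⟨a, ha⟩ := (hex i (z - b + b')).1 (by rw [map_add, map_sub, hb'']; abel)
      have hb0 : dB i b = 0 := b.2
      exact ⟨a, by rw [ha, map_add, map_sub, hb'0, hb0, sub_zero, add_zero]⟩
    · rintro ⟨a, ha⟩
      refine ⟨⟨z - j i a, by rw [LinearMap.mem_ker, map_sub, ha, sub_self]⟩, ?_⟩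
      refine congrArg (Submodule.mkQ _) (Subtype.ext ?_)
      change q i (z - j i a) = q i z
      rw [map_sub, (hex i _).2 ⟨a, rfl⟩, sub_zero]
  have hker : LinearMap.ker β = LinearMap.ker α := by
    ext z
    rw [LinearMap.mem_ker, LinearMap.mem_ker, hβker, hαker]
  exact ⟨(β.quotKerEquivOfSurjective hβ).symm.trans ((Submodule.quotEquivOfEq _ _ hker).trans
    (α.quotKerEquivOfSurjective hα))⟩

/-- Two submodules realised with the same image in `N`, together with submodules having the same
image, have isomorphic quotients. -/
lemma nonempty_quotient_equiv_of_range_eq {X Y N : Type*} [AddCommGroup X] [Module R X]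
    [AddCommGroup Y] [Module R Y] [AddCommGroup N] [Module R N] (a : X →ₗ[R] N) (b : Y →ₗ[R] N)
    (ha : Function.Injective a) (hb : Function.Injective b)
    (h : LinearMap.range a = LinearMap.range b) (P : Submodule R X) (Q : Submodule R Y)
    (hPQ : P.map a = Q.map b) : Nonempty ((X ⧸ P) ≃ₗ[R] Y ⧸ Q) := by
  let e : X ≃ₗ[R] Y := (LinearEquiv.ofInjective a ha).trans
    ((LinearEquiv.ofEq _ _ h).trans (LinearEquiv.ofInjective b hb).symm)
  have he : b ∘ₗ e.toLinearMap = a := LinearMap.ext fun y => congrArg Subtype.val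
    ((LinearEquiv.ofInjective b hb).apply_symm_apply
      (LinearEquiv.ofEq _ _ h (LinearEquiv.ofInjective a ha y)))
  refine ⟨Submodule.Quotient.equiv P Q e (Submodule.map_injective_of_injective hb ?_)⟩
  rw [← hPQ, ← he, Submodule.map_comp]

end CohomologyOfSequence

/-! ### Local cohomology is Čech cohomology -/

namespace Cech

open localCohomology CategoryTheory Limits

variable {R : Type u} [CommRing R] {n : ℕ} (x : Fin n → R)

lemma ext_zero {L : Finset (Fin n) → Type*} {c c' : Cochain L 0}
    (h : c ⟨∅, Finset.card_empty⟩ = c' ⟨∅, Finset.card_empty⟩) : c = c' := by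
  funext ⟨F, hF⟩
  obtain rfl := Finset.card_eq_zero.1 hF
  exact h

lemma bijective_empty (x : Fin n → R) {M N : Type*} [AddCommGroup M] [Module R M] [AddCommGroup N]
    [Module R N] (g : M →ₗ[R] N)
    [IsLocalizedModule (Submonoid.powers (∏ j ∈ (∅ : Finset (Fin n)), x j)) g] :
    Function.Bijective g := by
  constructor
  · rw [injective_iff_map_eq_zero]
    intro m hm
    obtain ⟨⟨_, p, rfl⟩, h⟩ := (IsLocalizedModule.eq_zero_iff
      (Submonoid.powers (∏ j ∈ (∅ : Finset (Fin n)), x j)) g).1 hm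
    have h' : (∏ j ∈ (∅ : Finset (Fin n)), x j) ^ p • m = 0 := h
    simpa using h'
  · intro y
    obtain ⟨⟨m, ⟨_, p, rfl⟩⟩, h⟩ := IsLocalizedModule.surj
      (Submonoid.powers (∏ j ∈ (∅ : Finset (Fin n)), x j)) g y
    have h' : (∏ j ∈ (∅ : Finset (Fin n)), x j) ^ p • y = g m := h
    exact ⟨m, by simpa using h'.symm⟩

section DegreeZero

variable {M : Type*} [AddCommGroup M] [Module R M] {L : Finset (Fin n) → Type*}
  [∀ F, AddCommGroup (L F)] [∀ F, Module R (L F)] (f : ∀ F, M →ₗ[R] L F)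
  [∀ F, IsLocalizedModule (Submonoid.powers (∏ j ∈ F, x j)) (f F)]

/-- The inclusion of the cohomology in degree `0` into the module. -/
noncomputable def zeroEval : seqCohomology (d x f) 0 →ₗ[R] M :=
  Submodule.liftQ _ ((LinearEquiv.ofBijective (f ∅) (bijective_empty x (f ∅))).symm.toLinearMap ∘ₗ
    LinearMap.proj (R := R) (φ := fun F : {F : Finset (Fin n) // F.card = 0} => L F.1)
      ⟨∅, Finset.card_empty⟩ ∘ₗ (LinearMap.ker (d x f 0)).subtype) (by
      intro c hc
      have : c = 0 := Subtype.ext hc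
      rw [this]
      exact zero_mem _)

lemma f_zeroEval_mk (c : LinearMap.ker (d x f 0)) :
    f ∅ (zeroEval x f (Submodule.Quotient.mk c)) = c.1 ⟨∅, Finset.card_empty⟩ :=
  (LinearEquiv.ofBijective (f ∅) (bijective_empty x (f ∅))).apply_symm_apply _

lemma zeroEval_injective : Function.Injective (zeroEval x f) := by
  rw [injective_iff_map_eq_zero]
  intro z hz
  obtain ⟨c, rfl⟩ := Submodule.Quotient.mk_surjective _ z
  have h := f_zeroEval_mk x f c
  rw [hz, map_zero] at h
  have : c = 0 := Subtype.ext (ext_zero h.symm)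
  rw [this]
  rfl

lemma d_zero_eq_zero_iff (m : M) :
    d x f 0 (fun F => f F.1 m) = 0 ↔ ∀ v, ∃ k : ℕ, x v ^ k • m = 0 := by
  have key : ∀ G : {F : Finset (Fin n) // F.card = 0 + 1}, ∀ v, G.1 = {v} →
      (d x f 0 (fun F => f F.1 m) G = 0 ↔ ∃ k : ℕ, x v ^ k • m = 0) := by
    rintro ⟨G, hG⟩ v (rfl : G = {v})
    rw [d_eq_totalD x f _ (fun F => f F m) (fun _ => rfl), totalD_apply, Finset.sum_singleton,
      resOrZero_of_subset x f (Finset.erase_subset _ _), res_apply]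
    have hp : FinSimplicialComplex.position {v} v = 0 := by
      simp [FinSimplicialComplex.position]
    rw [hp, pow_zero, one_smul]
    constructor
    · intro h
      obtain ⟨k, hk⟩ := exists_pow_smul_eq_zero x f h
      exact ⟨k, by simpa using hk⟩
    · rintro ⟨k, hk⟩
      refine smul_injective_of_subset x (Finset.Subset.refl {v}) (f _) k ?_
      dsimp only
      rw [← map_smul, Finset.prod_singleton, hk, map_zero, smul_zero]
  constructor
  · intro h v
    exact (key ⟨{v}, Finset.card_singleton v⟩ v rfl).1 (congrFun h _)
  · intro h
    funext G
    obtain ⟨v, hv⟩ := Finset.card_eq_one.1 (show G.1.card = 1 from G.2)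
    exact (key G v hv).2 (h v)

/-- If every generator has a power killing `m`, the ideal lies in the radical of the annihilator of
`m`; being finitely generated, it has a power inside the annihilator. -/
lemma mem_torsion_span_range_iff (m : M) :
    m ∈ torsion (Ideal.span (Set.range x)) M ↔ ∀ v, ∃ k : ℕ, x v ^ k • m = 0 := by
  constructor
  · rintro ⟨t, ht⟩ v
    exact ⟨t, ht _ (Ideal.pow_mem_pow (Ideal.subset_span (Set.mem_range_self v)) t)⟩
  · intro h
    have hle : Ideal.span (Set.range x) ≤
        Ideal.radical (LinearMap.ker (LinearMap.toSpanSingleton R M m)) := by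
      rw [Ideal.span_le]
      rintro _ ⟨v, rfl⟩
      exact h v
    obtain ⟨t, ht⟩ := Ideal.exists_pow_le_of_le_radical_of_fg hle
      (Submodule.fg_span (Set.finite_range x))
    exact ⟨t, fun r hr => ht hr⟩

lemma range_zeroEval :
    LinearMap.range (zeroEval x f) = torsion (Ideal.span (Set.range x)) M := by
  ext m
  rw [mem_torsion_span_range_iff, ← d_zero_eq_zero_iff x f]
  constructor
  · rintro ⟨z, rfl⟩
    obtain ⟨c, rfl⟩ := Submodule.Quotient.mk_surjective _ z
    have h : (fun F : {F : Finset (Fin n) // F.card = 0} =>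
        f F.1 (zeroEval x f (Submodule.Quotient.mk c))) = c.1 := ext_zero (f_zeroEval_mk x f c)
    rw [h]
    exact c.2
  · intro h
    exact ⟨Submodule.Quotient.mk ⟨_, h⟩, (bijective_empty x (f ∅)).1 (f_zeroEval_mk x f ⟨_, h⟩)⟩

end DegreeZero

section Comparison

variable {M N : Type*} [AddCommGroup M] [Module R M] [AddCommGroup N] [Module R N]
  {L L' : Finset (Fin n) → Type*}
  [∀ F, AddCommGroup (L F)] [∀ F, Module R (L F)] (f : ∀ F, M →ₗ[R] L F)
  [∀ F, IsLocalizedModule (Submonoid.powers (∏ j ∈ F, x j)) (f F)]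
  [∀ F, AddCommGroup (L' F)] [∀ F, Module R (L' F)] (f' : ∀ F, N →ₗ[R] L' F)
  [∀ F, IsLocalizedModule (Submonoid.powers (∏ j ∈ F, x j)) (f' F)] (g : M →ₗ[R] N)

lemma zeroEval_seqCohomologyMap (c : LinearMap.ker (d x f 0)) :
    zeroEval x f' (seqCohomologyMap (d x f) (d x f') (cochainMap x f f' g)
      (cochainMap_d x f f' g) 0 c) = g (zeroEval x f (Submodule.Quotient.mk c)) := by
  apply (bijective_empty x (f' ∅)).1
  rw [← locMap_apply x f f' g, f_zeroEval_mk]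
  exact f_zeroEval_mk x f' _

/-- Together with `range_colimMap_extSystemMap_zero`, this shows that both theories divide the
torsion of `N` by the same submodule. -/
lemma map_range_seqCohomologyMap_zero :
    (LinearMap.range (seqCohomologyMap (d x f) (d x f') (cochainMap x f f' g)
      (cochainMap_d x f f' g) 0)).map (zeroEval x f') =
        (torsion (Ideal.span (Set.range x)) M).map g := by
  rw [← range_zeroEval x f]
  ext y
  constructor
  · rintro ⟨_, ⟨c, rfl⟩, rfl⟩
    exact ⟨_, ⟨_, rfl⟩, (zeroEval_seqCohomologyMap x f f' g c).symm⟩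
  · rintro ⟨_, ⟨z, rfl⟩, rfl⟩
    obtain ⟨c, rfl⟩ := Submodule.Quotient.mk_surjective _ z
    exact ⟨_, ⟨c, rfl⟩, zeroEval_seqCohomologyMap x f f' g c⟩

end Comparison

lemma range_colimMap_extSystemMap_zero (J : Ideal R) {M N : ModuleCat.{u} R} (g : M ⟶ N) :
    (LinearMap.range (colimMap (extSystemMap J 0 g)).hom).map (extZeroEval J N).hom =
      (torsion J M).map g.hom := by
  rw [← range_extZeroEval, ← LinearMap.range_comp, ← LinearMap.range_comp, ← ModuleCat.hom_comp,
    ← ModuleCat.hom_comp, extZeroEval_naturality]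

/-- Over a Noetherian ring, local cohomology is the cohomology of the Čech complex. -/
theorem nonempty_colimit_extSystem_equiv [IsNoetherianRing R] (i : ℕ) :
    ∀ (M : ModuleCat.{u} R) {L : Finset (Fin n) → Type u} [∀ F, AddCommGroup (L F)]
      [∀ F, Module R (L F)] (f : ∀ F, M →ₗ[R] L F)
      [∀ F, IsLocalizedModule (Submonoid.powers (∏ j ∈ F, x j)) (f F)],
      Nonempty ((colimit (extSystem (Ideal.span (Set.range x)) i M) : ModuleCat.{u} R) ≃ₗ[R]
        seqCohomology (d x f) i) := by
  induction i with
  | zero =>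
    intro M L _ _ f _
    have h : LinearMap.range (extZeroEval (Ideal.span (Set.range x)) M).hom =
        LinearMap.range (zeroEval x f) := by rw [range_extZeroEval, range_zeroEval]
    exact ⟨(LinearEquiv.ofInjective _ (extZeroEval_injective _ M)).trans
      ((LinearEquiv.ofEq _ _ h).trans (LinearEquiv.ofInjective _ (zeroEval_injective x f)).symm)⟩
  | succ i ih =>
    intro M L _ _ f _
    let E := Injective.under M
    have : Module.Injective R E := @Module.injective_module_of_injective_object R E _ _ _
      (inferInstanceAs (Injective (Injective.under M)))
    let S : ShortComplex (ModuleCat.{u} R) :=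
      ShortComplex.mk (Injective.ι M) (cokernel.π (Injective.ι M)) (cokernel.condition _)
    have hS : S.ShortExact :=
      { exact := ShortComplex.exact_of_g_is_cokernel _ (cokernelIsCokernel _)
        mono_f := inferInstanceAs (Mono (Injective.ι M))
        epi_g := inferInstanceAs (Epi (cokernel.π (Injective.ι M))) }
    have : Injective S.X₂ := inferInstanceAs (Injective (Injective.under M))
    let fE : ∀ F : Finset (Fin n), S.X₂ →ₗ[R]
        LocalizedModule (Submonoid.powers (∏ j ∈ F, x j)) S.X₂ :=
      fun F => LocalizedModule.mkLinearMap _ _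
    let fN : ∀ F : Finset (Fin n), S.X₃ →ₗ[R]
        LocalizedModule (Submonoid.powers (∏ j ∈ F, x j)) S.X₃ :=
      fun F => LocalizedModule.mkLinearMap _ _
    obtain ⟨e₁⟩ := nonempty_colimit_extSystem_succ (Ideal.span (Set.range x)) hS i
    obtain ⟨e₂⟩ := nonempty_seqCohomology_succ_equiv (d x f) (d x fE) (d x fN)
      (cochainMap x f fE S.f.hom) (cochainMap x fE fN S.g.hom)
      (cochainMap_d x f fE S.f.hom) (cochainMap_d x fE fN S.g.hom) (d_comp_d x fE)
      (cochainMap_injective x f fE S.f.hom hS.moduleCat_injective_f)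
      (cochainMap_exact x f fE S.f.hom fN S.g.hom
        ((ShortComplex.ShortExact.moduleCat_exact_iff_function_exact S).1 hS.exact))
      (cochainMap_surjective x fE fN S.g.hom hS.moduleCat_surjective_g) i
      (ker_d_le_range_of_injective x fE i)
    suffices h : Nonempty (((colimit (extSystem (Ideal.span (Set.range x)) i S.X₃) :
        ModuleCat.{u} R) ⧸ LinearMap.range
          (colimMap (extSystemMap (Ideal.span (Set.range x)) i S.g)).hom) ≃ₗ[R]
        seqCohomology (d x fN) i ⧸ LinearMap.range (seqCohomologyMap (d x fE) (d x fN)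
          (cochainMap x fE fN S.g.hom) (cochainMap_d x fE fN S.g.hom) i)) by
      obtain ⟨e⟩ := h
      exact ⟨e₁.trans (e.trans e₂.symm)⟩
    -- From degree 0 to degree 1 the cohomology of the injective module does not vanish, and both
    -- cokernels are compared inside `S.X₃`. In higher degrees the maps out of it are zero and the
    -- induction hypothesis suffices.
    cases i with
    | zero =>
      exact nonempty_quotient_equiv_of_range_eq _ _ (extZeroEval_injective _ S.X₃)
        (zeroEval_injective x fN) (by rw [range_extZeroEval, range_zeroEval]) _ _
        (by rw [range_colimMap_extSystemMap_zero, map_range_seqCohomologyMap_zero])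
    | succ i =>
      obtain ⟨e⟩ := ih S.X₃ fN
      have h1 := subsingleton_colimit_extSystem_succ (Ideal.span (Set.range x)) S.X₂ i
      have h2 : LinearMap.range
          (colimMap (extSystemMap (Ideal.span (Set.range x)) (i + 1) S.g)).hom = ⊥ := by
        rw [LinearMap.range_eq_bot]
        exact LinearMap.ext fun z => by rw [Subsingleton.elim z 0, map_zero, map_zero]
      rw [h2, seqCohomologyMap_range_eq_bot _ _ _ _ _ (ker_d_le_range_of_injective x fE i)]
      exact ⟨(Submodule.quotEquivOfEqBot _ rfl).trans
        (e.trans (Submodule.quotEquivOfEqBot _ rfl).symm)⟩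

/-- Over a Noetherian ring, local cohomology is the cohomology of the Čech complex. -/
theorem nonempty_localCohomology_equiv [IsNoetherianRing R] (i : ℕ)
    (M : ModuleCat.{u} R) {L : Finset (Fin n) → Type u} [∀ F, AddCommGroup (L F)]
    [∀ F, Module R (L F)] (f : ∀ F, M →ₗ[R] L F)
    [∀ F, IsLocalizedModule (Submonoid.powers (∏ j ∈ F, x j)) (f F)] :
    Nonempty (((localCohomology (Ideal.span (Set.range x)) i).obj M) ≃ₗ[R]
      seqCohomology (d x f) i) := by
  obtain ⟨e⟩ := nonempty_colimit_extSystem_equiv x i M f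
  exact ⟨(objIsoColimit _ i M).toLinearEquiv.trans e⟩

end Cech

/-! ### The comparison for Stanley–Reisner rings -/

namespace FinSimplicialComplex

variable (K : Type u) [Field K] {n : ℕ} (Δ : FinSimplicialComplex n)

/-- The structure map of a localization of `K[Δ]`. -/
noncomputable abbrev toLoc (F : Finset (Fin n)) :
    Δ.stanleyReisnerRing K →ₗ[Δ.stanleyReisnerRing K] Δ.loc K F :=
  Algebra.linearMap _ _

instance toLoc_isLocalizedModule (F : Finset (Fin n)) :
    IsLocalizedModule (Submonoid.powers (∏ j ∈ F, Δ.x K j)) (Δ.toLoc K F) :=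
  inferInstanceAs (IsLocalizedModule (Submonoid.powers (Δ.xProd K F))
    (Algebra.linearMap (Δ.stanleyReisnerRing K) (Δ.loc K F)))

lemma nat_eq_res {F G : Finset (Fin n)} (h : F ⊆ G) :
    (Δ.nat K h).toLinearMap = Cech.res (Δ.x K) (Δ.toLoc K) h :=
  Cech.hom_ext_of_subset (Δ.x K) (Δ.toLoc K) h (Δ.toLoc K G) fun m => by
    rw [Cech.res_apply]
    exact (Δ.nat K h).commutes m

lemma cechD_eq (t : ℕ) : Δ.cechD K t = Cech.d (Δ.x K) (Δ.toLoc K) t := by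
  refine congrArg LinearMap.pi (funext fun G => Finset.sum_congr rfl fun v _ => ?_)
  exact congrArg (fun φ => (-1 : Δ.stanleyReisnerRing K) ^ position G.1 v.1 •
    (φ ∘ₗ LinearMap.proj (deleteVertex G v)))
      (Δ.nat_eq_res K (F := (deleteVertex G v).1) (Finset.erase_subset v.1 G.1))

lemma cechCoboundaries_eq (i : ℕ) : Δ.cechCoboundaries K i = seqCoboundaries (Δ.cechD K) i := by
  cases i <;> rfl

theorem nonempty_localCoh_equiv (i : ℕ) :
    Nonempty (Δ.LocalCoh K i ≃ₗ[Δ.stanleyReisnerRing K] Δ.cechCohomology K i) := by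
  have h := Cech.nonempty_localCohomology_equiv (Δ.x K) i
    (ModuleCat.of (Δ.stanleyReisnerRing K) (Δ.stanleyReisnerRing K)) (Δ.toLoc K)
  have hd : Cech.d (Δ.x K) (Δ.toLoc K) = Δ.cechD K := funext fun t => (Δ.cechD_eq K t).symm
  rw [hd] at h
  unfold cechCohomology
  rw [cechCoboundaries_eq]
  exact h

end FinSimplicialComplex

/-! ### Detecting monomials in Laurent polynomial rings -/

namespace FinSimplicialComplex

variable (K : Type u) [Field K] {n : ℕ} (Δ : FinSimplicialComplex n)

lemma monomial_mem_stanleyReisnerIdeal {b : Fin n →₀ ℕ} (h : b.support ∉ Δ.faces) :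
    MvPolynomial.monomial b (1 : K) ∈ Δ.stanleyReisnerIdeal K := by
  have hle : (Finsupp.indicator b.support fun _ _ => 1) ≤ b := by
    intro j
    rw [Finsupp.indicator_apply]
    split_ifs with hj
    · exact Nat.one_le_iff_ne_zero.2 (Finsupp.mem_support_iff.1 hj)
    · exact Nat.zero_le _
  have h1 : (∏ j ∈ b.support, MvPolynomial.X j : MvPolynomial (Fin n) K) ∣
      MvPolynomial.monomial b 1 := by
    rw [MvPolynomial.monomial_eq, map_one, one_mul]
    exact Finset.prod_dvd_prod_of_dvd _ _ fun j hj =>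
      dvd_pow_self _ (Finsupp.mem_support_iff.1 hj)
  exact Ideal.mem_of_dvd _ h1 (Ideal.subset_span ⟨_, h, rfl⟩)

/-- The support of a multidegree. -/
def degreeSupport (a : Fin n → ℤ) : Finset (Fin n) := Finset.univ.filter fun j => a j ≠ 0

lemma mem_degreeSupport {a : Fin n → ℤ} {j : Fin n} : j ∈ degreeSupport a ↔ a j ≠ 0 := by
  simp [degreeSupport]

/-- The multidegrees `a` for which `K[Δ]_{x_F}` has a nonzero element of degree `a`. -/
def IsDegree (F : Finset (Fin n)) (a : Fin n → ℤ) : Prop :=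
  (∀ j, a j < 0 → j ∈ F) ∧ F ∪ degreeSupport a ∈ Δ.faces

open Classical in
/-- The homomorphism to the Laurent polynomial ring that kills the variables outside `H`. -/
noncomputable def polyToLaurent (H : Finset (Fin n)) :
    MvPolynomial (Fin n) K →ₐ[K] AddMonoidAlgebra K (Fin n → ℤ) :=
  MvPolynomial.aeval fun j => if j ∈ H then AddMonoidAlgebra.single (Pi.single j 1) 1 else 0

open Classical in
lemma polyToLaurent_monomial (H : Finset (Fin n)) (b : Fin n →₀ ℕ) :
    polyToLaurent K H (MvPolynomial.monomial b 1) =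
      if b.support ⊆ H then AddMonoidAlgebra.single (fun j => (b j : ℤ)) 1 else 0 := by
  rw [polyToLaurent, MvPolynomial.aeval_monomial, map_one, one_mul, Finsupp.prod]
  split_ifs with h
  · have h1 : ∀ S : Finset (Fin n), S ⊆ H → ∏ j ∈ S,
        (if j ∈ H then AddMonoidAlgebra.single (Pi.single j 1) (1 : K) else 0) ^ b j =
        AddMonoidAlgebra.single (∑ j ∈ S, b j • (Pi.single j 1 : Fin n → ℤ)) 1 := by
      intro S
      induction S using Finset.induction_on with
      | empty => exact fun _ => rfl
      | insert v S hv ih =>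
        intro hS
        rw [Finset.prod_insert hv, Finset.sum_insert hv,
          ih ((Finset.subset_insert v S).trans hS), if_pos (hS (Finset.mem_insert_self v S)),
          AddMonoidAlgebra.single_pow, AddMonoidAlgebra.single_mul_single, one_pow, one_mul]
    rw [h1 _ h]
    congr 1
    funext i
    rw [Finset.sum_apply]
    by_cases hi : i ∈ b.support
    · rw [Finset.sum_eq_single i]
      · simp
      · intro j _ hj
        simp [Pi.single_eq_of_ne hj.symm]
      · exact fun h => (h hi).elim
    · rw [Finsupp.notMem_support_iff.1 hi, Finset.sum_eq_zero]
      · rfl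
      · intro j hj
        have : i ≠ j := fun hij => hi (hij ▸ hj)
        simp [Pi.single_eq_of_ne this]
  · obtain ⟨j, hj, hjH⟩ := Finset.not_subset.1 h
    refine Finset.prod_eq_zero hj ?_
    rw [if_neg hjH, zero_pow (Finsupp.mem_support_iff.1 hj)]

/-- A nonface is not contained in the face `H`, so each generator has a variable that is killed. -/
lemma polyToLaurent_eq_zero {H : Finset (Fin n)} (hH : H ∈ Δ.faces)
    (p : MvPolynomial (Fin n) K) (hp : p ∈ Δ.stanleyReisnerIdeal K) : polyToLaurent K H p = 0 := by
  have hle : Δ.stanleyReisnerIdeal K ≤ RingHom.ker (polyToLaurent K H) := by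
    refine Ideal.span_le.2 ?_
    rintro _ ⟨F, hF, rfl⟩
    have h : ¬ F ⊆ H := fun h => hF (Δ.down_closed h hH)
    obtain ⟨j, hj, hjH⟩ := Finset.not_subset.1 h
    change polyToLaurent K H _ = 0
    rw [map_prod]
    refine Finset.prod_eq_zero hj ?_
    rw [polyToLaurent, MvPolynomial.aeval_X, if_neg hjH]
  exact hle hp

/-- The homomorphism from `K[Δ]` to the Laurent polynomial ring that kills the variables outside
the face `H`. -/
noncomputable def toLaurent {H : Finset (Fin n)} (hH : H ∈ Δ.faces) :
    Δ.stanleyReisnerRing K →ₐ[K] AddMonoidAlgebra K (Fin n → ℤ) :=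
  Ideal.Quotient.liftₐ _ (polyToLaurent K H) (Δ.polyToLaurent_eq_zero K hH)

lemma toLaurent_mk {H : Finset (Fin n)} (hH : H ∈ Δ.faces) (p : MvPolynomial (Fin n) K) :
    Δ.toLaurent K hH (Ideal.Quotient.mk _ p) = polyToLaurent K H p := rfl

/-- The exponent vector of `x_F ^ m`. -/
noncomputable def powExponent (F : Finset (Fin n)) (m : ℕ) : Fin n →₀ ℕ :=
  Finsupp.indicator F fun _ _ => m

lemma powExponent_apply (F : Finset (Fin n)) (m : ℕ) (j : Fin n) :
    powExponent F m j = if j ∈ F then m else 0 := by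
  rw [powExponent, Finsupp.indicator_apply]
  split_ifs <;> rfl

lemma support_powExponent_subset (F : Finset (Fin n)) (m : ℕ) : (powExponent F m).support ⊆ F :=
  Finsupp.support_indicator_subset _ _

lemma xProd_pow_eq (F : Finset (Fin n)) (m : ℕ) :
    Δ.xProd K F ^ m = Ideal.Quotient.mk _ (MvPolynomial.monomial (powExponent F m) 1) := by
  have h : (∏ j ∈ F, MvPolynomial.X j : MvPolynomial (Fin n) K) ^ m =
      MvPolynomial.monomial (powExponent F m) 1 := by
    rw [← Finset.prod_pow, MvPolynomial.monomial_eq, map_one, one_mul,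
      Finsupp.prod_of_support_subset _ (support_powExponent_subset F m)]
    · refine Finset.prod_congr rfl fun j hj => ?_
      rw [powExponent_apply, if_pos hj]
    · exact fun _ _ => pow_zero _
  rw [← h, map_pow, map_prod]
  rfl

lemma toLaurent_xProd_pow {H F : Finset (Fin n)} (hH : H ∈ Δ.faces) (hF : F ⊆ H) (m : ℕ) :
    Δ.toLaurent K hH (Δ.xProd K F ^ m) =
      AddMonoidAlgebra.single (fun j => if j ∈ F then (m : ℤ) else 0) 1 := by
  rw [xProd_pow_eq, toLaurent_mk, polyToLaurent_monomial,
    if_pos ((support_powExponent_subset F m).trans hF)]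
  congr 1
  funext j
  rw [powExponent_apply]
  split_ifs <;> simp

lemma isUnit_toLaurent {H F : Finset (Fin n)} (hH : H ∈ Δ.faces) (hF : F ⊆ H)
    (y : Submonoid.powers (Δ.xProd K F)) : IsUnit (Δ.toLaurent K hH y) := by
  obtain ⟨_, m, rfl⟩ := y
  change IsUnit (Δ.toLaurent K hH (Δ.xProd K F ^ m))
  rw [toLaurent_xProd_pow K Δ hH hF]
  refine IsUnit.of_mul_eq_one
    (AddMonoidAlgebra.single (fun j => if j ∈ F then -(m : ℤ) else 0) 1) ?_
  rw [AddMonoidAlgebra.single_mul_single, one_mul, AddMonoidAlgebra.one_def]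
  congr 1
  funext j
  simp only [Pi.add_apply, Pi.zero_apply]
  split_ifs <;> simp

/-- The homomorphism from `K[Δ]_{x_F}` to the Laurent polynomial ring that kills the variables
outside the face `H ⊇ F`. -/
noncomputable def locToLaurent {H F : Finset (Fin n)} (hH : H ∈ Δ.faces) (hF : F ⊆ H) :
    Δ.loc K F →ₐ[K] AddMonoidAlgebra K (Fin n → ℤ) :=
  IsLocalization.liftAlgHom (M := Submonoid.powers (Δ.xProd K F)) (Δ.isUnit_toLaurent K hH hF)

/-- The fraction `x^b / x_F^m`. -/
noncomputable def frac (F : Finset (Fin n)) (b : Fin n →₀ ℕ) (m : ℕ) : Δ.loc K F :=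
  Localization.mk (Ideal.Quotient.mk (Δ.stanleyReisnerIdeal K) (MvPolynomial.monomial b 1))
    ⟨Δ.xProd K F ^ m, pow_mem (Submonoid.mem_powers _) m⟩

/-- The degree of `x^b / x_F^m`. -/
def fracDegree (F : Finset (Fin n)) (b : Fin n →₀ ℕ) (m : ℕ) : Fin n → ℤ :=
  fun j => (b j : ℤ) - if j ∈ F then (m : ℤ) else 0

lemma frac_mul (F : Finset (Fin n)) (b : Fin n →₀ ℕ) (m : ℕ) :
    Δ.frac K F b m * algebraMap _ _ (Δ.xProd K F ^ m) =
      algebraMap _ _ (Ideal.Quotient.mk (Δ.stanleyReisnerIdeal K) (MvPolynomial.monomial b 1)) := by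
  rw [frac, Localization.mk_eq_mk']
  exact IsLocalization.mk'_spec _ _ _

/-- Outside `F` the exponent and the degree coincide, and inside `F` nothing has to be checked. -/
lemma support_subset_iff {H F : Finset (Fin n)} (hF : F ⊆ H) (b : Fin n →₀ ℕ) (m : ℕ) :
    b.support ⊆ H ↔ degreeSupport (fracDegree F b m) ⊆ H := by
  constructor
  · intro h j hj
    by_cases hjF : j ∈ F
    · exact hF hjF
    · rw [mem_degreeSupport, fracDegree, if_neg hjF, sub_zero] at hj
      exact h (Finsupp.mem_support_iff.2 (by exact_mod_cast hj))
  · intro h j hj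
    by_cases hjF : j ∈ F
    · exact hF hjF
    · refine h ?_
      rw [mem_degreeSupport, fracDegree, if_neg hjF, sub_zero]
      exact_mod_cast Finsupp.mem_support_iff.1 hj

open Classical in
lemma locToLaurent_frac {H F : Finset (Fin n)} (hH : H ∈ Δ.faces) (hF : F ⊆ H) (b : Fin n →₀ ℕ)
    (m : ℕ) : Δ.locToLaurent K hH hF (Δ.frac K F b m) =
      if degreeSupport (fracDegree F b m) ⊆ H then
        AddMonoidAlgebra.single (fracDegree F b m) 1 else 0 := by
  have h1 : ∀ y, Δ.locToLaurent K hH hF (algebraMap _ _ y) = Δ.toLaurent K hH y := fun y =>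
    IsLocalization.lift_eq _ y
  have h2 := congrArg (Δ.locToLaurent K hH hF) (Δ.frac_mul K F b m)
  rw [map_mul, h1, h1, toLaurent_mk, polyToLaurent_monomial] at h2
  apply (Δ.isUnit_toLaurent K hH hF ⟨Δ.xProd K F ^ m, m, rfl⟩).mul_right_cancel
  rw [h2, toLaurent_xProd_pow K Δ hH hF]
  simp only [support_subset_iff hF b m]
  split_ifs
  · rw [AddMonoidAlgebra.single_mul_single, one_mul]
    congr 1
    funext j
    simp [fracDegree]
  · rw [zero_mul]

end FinSimplicialComplex

/-! ### Monomial bases and homogeneous projections of the localizations -/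

namespace FinSimplicialComplex

variable (K : Type u) [Field K] {n : ℕ} (Δ : FinSimplicialComplex n)

lemma mk_monomial_mul (b c : Fin n →₀ ℕ) :
    Ideal.Quotient.mk (Δ.stanleyReisnerIdeal K) (MvPolynomial.monomial b 1) *
      Ideal.Quotient.mk (Δ.stanleyReisnerIdeal K) (MvPolynomial.monomial c 1) =
    Ideal.Quotient.mk (Δ.stanleyReisnerIdeal K) (MvPolynomial.monomial (b + c) 1) := by
  rw [← map_mul, MvPolynomial.monomial_mul, one_mul]

lemma eq_frac {F : Finset (Fin n)} {b : Fin n →₀ ℕ} {m : ℕ} {y : Δ.loc K F}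
    (h : y * algebraMap _ _ (Δ.xProd K F ^ m) =
      algebraMap _ _ (Ideal.Quotient.mk (Δ.stanleyReisnerIdeal K) (MvPolynomial.monomial b 1))) :
    y = Δ.frac K F b m := by
  rw [frac, Localization.mk_eq_mk']
  exact (IsLocalization.eq_mk'_iff_mul_eq).2 h

lemma frac_add_pow (F : Finset (Fin n)) (b : Fin n →₀ ℕ) (m k : ℕ) :
    Δ.frac K F b m = Δ.frac K F (b + powExponent F k) (m + k) := by
  apply eq_frac
  rw [pow_add, map_mul, ← mul_assoc, frac_mul, xProd_pow_eq K Δ F k, ← map_mul, mk_monomial_mul]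

/-- Over the common denominator `x_F ^ (m + m')` the numerators have equal exponents. -/
lemma frac_eq_of_degree_eq {F : Finset (Fin n)} {b b' : Fin n →₀ ℕ} {m m' : ℕ}
    (h : fracDegree F b m = fracDegree F b' m') : Δ.frac K F b m = Δ.frac K F b' m' := by
  rw [frac_add_pow K Δ F b m m', frac_add_pow K Δ F b' m' m, add_comm m' m]
  congr 1
  ext j
  have hj := congrFun h j
  simp only [fracDegree] at hj
  rw [Finsupp.add_apply, Finsupp.add_apply, powExponent_apply, powExponent_apply]
  split_ifs at hj ⊢ <;> omega

lemma nonneg_fracDegree {F : Finset (Fin n)} {b : Fin n →₀ ℕ} {m : ℕ} (j : Fin n)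
    (h : fracDegree F b m j < 0) : j ∈ F := by
  by_contra hj
  rw [fracDegree, if_neg hj] at h
  omega

/-- After numerator and denominator are multiplied by `x_F`, the support of the numerator contains
`F` as well as the support of the degree, so it is a nonface. -/
lemma frac_eq_zero {F : Finset (Fin n)} {b : Fin n →₀ ℕ} {m : ℕ}
    (h : F ∪ degreeSupport (fracDegree F b m) ∉ Δ.faces) : Δ.frac K F b m = 0 := by
  have hs : F ∪ degreeSupport (fracDegree F b m) ⊆ (b + powExponent F 1).support := by
    intro j hj
    rw [Finsupp.mem_support_iff, Finsupp.add_apply, powExponent_apply]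
    by_cases hjF : j ∈ F
    · rw [if_pos hjF]
      omega
    · have := (Finset.mem_union.1 hj).resolve_left hjF
      rw [mem_degreeSupport, fracDegree, if_neg hjF] at this
      omega
  rw [frac_add_pow K Δ F b m 1, frac, Ideal.Quotient.eq_zero_iff_mem.2
    (Δ.monomial_mem_stanleyReisnerIdeal K fun h' => h (Δ.down_closed hs h')), Localization.mk_zero]

lemma nat_frac {F G : Finset (Fin n)} (h : F ⊆ G) (b : Fin n →₀ ℕ) (m : ℕ) :
    Δ.nat K h (Δ.frac K F b m) = Δ.frac K G (b + powExponent (G \ F) m) m := by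
  have hp : Δ.xProd K G ^ m = Δ.xProd K F ^ m * Δ.xProd K (G \ F) ^ m := by
    rw [← mul_pow, mul_comm]
    exact congrArg (· ^ m) (Finset.prod_sdiff h).symm
  have hp' := congrArg (algebraMap _ (Δ.loc K G)) hp
  rw [map_mul] at hp'
  have h1 := congrArg (Δ.nat K h) (Δ.frac_mul K F b m)
  rw [map_mul, AlgHom.commutes, AlgHom.commutes] at h1
  apply eq_frac
  rw [hp', ← mul_assoc, h1, xProd_pow_eq K Δ (G \ F) m, ← map_mul,
    mk_monomial_mul]

lemma fracDegree_nat {F G : Finset (Fin n)} (h : F ⊆ G) (b : Fin n →₀ ℕ) (m : ℕ) :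
    fracDegree G (b + powExponent (G \ F) m) m = fracDegree F b m := by
  funext j
  simp only [fracDegree, Finsupp.add_apply, powExponent_apply, Finset.mem_sdiff]
  by_cases hF : j ∈ F
  · simp [hF, h hF]
  · by_cases hG : j ∈ G <;> simp [hF, hG]

lemma span_frac (F : Finset (Fin n)) :
    Submodule.span K {y | ∃ b m, y = Δ.frac K F b m} = ⊤ := by
  rw [eq_top_iff]
  rintro y -
  obtain ⟨p, ⟨_, m, rfl⟩, rfl⟩ := IsLocalization.exists_mk'_eq (Submonoid.powers (Δ.xProd K F)) y
  obtain ⟨q, rfl⟩ := Ideal.Quotient.mk_surjective p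
  have hmk : ∀ q, IsLocalization.mk' (Δ.loc K F) (Ideal.Quotient.mk (Δ.stanleyReisnerIdeal K) q)
      (⟨Δ.xProd K F ^ m, m, rfl⟩ : Submonoid.powers (Δ.xProd K F)) =
      algebraMap _ _ (Ideal.Quotient.mk (Δ.stanleyReisnerIdeal K) q) *
        IsLocalization.mk' (Δ.loc K F) 1
          (⟨Δ.xProd K F ^ m, m, rfl⟩ : Submonoid.powers (Δ.xProd K F)) := fun q => by
    rw [IsLocalization.mul_mk'_eq_mk'_of_mul, mul_one]
  change IsLocalization.mk' (Δ.loc K F) _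
    (⟨Δ.xProd K F ^ m, m, rfl⟩ : Submonoid.powers (Δ.xProd K F)) ∈ _
  induction q using MvPolynomial.induction_on' with
  | monomial b c =>
    have hc : MvPolynomial.monomial b c = c • MvPolynomial.monomial b 1 := by
      rw [MvPolynomial.smul_monomial, smul_eq_mul, mul_one]
    have : Ideal.Quotient.mk (Δ.stanleyReisnerIdeal K) (c • MvPolynomial.monomial b 1) =
      c • Ideal.Quotient.mk (Δ.stanleyReisnerIdeal K) (MvPolynomial.monomial b 1) := rfl
    rw [hmk, hc, this, show ∀ z, algebraMap (Δ.stanleyReisnerRing K) (Δ.loc K F) (c • z) =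
      c • algebraMap _ _ z from map_smul (IsScalarTower.toAlgHom K _ (Δ.loc K F)) c, smul_mul_assoc, ← hmk, ← Localization.mk_eq_mk']
    exact Submodule.smul_mem _ _ (Submodule.subset_span ⟨b, m, rfl⟩)
  | add p q hp hq =>
    rw [hmk, map_add, map_add, add_mul, ← hmk, ← hmk]
    exact add_mem hp hq

lemma loc_hom_ext {F : Finset (Fin n)} {V : Type*} [AddCommGroup V] [Module K V]
    {f g : Δ.loc K F →ₗ[K] V} (h : ∀ b m, f (Δ.frac K F b m) = g (Δ.frac K F b m)) : f = g := by
  refine LinearMap.ext_on (Δ.span_frac K F) ?_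
  rintro _ ⟨b, m, rfl⟩
  exact h b m

open Classical in
/-- The coefficient of the monomial of degree `a` of an element of `K[Δ]_{x_F}`. -/
noncomputable def coef (F : Finset (Fin n)) (a : Fin n → ℤ) : Δ.loc K F →ₗ[K] K :=
  if h : Δ.IsDegree F a then
    { toFun := fun y => (Δ.locToLaurent K h.2 Finset.subset_union_left y).coeff a
      map_add' := fun y z => by simp
      map_smul' := fun c y => by simp }
  else 0

-- The face `F ∪ supp a` is the right one for testing degree `a`: a fraction of that degree survives
-- when the other variables are killed, while a fraction of another degree cannot contribute to the
-- coefficient.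
open Classical in
lemma coef_frac (F : Finset (Fin n)) (a : Fin n → ℤ) (b : Fin n →₀ ℕ) (m : ℕ) :
    Δ.coef K F a (Δ.frac K F b m) = if Δ.IsDegree F a ∧ fracDegree F b m = a then 1 else 0 := by
  by_cases h : Δ.IsDegree F a
  · rw [coef, dif_pos h]
    simp only [h, true_and]
    change (Δ.locToLaurent K h.2 Finset.subset_union_left (Δ.frac K F b m)).coeff a = _
    rw [locToLaurent_frac]
    by_cases ha : fracDegree F b m = a
    · rw [ha, if_pos rfl, if_pos Finset.subset_union_right]
      simp
    · rw [if_neg ha]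
      split_ifs
      · simp [ha]
      · rfl
  · rw [coef, dif_neg h, if_neg fun h' => h h'.1, LinearMap.zero_apply]

/-- The monomial of degree `a` in `K[Δ]_{x_F}`. -/
noncomputable def mono (F : Finset (Fin n)) (a : Fin n → ℤ) : Δ.loc K F :=
  Δ.frac K F (Finsupp.equivFunOnFinite.symm fun j =>
    (a j + if j ∈ F then (∑ i, (a i).natAbs : ℤ) else 0).toNat) (∑ i, (a i).natAbs)

/-- The denominator exponent `∑ |a i|` is at least each `|a j|`, so the numerator exponents are
nonnegative on `F`; off `F` they are by hypothesis. Hence `toNat` loses nothing. -/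
lemma mono_eq_frac {F : Finset (Fin n)} {a : Fin n → ℤ} (h : ∀ j, a j < 0 → j ∈ F) :
    ∃ b m, Δ.mono K F a = Δ.frac K F b m ∧ fracDegree F b m = a := by
  refine ⟨_, _, rfl, ?_⟩
  funext j
  have h1 : (a j).natAbs ≤ ∑ i, (a i).natAbs :=
    Finset.single_le_sum (f := fun i => (a i).natAbs) (fun _ _ => Nat.zero_le _)
      (Finset.mem_univ j)
  have h2 := h j
  simp only [fracDegree, Finsupp.equivFunOnFinite_symm_apply_apply, ← Nat.cast_sum]
  by_cases hj : j ∈ F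
  · simp only [hj, if_true]
    omega
  · simp only [hj, if_false]
    have : ¬ a j < 0 := fun h => hj (h2 h)
    omega

lemma frac_eq_mono (F : Finset (Fin n)) (b : Fin n →₀ ℕ) (m : ℕ) :
    Δ.frac K F b m = Δ.mono K F (fracDegree F b m) := by
  obtain ⟨b', m', h1, h2⟩ := Δ.mono_eq_frac K (nonneg_fracDegree (F := F) (b := b) (m := m))
  rw [h1, frac_eq_of_degree_eq K Δ h2]

lemma mono_eq_zero {F : Finset (Fin n)} {a : Fin n → ℤ} (h : ∀ j, a j < 0 → j ∈ F)
    (ha : ¬ Δ.IsDegree F a) : Δ.mono K F a = 0 := by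
  obtain ⟨b, m, h1, rfl⟩ := Δ.mono_eq_frac K h
  rw [h1]
  exact Δ.frac_eq_zero K fun h' => ha ⟨h, h'⟩

lemma nat_mono {F G : Finset (Fin n)} (hFG : F ⊆ G) {a : Fin n → ℤ} (h : ∀ j, a j < 0 → j ∈ F) :
    Δ.nat K hFG (Δ.mono K F a) = Δ.mono K G a := by
  obtain ⟨b, m, h1, rfl⟩ := Δ.mono_eq_frac K h
  rw [h1, nat_frac, frac_eq_mono, fracDegree_nat hFG]

open Classical in
lemma coef_mono {F : Finset (Fin n)} {a : Fin n → ℤ} (h : Δ.IsDegree F a) (b : Fin n → ℤ) :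
    Δ.coef K F b (Δ.mono K F a) = if a = b then 1 else 0 := by
  obtain ⟨c, m, h1, h2⟩ := Δ.mono_eq_frac K h.1
  rw [h1, coef_frac, h2]
  by_cases hab : a = b
  · subst hab
    simp [h]
  · simp [hab]

/-- Checked on fractions, whose degree is preserved. A fraction of degree `a` over `x_F` forces the
negative support of `a` into `F`, so `a` is then a degree for `F` as well. -/
lemma coef_nat {F G : Finset (Fin n)} (hFG : F ⊆ G) {a : Fin n → ℤ} (h : Δ.IsDegree G a)
    (y : Δ.loc K F) : Δ.coef K G a (Δ.nat K hFG y) = Δ.coef K F a y := by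
  classical
  have : Δ.coef K G a ∘ₗ (Δ.nat K hFG).toLinearMap.restrictScalars K = Δ.coef K F a := by
    refine loc_hom_ext K Δ fun b m => ?_
    change Δ.coef K G a (Δ.nat K hFG _) = _
    rw [nat_frac, coef_frac, coef_frac, fracDegree_nat hFG]
    refine if_congr (and_congr_left fun hb => ?_) rfl rfl
    refine iff_of_true h ⟨?_, Δ.down_closed (Finset.union_subset_union_left hFG) h.2⟩
    rw [← hb]
    exact nonneg_fracDegree
  exact LinearMap.congr_fun this y

lemma coef_of_not_isDegree {F : Finset (Fin n)} {a : Fin n → ℤ} (h : ¬ Δ.IsDegree F a) :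
    Δ.coef K F a = 0 := by
  rw [coef, dif_neg h]

/-- The projection of `K[Δ]_{x_F}` to its component of degree `a`. -/
noncomputable def locProj (a : Fin n → ℤ) (F : Finset (Fin n)) : Δ.loc K F →ₗ[K] Δ.loc K F :=
  LinearMap.toSpanSingleton K _ (Δ.mono K F a) ∘ₗ Δ.coef K F a

lemma locProj_apply (a : Fin n → ℤ) (F : Finset (Fin n)) (y : Δ.loc K F) :
    Δ.locProj K a F y = Δ.coef K F a y • Δ.mono K F a := rfl

open Classical in
lemma locProj_frac (a : Fin n → ℤ) (F : Finset (Fin n)) (b : Fin n →₀ ℕ) (m : ℕ) :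
    Δ.locProj K a F (Δ.frac K F b m) = if fracDegree F b m = a then Δ.frac K F b m else 0 := by
  rw [locProj_apply, coef_frac]
  by_cases ha : fracDegree F b m = a
  · subst ha
    by_cases h : Δ.IsDegree F (fracDegree F b m)
    · simp [h, ← frac_eq_mono]
    · rw [if_neg fun h' => h h'.1, if_pos rfl, zero_smul,
        frac_eq_zero K Δ fun h' => h ⟨nonneg_fracDegree, h'⟩]
  · simp [ha]

lemma range_locProj (a : Fin n → ℤ) (F : Finset (Fin n)) :
    LinearMap.range (Δ.locProj K a F) = Δ.locDegree K F a := by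
  classical
  apply le_antisymm
  · rintro _ ⟨y, rfl⟩
    rw [locProj_apply]
    by_cases h : Δ.IsDegree F a
    · obtain ⟨b, m, h1, h2⟩ := Δ.mono_eq_frac K h.1
      refine Submodule.smul_mem _ _ (Submodule.subset_span ⟨b, m, fun j => ?_, h1⟩)
      exact (congrFun h2 j).symm
    · rw [coef_of_not_isDegree K Δ h, LinearMap.zero_apply, zero_smul]
      exact zero_mem _
  · refine Submodule.span_le.2 ?_
    rintro _ ⟨b, m, hb, rfl⟩
    refine ⟨Δ.frac K F b m, ?_⟩
    rw [locProj_frac, if_pos (show fracDegree F b m = a from funext fun j => (hb j).symm)]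
    rfl

open Classical in
lemma locProj_locProj (a b : Fin n → ℤ) (F : Finset (Fin n)) (y : Δ.loc K F) :
    Δ.locProj K a F (Δ.locProj K b F y) = if b = a then Δ.locProj K b F y else 0 := by
  by_cases h : Δ.IsDegree F b
  · rw [locProj_apply K Δ b, map_smul, locProj_apply K Δ a, coef_mono K Δ h]
    split_ifs with hb
    · rw [one_smul, hb]
    · rw [zero_smul, smul_zero]
  · rw [locProj_apply K Δ b, coef_of_not_isDegree K Δ h]
    simp

/-- Allowing every larger `S'` lets the supports of two summands, and later of all components of a
cochain, be enlarged to a common set. -/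
lemma exists_sum_locProj (F : Finset (Fin n)) (y : Δ.loc K F) :
    ∃ S : Finset (Fin n → ℤ), ∀ S', S ⊆ S' → ∑ a ∈ S', Δ.locProj K a F y = y := by
  classical
  have hy : y ∈ Submodule.span K {y | ∃ b m, y = Δ.frac K F b m} := by
    rw [span_frac]
    trivial
  induction hy using Submodule.span_induction with
  | mem y hy =>
    obtain ⟨b, m, rfl⟩ := hy
    refine ⟨{fracDegree F b m}, fun S' hS' => ?_⟩
    simp only [locProj_frac]
    rw [Finset.sum_ite_eq, if_pos (hS' (Finset.mem_singleton_self _))]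
  | zero => exact ⟨∅, fun S' _ => by simp⟩
  | add y z _ _ hy hz =>
    obtain ⟨S, hS⟩ := hy
    obtain ⟨T, hT⟩ := hz
    refine ⟨S ∪ T, fun S' h => ?_⟩
    simp only [map_add]
    rw [Finset.sum_add_distrib, hS S' (Finset.subset_union_left.trans h),
      hT S' (Finset.subset_union_right.trans h)]
  | smul c y _ hy =>
    obtain ⟨S, hS⟩ := hy
    refine ⟨S, fun S' h => ?_⟩
    simp only [map_smul]
    rw [← Finset.smul_sum, hS S' h]

lemma nat_locProj {F G : Finset (Fin n)} (hFG : F ⊆ G) (a : Fin n → ℤ) (y : Δ.loc K F) :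
    Δ.nat K hFG (Δ.locProj K a F y) = Δ.locProj K a G (Δ.nat K hFG y) := by
  classical
  have : (Δ.nat K hFG).toLinearMap.restrictScalars K ∘ₗ Δ.locProj K a F =
      Δ.locProj K a G ∘ₗ (Δ.nat K hFG).toLinearMap.restrictScalars K := by
    refine loc_hom_ext K Δ fun b m => ?_
    change Δ.nat K hFG (Δ.locProj K a F _) = Δ.locProj K a G (Δ.nat K hFG _)
    rw [nat_frac, locProj_frac, locProj_frac, fracDegree_nat hFG]
    split_ifs
    · rw [nat_frac]
    · rw [map_zero]
  exact LinearMap.congr_fun this y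

end FinSimplicialComplex

/-! ### Gradings from families of projections -/

section Projections

variable {K ι : Type*} [Field K] {V Z H : Type*} [AddCommGroup V] [Module K V] [AddCommGroup Z]
  [Module K Z] [AddCommGroup H] [Module K H]

open Classical in
lemma DirectSum.isInternal_range_of_projections (π : ι → V →ₗ[K] V)
    (hπ : ∀ a b y, π a (π b y) = if b = a then π b y else 0)
    (hsum : ∀ y, ∃ S : Finset ι, ∑ a ∈ S, π a y = y) :
    DirectSum.IsInternal fun a => LinearMap.range (π a) := by
  constructor
  · rw [injective_iff_map_eq_zero]
    intro x hx
    have key : ∀ b, π b (DirectSum.coeAddMonoidHom (fun a => LinearMap.range (π a)) x) = x b := by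
      intro b
      clear hx
      induction x using DirectSum.induction_on with
      | zero => simp
      | of a y =>
        obtain ⟨_, y, rfl⟩ := y
        rw [DirectSum.coeAddMonoidHom_of, DirectSum.coe_of_apply]
        dsimp only
        rw [hπ]
        split_ifs <;> rfl
      | add x y hx hy => simp_all
    ext b
    rw [← key b, hx, map_zero]
    rfl
  · intro y
    obtain ⟨S, hS⟩ := hsum y
    refine ⟨∑ a ∈ S, DirectSum.of (fun a => LinearMap.range (π a)) a ⟨π a y, y, rfl⟩, ?_⟩
    rw [map_sum]
    simpa [DirectSum.coeAddMonoidHom_of] using hS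

open Classical in
/-- A family of projections that respects a submodule and a quotient of it gives a grading of the
subquotient. -/
lemma DirectSum.isInternal_map_comap (π : ι → V →ₗ[K] V)
    (hπ : ∀ a b y, π a (π b y) = if b = a then π b y else 0)
    (hsum : ∀ y, ∃ S : Finset ι, ∑ a ∈ S, π a y = y) (s : Z →ₗ[K] V)
    (hs : Function.Injective s) (h : Z →ₗ[K] H) (hh : Function.Surjective h)
    (πZ : ι → Z →ₗ[K] Z) (hZ : ∀ a z, s (πZ a z) = π a (s z))
    (hker : ∀ a z, h z = 0 → h (πZ a z) = 0) :
    DirectSum.IsInternal fun a => ((LinearMap.range (π a)).comap s).map h := by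
  -- A linear section exists over a field. By `hker` the operators that it induces on the quotient
  -- do not depend on the choice.
  obtain ⟨g, hg⟩ := LinearMap.exists_rightInverse_of_surjective h (LinearMap.range_eq_top.2 hh)
  have hg' : ∀ y, h (g y) = y := fun y => LinearMap.congr_fun hg y
  let πH : ι → H →ₗ[K] H := fun a => h ∘ₗ πZ a ∘ₗ g
  have hH : ∀ a z, πH a (h z) = h (πZ a z) := fun a z => by
    have := hker a (g (h z) - z) (by rw [map_sub, hg', sub_self])
    rw [map_sub, map_sub, sub_eq_zero] at this
    exact this
  have hrange : (fun a => ((LinearMap.range (π a)).comap s).map h) =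
      fun a => LinearMap.range (πH a) := by
    funext a
    apply le_antisymm
    · rintro _ ⟨z, ⟨w, hw⟩, rfl⟩
      refine ⟨h z, ?_⟩
      rw [hH]
      congr 1
      apply hs
      rw [hZ, ← hw, hπ, if_pos rfl]
    · rintro _ ⟨y, rfl⟩
      exact ⟨πZ a (g y), ⟨s (g y), (hZ a _).symm⟩, rfl⟩
  rw [hrange]
  refine DirectSum.isInternal_range_of_projections πH (fun a b y => ?_) fun y => ?_
  · obtain ⟨z, rfl⟩ := hh y
    rw [hH, hH]
    split_ifs with hab
    · congr 1
      apply hs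
      rw [hZ, hZ, hπ, if_pos hab]
    · rw [← map_zero h]
      congr 1
      apply hs
      rw [hZ, hZ, hπ, if_neg hab, map_zero]
  · obtain ⟨z, rfl⟩ := hh y
    obtain ⟨S, hS⟩ := hsum (s z)
    refine ⟨S, ?_⟩
    simp only [hH]
    rw [← map_sum]
    congr 1
    apply hs
    rw [map_sum]
    simpa only [hZ] using hS

end Projections

/-! ### The multigrading of local cohomology -/

lemma neg_one_pow_smul_eq (A B : Type*) [CommRing A] [CommRing B] {V : Type*} [AddCommGroup V]
    [Module A V] [Module B V] (p : ℕ) (y : V) : (-1 : A) ^ p • y = (-1 : B) ^ p • y := by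
  rcases Nat.even_or_odd p with h | h
  · rw [h.neg_one_pow, h.neg_one_pow, one_smul, one_smul]
  · rw [h.neg_one_pow, h.neg_one_pow, neg_smul, neg_smul, one_smul, one_smul]

namespace FinSimplicialComplex

variable (K : Type u) [Field K] {n : ℕ} (Δ : FinSimplicialComplex n)

instance (F : Finset (Fin n)) (a : Fin n → ℤ) : Decidable (Δ.IsDegree F a) :=
  inferInstanceAs (Decidable (_ ∧ _))

lemma deleteVertex_subset {t : ℕ} (G : {G : Finset (Fin n) // G.card = t + 1})
    (v : {v : Fin n // v ∈ G.1}) : (deleteVertex G v).1 ⊆ G.1 := Finset.erase_subset v.1 G.1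

lemma cechD_apply {t : ℕ} (c : Δ.cech K t) (G : {G : Finset (Fin n) // G.card = t + 1}) :
    Δ.cechD K t c G = ∑ v : {v : Fin n // v ∈ G.1}, (-1 : K) ^ position G.1 v.1 •
      Δ.nat K (deleteVertex_subset G v) (c (deleteVertex G v)) := by
  rw [cechD, LinearMap.pi_apply, LinearMap.sum_apply]
  exact Finset.sum_congr rfl fun v _ => (LinearMap.smul_apply _ _ _).trans
    (neg_one_pow_smul_eq (Δ.stanleyReisnerRing K) K (V := Δ.loc K G.1) (position G.1 v.1)
      (Δ.nat K (deleteVertex_subset G v) (c (deleteVertex G v))))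

/-- The projection of the Čech complex to its component of degree `a`. -/
noncomputable def cechProj (a : Fin n → ℤ) (t : ℕ) : Δ.cech K t →ₗ[K] Δ.cech K t :=
  LinearMap.pi fun F => Δ.locProj K a F.1 ∘ₗ LinearMap.proj F

lemma cechProj_apply (a : Fin n → ℤ) {t : ℕ} (c : Δ.cech K t)
    (F : {F : Finset (Fin n) // F.card = t}) :
    Δ.cechProj K a t c F = Δ.locProj K a F.1 (c F) := rfl

lemma cechD_cechProj (a : Fin n → ℤ) {t : ℕ} (c : Δ.cech K t) :
    Δ.cechD K t (Δ.cechProj K a t c) = Δ.cechProj K a (t + 1) (Δ.cechD K t c) := by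
  funext G
  rw [cechProj_apply, cechD_apply, cechD_apply, map_sum]
  refine Finset.sum_congr rfl fun v _ => ?_
  rw [map_smul, cechProj_apply, nat_locProj]

open Classical in
lemma cechProj_cechProj (a b : Fin n → ℤ) {t : ℕ} (c : Δ.cech K t) :
    Δ.cechProj K a t (Δ.cechProj K b t c) = if b = a then Δ.cechProj K b t c else 0 := by
  funext F
  rw [cechProj_apply, cechProj_apply, locProj_locProj]
  split_ifs <;> rfl

lemma exists_sum_cechProj {t : ℕ} (c : Δ.cech K t) :
    ∃ S : Finset (Fin n → ℤ), ∑ a ∈ S, Δ.cechProj K a t c = c := by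
  classical
  choose S hS using fun F : {F : Finset (Fin n) // F.card = t} => Δ.exists_sum_locProj K F.1 (c F)
  refine ⟨Finset.univ.biUnion S, ?_⟩
  funext F
  rw [Finset.sum_apply]
  exact hS F _ (Finset.subset_biUnion_of_mem S (Finset.mem_univ F))

lemma range_cechProj (a : Fin n → ℤ) (t : ℕ) :
    LinearMap.range (Δ.cechProj K a t) = Δ.cechDegree K t a := by
  apply le_antisymm
  · rintro _ ⟨c, rfl⟩ F -
    change _ ∈ Δ.locDegree K F.1 a
    rw [← range_locProj]
    exact ⟨c F, rfl⟩
  · intro c hc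
    have h : ∀ F : {F : Finset (Fin n) // F.card = t}, ∃ y, Δ.locProj K a F.1 y = c F := fun F => by
      have : c F ∈ Δ.locDegree K F.1 a := hc F trivial
      rwa [← range_locProj] at this
    choose c' hc' using h
    exact ⟨c', funext hc'⟩

lemma cechProj_mem_cechCoboundaries (a : Fin n → ℤ) {i : ℕ} {c : Δ.cech K i}
    (hc : c ∈ Δ.cechCoboundaries K i) : Δ.cechProj K a i c ∈ Δ.cechCoboundaries K i := by
  cases i with
  | zero =>
    rw [(Submodule.mem_bot _).1 hc, map_zero]
    exact zero_mem _
  | succ i =>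
    obtain ⟨c', rfl⟩ := hc
    exact ⟨Δ.cechProj K a i c', Δ.cechD_cechProj K a c'⟩

/-- The class in local cohomology of a Čech cocycle. -/
noncomputable def cocycleClass {i : ℕ}
    (φ : Δ.LocalCoh K i ≃ₗ[Δ.stanleyReisnerRing K] Δ.cechCohomology K i) :
    LinearMap.ker (Δ.cechD K i) →ₗ[K] Δ.LocalCoh K i :=
  (φ.symm.toLinearMap ∘ₗ Submodule.mkQ _).restrictScalars K

lemma cocycleClass_surjective {i : ℕ}
    (φ : Δ.LocalCoh K i ≃ₗ[Δ.stanleyReisnerRing K] Δ.cechCohomology K i) :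
    Function.Surjective (Δ.cocycleClass K φ) :=
  φ.symm.surjective.comp (Submodule.mkQ_surjective _)

lemma cocycleClass_eq_zero_iff {i : ℕ}
    (φ : Δ.LocalCoh K i ≃ₗ[Δ.stanleyReisnerRing K] Δ.cechCohomology K i)
    (z : LinearMap.ker (Δ.cechD K i)) :
    Δ.cocycleClass K φ z = 0 ↔ z.1 ∈ Δ.cechCoboundaries K i := by
  refine (φ.symm.map_eq_zero_iff).trans ?_
  exact Submodule.Quotient.mk_eq_zero _

lemma localCohDegree_eq {i : ℕ}
    (φ : Δ.LocalCoh K i ≃ₗ[Δ.stanleyReisnerRing K] Δ.cechCohomology K i) (a : Fin n → ℤ) :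
    Δ.localCohDegree K i φ a =
      ((LinearMap.range (Δ.cechProj K a i)).comap
        ((LinearMap.ker (Δ.cechD K i)).subtype.restrictScalars K)).map (Δ.cocycleClass K φ) := by
  rw [range_cechProj]
  ext y
  constructor
  · rintro ⟨z, hz, hzy⟩
    refine ⟨z, hz, ?_⟩
    exact φ.symm_apply_eq.2 hzy
  · rintro ⟨z, hz, hzy⟩
    exact ⟨z, hz, φ.symm_apply_eq.1 hzy⟩

theorem isInternal_localCohDegree (i : ℕ)
    (φ : Δ.LocalCoh K i ≃ₗ[Δ.stanleyReisnerRing K] Δ.cechCohomology K i) :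
    DirectSum.IsInternal (Δ.localCohDegree K i φ) := by
  have hstable : ∀ a, ∀ z : LinearMap.ker (Δ.cechD K i),
      Δ.cechProj K a i z.1 ∈ (LinearMap.ker (Δ.cechD K i)).restrictScalars K := fun a z => by
    change Δ.cechD K i _ = 0
    have hz : Δ.cechD K i z.1 = 0 := z.2
    rw [cechD_cechProj, hz, map_zero]
  have h := DirectSum.isInternal_map_comap (fun a => Δ.cechProj K a i)
    (fun a b c => by convert Δ.cechProj_cechProj K a b c) (Δ.exists_sum_cechProj K)
    ((LinearMap.ker (Δ.cechD K i)).subtype.restrictScalars K) Subtype.val_injective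
    (Δ.cocycleClass K φ) (Δ.cocycleClass_surjective K φ)
    (fun a => LinearMap.codRestrict ((LinearMap.ker (Δ.cechD K i)).restrictScalars K)
      (Δ.cechProj K a i ∘ₗ (LinearMap.ker (Δ.cechD K i)).subtype.restrictScalars K) (hstable a))
    (fun a z => rfl)
    (fun a z hz => by
      rw [cocycleClass_eq_zero_iff] at hz
      exact (Δ.cocycleClass_eq_zero_iff K φ _).2 (Δ.cechProj_mem_cechCoboundaries K a hz))
  have heq : Δ.localCohDegree K i φ = fun a => ((LinearMap.range (Δ.cechProj K a i)).comap
      ((LinearMap.ker (Δ.cechD K i)).subtype.restrictScalars K)).map (Δ.cocycleClass K φ) :=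
    funext fun a => Δ.localCohDegree_eq K φ a
  rw [heq]
  convert h

end FinSimplicialComplex

/-! ### The strand of the Čech complex in a fixed degree -/

namespace FinSimplicialComplex

variable (K : Type u) [Field K] {n : ℕ} (Δ : FinSimplicialComplex n)

/-- The incidence number of `F` in `G`. -/
def inc (G F : Finset (Fin n)) : K := ∑ v ∈ G, if G.erase v = F then (-1) ^ position G v else 0

/-- The sets `F` with `t` elements such that `K[Δ]_{x_F}` has a component of degree `a`. -/
abbrev DegreeFace (a : Fin n → ℤ) (t : ℕ) : Type :=
  {F : Finset (Fin n) // F.card = t ∧ Δ.IsDegree F a}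

/-- The component of degree `a` of the Čech differential in terms of the monomial bases. -/
def incMatrix (a : Fin n → ℤ) (t : ℕ) : Matrix (Δ.DegreeFace a (t + 1)) (Δ.DegreeFace a t) K :=
  Matrix.of fun G F => inc K G.1 F.1

/-- The component of degree `a` of the Čech complex, in terms of the monomial bases. -/
def degreeD (a : Fin n → ℤ) (t : ℕ) : (Δ.DegreeFace a t → K) →ₗ[K] (Δ.DegreeFace a (t + 1) → K) :=
  (Δ.incMatrix K a t).mulVecLin

/-- Extension of a function on `DegreeFace a t` by zero. -/
def degreeExt (a : Fin n → ℤ) (t : ℕ) (w : Δ.DegreeFace a t → K) (F : Finset (Fin n)) : K :=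
  if h : F.card = t ∧ Δ.IsDegree F a then w ⟨F, h⟩ else 0

lemma degreeExt_apply {a : Fin n → ℤ} {t : ℕ} (w : Δ.DegreeFace a t → K) (F : Δ.DegreeFace a t) :
    Δ.degreeExt K a t w F.1 = w F := dif_pos F.2

lemma degreeExt_of_not {a : Fin n → ℤ} {t : ℕ} (w : Δ.DegreeFace a t → K) {F : Finset (Fin n)}
    (h : ¬ Δ.IsDegree F a) : Δ.degreeExt K a t w F = 0 := dif_neg fun h' => h h'.2

lemma degreeD_apply {a : Fin n → ℤ} {t : ℕ} (w : Δ.DegreeFace a t → K)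
    (G : Δ.DegreeFace a (t + 1)) : Δ.degreeD K a t w G =
      ∑ v ∈ G.1, (-1) ^ position G.1 v * Δ.degreeExt K a t w (G.1.erase v) := by
  change ∑ F : Δ.DegreeFace a t, inc K G.1 F.1 * w F = _
  simp only [inc, Finset.sum_mul]
  rw [Finset.sum_comm]
  refine Finset.sum_congr rfl fun v hv => ?_
  by_cases h : (G.1.erase v).card = t ∧ Δ.IsDegree (G.1.erase v) a
  · rw [Finset.sum_eq_single (⟨G.1.erase v, h⟩ : Δ.DegreeFace a t)]
    · rw [if_pos rfl, degreeExt, dif_pos h]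
    · intro F _ hF
      rw [if_neg fun h' => hF (Subtype.ext h'.symm), zero_mul]
    · exact fun h => (h (Finset.mem_univ _)).elim
  · rw [degreeExt, dif_neg h, mul_zero]
    refine Finset.sum_eq_zero fun F _ => ?_
    rw [if_neg fun h' : G.1.erase v = F.1 => h (by rw [h']; exact F.2), zero_mul]

/-- The inclusion of the component of degree `a` into the Čech complex. -/
noncomputable def degreeIncl (a : Fin n → ℤ) (t : ℕ) : (Δ.DegreeFace a t → K) →ₗ[K] Δ.cech K t where
  toFun w F := Δ.degreeExt K a t w F.1 • Δ.mono K F.1 a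
  map_add' w w' := by
    funext F
    simp only [degreeExt, Pi.add_apply, ← add_smul]
    split_ifs <;> simp
  map_smul' c w := by
    funext F
    simp only [degreeExt, Pi.smul_apply, RingHom.id_apply, smul_smul, smul_eq_mul]
    split_ifs <;> simp

/-- The coefficients in degree `a` of a Čech cochain. -/
noncomputable def degreeCoef (a : Fin n → ℤ) (t : ℕ) : Δ.cech K t →ₗ[K] (Δ.DegreeFace a t → K) :=
  LinearMap.pi fun F => Δ.coef K F.1 a ∘ₗ
    LinearMap.proj (⟨F.1, F.2.1⟩ : {F : Finset (Fin n) // F.card = t})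

lemma degreeIncl_apply {a : Fin n → ℤ} {t : ℕ} (w : Δ.DegreeFace a t → K)
    (F : {F : Finset (Fin n) // F.card = t}) :
    Δ.degreeIncl K a t w F = Δ.degreeExt K a t w F.1 • Δ.mono K F.1 a := rfl

lemma degreeCoef_apply {a : Fin n → ℤ} {t : ℕ} (c : Δ.cech K t) (F : Δ.DegreeFace a t) :
    Δ.degreeCoef K a t c F = Δ.coef K F.1 a (c ⟨F.1, F.2.1⟩) := rfl

lemma degreeExt_degreeCoef {a : Fin n → ℤ} {t : ℕ} (c : Δ.cech K t)
    (F : {F : Finset (Fin n) // F.card = t}) :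
    Δ.degreeExt K a t (Δ.degreeCoef K a t c) F.1 = Δ.coef K F.1 a (c F) := by
  by_cases h : Δ.IsDegree F.1 a
  · exact Δ.degreeExt_apply K _ (⟨F.1, F.2, h⟩ : Δ.DegreeFace a t)
  · rw [degreeExt_of_not K Δ _ h, coef_of_not_isDegree K Δ h, LinearMap.zero_apply]

lemma degreeCoef_degreeIncl {a : Fin n → ℤ} {t : ℕ} (w : Δ.DegreeFace a t → K) :
    Δ.degreeCoef K a t (Δ.degreeIncl K a t w) = w := by
  funext F
  rw [degreeCoef_apply, degreeIncl_apply, map_smul, coef_mono K Δ F.2.2, if_pos rfl]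
  exact (mul_one _).trans (Δ.degreeExt_apply K w F)

lemma degreeIncl_degreeCoef {a : Fin n → ℤ} {t : ℕ} (c : Δ.cech K t) :
    Δ.degreeIncl K a t (Δ.degreeCoef K a t c) = Δ.cechProj K a t c := by
  funext F
  rw [degreeIncl_apply, degreeExt_degreeCoef]
  rfl

lemma nat_degreeExt_smul_mono {a : Fin n → ℤ} {t : ℕ} (w : Δ.DegreeFace a t → K)
    {F G : Finset (Fin n)} (h : F ⊆ G) :
    Δ.nat K h (Δ.degreeExt K a t w F • Δ.mono K F a) =
      Δ.degreeExt K a t w F • Δ.mono K G a := by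
  by_cases hF : Δ.IsDegree F a
  · rw [← nat_mono K Δ h hF.1]
    exact ((Δ.nat K h).toLinearMap.restrictScalars K).map_smul _ _
  · rw [degreeExt_of_not K Δ w hF, zero_smul, zero_smul, map_zero]

lemma cechD_degreeIncl {a : Fin n → ℤ} {t : ℕ} (w : Δ.DegreeFace a t → K) :
    Δ.cechD K t (Δ.degreeIncl K a t w) = Δ.degreeIncl K a (t + 1) (Δ.degreeD K a t w) := by
  funext G
  rw [cechD_apply, degreeIncl_apply]
  have h1 : ∀ v : {v : Fin n // v ∈ G.1}, Δ.nat K (deleteVertex_subset G v)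
      (Δ.degreeIncl K a t w (deleteVertex G v)) =
        Δ.degreeExt K a t w (G.1.erase v.1) • Δ.mono K G.1 a := fun v =>
    Δ.nat_degreeExt_smul_mono K w (deleteVertex_subset G v)
  simp only [h1]
  by_cases hG : Δ.IsDegree G.1 a
  · have h2 : Δ.degreeExt K a (t + 1) (Δ.degreeD K a t w) G.1 = _ :=
      (Δ.degreeExt_apply K _ (⟨G.1, G.2, hG⟩ : Δ.DegreeFace a (t + 1))).trans
        (Δ.degreeD_apply K w _)
    rw [h2, Finset.sum_smul]
    simp only [mul_smul]
    exact Finset.sum_coe_sort G.1 fun v =>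
      (-1 : K) ^ position G.1 v • Δ.degreeExt K a t w (G.1.erase v) • Δ.mono K G.1 a
  -- Here `G` carries nothing in degree `a`: a monomial coming from a smaller set that does carry
  -- degree `a` becomes zero in the localization at `x_G`.
  · rw [degreeExt_of_not K Δ _ hG, zero_smul]
    refine Finset.sum_eq_zero fun v _ => ?_
    by_cases hv : Δ.IsDegree (G.1.erase v.1) a
    · rw [Δ.mono_eq_zero K (fun j hj => Finset.mem_of_mem_erase (hv.1 j hj)) hG, smul_zero,
        smul_zero]
    · rw [degreeExt_of_not K Δ w hv, zero_smul, smul_zero]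

lemma degreeCoef_cechD {a : Fin n → ℤ} {t : ℕ} (c : Δ.cech K t) :
    Δ.degreeCoef K a (t + 1) (Δ.cechD K t c) = Δ.degreeD K a t (Δ.degreeCoef K a t c) := by
  funext G
  rw [degreeCoef_apply, degreeD_apply, cechD_apply, map_sum]
  rw [← Finset.sum_coe_sort G.1 fun v =>
      (-1 : K) ^ position G.1 v * Δ.degreeExt K a t (Δ.degreeCoef K a t c) (G.1.erase v)]
  refine Finset.sum_congr rfl fun v _ => ?_
  rw [map_smul, coef_nat K Δ _ G.2.2, smul_eq_mul]
  congr 1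
  exact (Δ.degreeExt_degreeCoef K c (deleteVertex ⟨G.1, G.2.1⟩ v)).symm

lemma cechD_cechD {t : ℕ} (c : Δ.cech K t) : Δ.cechD K (t + 1) (Δ.cechD K t c) = 0 := by
  rw [cechD_eq, cechD_eq]
  exact Cech.d_comp_d _ _ _ _

lemma degreeD_degreeD {a : Fin n → ℤ} {t : ℕ} (w : Δ.DegreeFace a t → K) :
    Δ.degreeD K a (t + 1) (Δ.degreeD K a t w) = 0 := by
  rw [← degreeCoef_degreeIncl K Δ w, ← degreeCoef_cechD, ← degreeCoef_cechD, cechD_cechD, map_zero]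

lemma degreeIncl_mem_cechCoboundaries_iff {a : Fin n → ℤ} {i : ℕ} (w : Δ.DegreeFace a i → K) :
    Δ.degreeIncl K a i w ∈ Δ.cechCoboundaries K i ↔ w ∈ seqCoboundaries (Δ.degreeD K a) i := by
  cases i with
  | zero =>
    constructor
    · intro h
      have h' : Δ.degreeIncl K a 0 w = 0 := h
      change w = 0
      rw [← degreeCoef_degreeIncl K Δ w, h', map_zero]
    · intro h
      have h' : w = 0 := h
      rw [h', map_zero]
      exact zero_mem _
  | succ i =>
    constructor
    · rintro ⟨c, hc⟩
      exact ⟨Δ.degreeCoef K a i c, by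
        rw [← degreeCoef_cechD, hc, degreeCoef_degreeIncl]⟩
    · rintro ⟨w', rfl⟩
      exact ⟨Δ.degreeIncl K a i w', Δ.cechD_degreeIncl K w'⟩

/-- The component of degree `a` of local cohomology is computed by the complex of functions on
the sets `DegreeFace a t`. -/
lemma nonempty_localCohDegree_equiv {i : ℕ}
    (φ : Δ.LocalCoh K i ≃ₗ[Δ.stanleyReisnerRing K] Δ.cechCohomology K i) (a : Fin n → ℤ) :
    Nonempty (seqCohomology (Δ.degreeD K a) i ≃ₗ[K] Δ.localCohDegree K i φ a) := by
  have hmem : ∀ w : LinearMap.ker (Δ.degreeD K a i),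
      Δ.degreeIncl K a i w.1 ∈ (LinearMap.ker (Δ.cechD K i)).restrictScalars K := fun w => by
    change Δ.cechD K i _ = 0
    have hw : Δ.degreeD K a i w.1 = 0 := w.2
    rw [cechD_degreeIncl, hw, map_zero]
  let E : LinearMap.ker (Δ.degreeD K a i) →ₗ[K] LinearMap.ker (Δ.cechD K i) :=
    LinearMap.codRestrict ((LinearMap.ker (Δ.cechD K i)).restrictScalars K)
      (Δ.degreeIncl K a i ∘ₗ (LinearMap.ker (Δ.degreeD K a i)).subtype) hmem
  let g : LinearMap.ker (Δ.degreeD K a i) →ₗ[K] Δ.LocalCoh K i := Δ.cocycleClass K φ ∘ₗ E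
  have hker : LinearMap.ker g =
      (seqCoboundaries (Δ.degreeD K a) i).submoduleOf (LinearMap.ker (Δ.degreeD K a i)) := by
    ext w
    exact (Δ.cocycleClass_eq_zero_iff K φ (E w)).trans
      (Δ.degreeIncl_mem_cechCoboundaries_iff K w.1)
  have hrange : LinearMap.range g = Δ.localCohDegree K i φ a := by
    rw [localCohDegree_eq]
    apply le_antisymm
    · rintro _ ⟨w, rfl⟩
      refine ⟨E w, ⟨Δ.degreeIncl K a i w.1, ?_⟩, rfl⟩
      rw [← degreeIncl_degreeCoef, degreeCoef_degreeIncl]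
      rfl
    · rintro _ ⟨z, ⟨c, hc⟩, rfl⟩
      have hz : Δ.cechD K i z.1 = 0 := z.2
      refine ⟨⟨Δ.degreeCoef K a i z.1, ?_⟩, congrArg (Δ.cocycleClass K φ) (Subtype.ext ?_)⟩
      · rw [LinearMap.mem_ker, ← degreeCoef_cechD, hz, map_zero]
      · change Δ.degreeIncl K a i (Δ.degreeCoef K a i z.1) = z.1
        have hc' : Δ.cechProj K a i c = z.1 := hc
        rw [degreeIncl_degreeCoef, ← hc', cechProj_cechProj, if_pos rfl]
  exact ⟨(Submodule.quotEquivOfEq _ _ hker.symm).trans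
    (g.quotKerEquivRange.trans (LinearEquiv.ofEq _ _ hrange))⟩

theorem finite_localCohDegree {i : ℕ}
    (φ : Δ.LocalCoh K i ≃ₗ[Δ.stanleyReisnerRing K] Δ.cechCohomology K i) (a : Fin n → ℤ) :
    Module.Finite K (Δ.localCohDegree K i φ a) :=
  Module.Finite.equiv (Δ.nonempty_localCohDegree_equiv K φ a).some

end FinSimplicialComplex

lemma Submodule.finrank_quotient_submoduleOf_add {K V : Type*} [Field K] [AddCommGroup V]
    [Module K V] [FiniteDimensional K V] {A B : Submodule K V} (h : A ≤ B) :
    Module.finrank K (B ⧸ A.submoduleOf B) + Module.finrank K A = Module.finrank K B := by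
  rw [← (Submodule.submoduleOfEquivOfLe h).finrank_eq]
  exact Submodule.finrank_quotient_add_finrank _

/-! ### Degrees with a positive entry, and links in nonpositive degrees -/

namespace FinSimplicialComplex

variable (K : Type u) [Field K] {n : ℕ} (Δ : FinSimplicialComplex n)

lemma isDegree_insert_iff {a : Fin n → ℤ} {v : Fin n} (hv : 0 < a v) (F : Finset (Fin n)) :
    Δ.IsDegree (insert v F) a ↔ Δ.IsDegree F a := by
  have h : insert v F ∪ degreeSupport a = F ∪ degreeSupport a := by
    rw [Finset.insert_union, Finset.insert_eq_of_mem]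
    exact Finset.mem_union_right _ (mem_degreeSupport.2 hv.ne')
  rw [IsDegree, IsDegree, h]
  refine and_congr_left fun _ => forall₂_congr fun j hj => ?_
  rw [Finset.mem_insert, or_iff_right]
  rintro rfl
  exact absurd hj (not_lt.2 hv.le)

/-- The contracting homotopy for the degrees with `0 < a v`. -/
def degreeHomotopy (a : Fin n → ℤ) (t : ℕ) (v : Fin n) (w : Δ.DegreeFace a t → K)
    (F : Finset (Fin n)) : K :=
  if v ∈ F then 0 else (-1) ^ position (insert v F) v * Δ.degreeExt K a t w (insert v F)

/-- If `v ∈ G`, only the term deleting `v` survives and returns `w G`. If not, `G ∪ {v}` is again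
admissible, and the cocycle equation there expresses `w G` through the values at sets containing
`v`. -/
lemma eq_sum_degreeHomotopy {a : Fin n → ℤ} {v : Fin n} (hv : 0 < a v) {t : ℕ}
    {w : Δ.DegreeFace a t → K} (hw : Δ.degreeD K a t w = 0) (G : Δ.DegreeFace a t) :
    w G = ∑ y ∈ G.1, (-1) ^ position G.1 y * Δ.degreeHomotopy K a t v w (G.1.erase y) := by
  have hsq : ∀ p : ℕ, ((-1 : K) ^ p) * (-1) ^ p = 1 := fun p => by
    rw [← mul_pow, neg_one_mul, neg_neg, one_pow]
  by_cases hG : v ∈ G.1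
  · rw [Finset.sum_eq_single_of_mem v hG]
    · rw [degreeHomotopy, if_neg (Finset.notMem_erase _ _), Finset.insert_erase hG,
        ← mul_assoc, hsq, one_mul, degreeExt_apply]
    · intro y _ hy
      rw [degreeHomotopy, if_pos (Finset.mem_erase.2 ⟨hy.symm, hG⟩), mul_zero]
  · have hH : (insert v G.1).card = t + 1 ∧ Δ.IsDegree (insert v G.1) a :=
      ⟨by rw [Finset.card_insert_of_notMem hG, G.2.1], (Δ.isDegree_insert_iff hv _).2 G.2.2⟩
    have h := congrFun hw ⟨insert v G.1, hH⟩
    rw [degreeD_apply, Pi.zero_apply, Finset.sum_insert hG, Finset.erase_insert hG,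
      degreeExt_apply] at h
    have h' : w G = -((-1) ^ position (insert v G.1) v * ∑ y ∈ G.1,
        (-1) ^ position (insert v G.1) y * Δ.degreeExt K a t w ((insert v G.1).erase y)) := by
      rw [← eq_neg_iff_add_eq_zero] at h
      rw [← mul_neg, ← h, ← mul_assoc, hsq, one_mul]
    rw [h', Finset.mul_sum, ← Finset.sum_neg_distrib]
    refine Finset.sum_congr rfl fun y hy => ?_
    have hyv : y ≠ v := fun h => hG (h ▸ hy)
    have hs := sign_erase_comm (A := K) (Finset.mem_insert_of_mem hy)
      (Finset.mem_insert_self v G.1) hyv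
    rw [Finset.erase_insert hG, Finset.erase_insert_of_ne hyv.symm] at hs
    rw [degreeHomotopy, if_neg fun h => hG (Finset.mem_of_mem_erase h),
      Finset.erase_insert_of_ne hyv.symm]
    generalize Δ.degreeExt K a t w (insert v (G.1.erase y)) = W
    have h1 := hsq (position (insert v G.1) v)
    have h2 := hsq (position (insert v (G.1.erase y)) v)
    generalize (-1 : K) ^ position (insert v G.1) v = A at *
    generalize (-1 : K) ^ position (insert v (G.1.erase y)) v = B at *
    generalize (-1 : K) ^ position (insert v G.1) y = C at *
    generalize (-1 : K) ^ position G.1 y = E at *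
    -- All four letters are signs: `hs` says that deleting `y` and `v` anticommute, and `h1`, `h2`
    -- say that `A` and `B` square to 1.
    linear_combination (-(A * B * W)) * hs + (A * C * W) * h2 + (E * B * W) * h1

lemma finrank_seqCohomology_degreeD_of_pos {a : Fin n → ℤ} {v : Fin n} (hv : 0 < a v) (i : ℕ) :
    Module.finrank K (seqCohomology (Δ.degreeD K a) i) = 0 := by
  have : Subsingleton (seqCohomology (Δ.degreeD K a) i) := by
    refine Submodule.Quotient.subsingleton_iff.2 (eq_top_iff.2 ?_)
    rintro ⟨w, hw⟩ -
    have h := Δ.eq_sum_degreeHomotopy K hv (LinearMap.mem_ker.1 hw)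
    change w ∈ seqCoboundaries (Δ.degreeD K a) i
    cases i with
    | zero =>
      change w = 0
      funext G
      rw [h, Finset.card_eq_zero.1 G.2.1, Finset.sum_empty]
      rfl
    | succ i =>
      refine ⟨fun F => Δ.degreeHomotopy K a (i + 1) v w F.1, ?_⟩
      funext G
      rw [h, degreeD_apply]
      refine Finset.sum_congr rfl fun y hy => ?_
      congr 1
      have hc := Finset.card_erase_of_mem hy
      rw [G.2.1, Nat.add_sub_cancel] at hc
      by_cases hd : Δ.IsDegree (G.1.erase y) a
      · exact Δ.degreeExt_apply K _ (⟨G.1.erase y, hc, hd⟩ : Δ.DegreeFace a i)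
      · rw [degreeExt_of_not K Δ _ hd, degreeHomotopy]
        split_ifs
        · rfl
        · rw [degreeExt_of_not K Δ _ (mt (Δ.isDegree_insert_iff hv _).1 hd), mul_zero]
  exact Module.finrank_zero_of_subsingleton

lemma isDegree_iff_of_nonpos {a : Fin n → ℤ} (ha : ∀ j, a j ≤ 0) (F : Finset (Fin n)) :
    Δ.IsDegree F a ↔ degreeSupport a ⊆ F ∧ F ∈ Δ.faces := by
  have h : (∀ j, a j < 0 → j ∈ F) ↔ degreeSupport a ⊆ F :=
    forall_congr' fun j => by rw [mem_degreeSupport, (ha j).lt_iff_ne]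
  rw [IsDegree, h]
  refine and_congr_right fun hF => ?_
  rw [Finset.union_eq_left.2 hF]

lemma mem_link {F G : Finset (Fin n)} :
    G ∈ (Δ.link F).faces ↔ F ∪ G ∈ Δ.faces ∧ Disjoint F G := by
  simp [link, Finset.disjoint_iff_inter_eq_empty]

/-- For a nonpositive degree `a`, the sets in `DegreeFace a t` correspond to faces of the link of
the support of `a`. -/
def degreeFaceEquiv {a : Fin n → ℤ} (ha : ∀ j, a j ≤ 0) {t : ℕ} {d : ℤ}
    (h : (t : ℤ) = d + 1 + (degreeSupport a).card) :
    Δ.DegreeFace a t ≃ (Δ.link (degreeSupport a)).Face d where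
  toFun G := ⟨G.1 \ degreeSupport a, by
    have hG := (Δ.isDegree_iff_of_nonpos ha G.1).1 G.2.2
    refine ⟨Δ.mem_link.2 ⟨?_, Finset.disjoint_sdiff⟩, ?_⟩
    · rw [Finset.union_sdiff_of_subset hG.1]
      exact hG.2
    · have := Finset.card_sdiff_add_card_eq_card hG.1
      have := G.2.1
      omega⟩
  invFun H := ⟨degreeSupport a ∪ H.1, by
    have hH := Δ.mem_link.1 H.2.1
    refine ⟨?_, (Δ.isDegree_iff_of_nonpos ha _).2 ⟨Finset.subset_union_left, hH.1⟩⟩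
    have := Finset.card_union_of_disjoint hH.2
    have := H.2.2
    omega⟩
  left_inv G := Subtype.ext
    (Finset.union_sdiff_of_subset ((Δ.isDegree_iff_of_nonpos ha G.1).1 G.2.2).1)
  right_inv H := Subtype.ext (Finset.union_sdiff_cancel_left (Δ.mem_link.1 H.2.1).2)

/-- The sign that compares the orientation of `G` with the one of `F ∪ G`. -/
def linkSign (F G : Finset (Fin n)) : K := ∏ v ∈ G, (-1) ^ position F v

lemma linkSign_mul_self (F G : Finset (Fin n)) : linkSign K F G * linkSign K F G = 1 := by
  rw [linkSign, ← Finset.prod_mul_distrib]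
  refine Finset.prod_eq_one fun v _ => ?_
  rw [← mul_pow, neg_one_mul, neg_neg, one_pow]

lemma position_eq_add {F G : Finset (Fin n)} (h : F ⊆ G) (v : Fin n) :
    position G v = position (G \ F) v + position F v := by
  rw [position, position, position, ← Finset.card_union_of_disjoint, ← Finset.filter_union,
    Finset.sdiff_union_of_subset h]
  exact Finset.disjoint_filter_filter Finset.sdiff_disjoint

/-- The position of a deleted vertex `v` in `G` is its position in `G \ F₀` plus the number of
elements of `F₀` below it. The second sign is exactly the factor by which `linkSign` changes when
`v` is removed. -/
lemma inc_eq_linkSign_mul {F₀ F G : Finset (Fin n)} (hF : F₀ ⊆ F) (hG : F₀ ⊆ G) :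
    inc K G F = linkSign K F₀ (G \ F₀) * inc K (G \ F₀) (F \ F₀) * linkSign K F₀ (F \ F₀) := by
  have h1 : inc K G F = ∑ v ∈ G \ F₀, if G.erase v = F then (-1) ^ position G v else 0 := by
    symm
    refine Finset.sum_subset Finset.sdiff_subset fun v hv hv' => if_neg ?_
    rintro rfl
    have hv0 : v ∈ F₀ := by
      by_contra h
      exact hv' (Finset.mem_sdiff.2 ⟨hv, h⟩)
    exact Finset.notMem_erase v G (hF hv0)
  rw [h1, inc, Finset.mul_sum, Finset.sum_mul]
  refine Finset.sum_congr rfl fun v hv => ?_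
  have hiff : G.erase v = F ↔ (G \ F₀).erase v = F \ F₀ := by
    rw [← Finset.erase_sdiff_comm]
    constructor
    · rintro rfl
      rfl
    · intro h
      have hG' : F₀ ⊆ G.erase v := fun j hj => Finset.mem_erase.2
        ⟨fun h => (Finset.mem_sdiff.1 hv).2 (h ▸ hj), hG hj⟩
      rw [← Finset.sdiff_union_of_subset hG', h, Finset.sdiff_union_of_subset hF]
  by_cases h : G.erase v = F
  · rw [if_pos h, if_pos (hiff.1 h), ← hiff.1 h, position_eq_add hG, pow_add]
    have hs : linkSign K F₀ (G \ F₀) = (-1) ^ position F₀ v * linkSign K F₀ ((G \ F₀).erase v) :=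
      (Finset.mul_prod_erase _ _ hv).symm
    have := linkSign_mul_self K F₀ ((G \ F₀).erase v)
    rw [hs]
    linear_combination -((-1) ^ position (G \ F₀) v * (-1) ^ position F₀ v) * this
  · rw [if_neg h, if_neg (mt hiff.2 h), mul_zero, zero_mul]

/-- The matrix of incidence numbers of the faces of dimensions `d` and `e`. -/
def faceMatrix (d e : ℤ) : Matrix (Δ.Face d) (Δ.Face e) K := Matrix.of fun G F => inc K G.1 F.1

lemma boundary_eq_mulVecLin {d e : ℤ} (h : e + 1 = d) :
    Δ.boundary K d e h = (Δ.faceMatrix K d e).transpose.mulVecLin := by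
  refine LinearMap.ext fun w => funext fun F => ?_
  rw [boundary, Fintype.linearCombination_apply, Finset.sum_apply]
  change _ = ∑ G : Δ.Face d, inc K G.1 F.1 * w G
  refine Finset.sum_congr rfl fun G _ => ?_
  rw [Pi.smul_apply, smul_eq_mul, mul_comm, Finset.sum_apply, inc]
  congr 1
  rw [← Finset.sum_coe_sort G.1 fun v => if G.1.erase v = F.1 then (-1 : K) ^ position G.1 v else 0]
  refine Finset.sum_congr rfl fun v _ => ?_
  rw [Pi.smul_apply, Pi.single_apply, smul_eq_mul, mul_ite, mul_one, mul_zero]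
  refine if_congr ?_ rfl rfl
  rw [Subtype.ext_iff, eq_comm]
  rfl

/-- The diagonal matrix of the signs `linkSign`. -/
def signMatrix (a : Fin n → ℤ) (t : ℕ) : Matrix (Δ.DegreeFace a t) (Δ.DegreeFace a t) K :=
  Matrix.diagonal fun G => linkSign K (degreeSupport a) (G.1 \ degreeSupport a)

lemma signMatrix_mul_self (a : Fin n → ℤ) (t : ℕ) :
    Δ.signMatrix K a t * Δ.signMatrix K a t = 1 := by
  rw [signMatrix, Matrix.diagonal_mul_diagonal, ← Matrix.diagonal_one]
  congr 1
  funext G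
  exact linkSign_mul_self K _ _

lemma isUnit_det_signMatrix (a : Fin n → ℤ) (t : ℕ) : IsUnit (Δ.signMatrix K a t).det :=
  IsUnit.of_mul_eq_one _ (by rw [← Matrix.det_mul, signMatrix_mul_self, Matrix.det_one])

lemma incMatrix_eq {a : Fin n → ℤ} (ha : ∀ j, a j ≤ 0) {t : ℕ} {d e : ℤ}
    (hd : ((t + 1 : ℕ) : ℤ) = d + 1 + (degreeSupport a).card)
    (he : (t : ℤ) = e + 1 + (degreeSupport a).card) :
    Δ.incMatrix K a t = Δ.signMatrix K a (t + 1) *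
      ((Δ.link (degreeSupport a)).faceMatrix K d e).submatrix (Δ.degreeFaceEquiv ha hd)
        (Δ.degreeFaceEquiv ha he) * Δ.signMatrix K a t := by
  ext G F
  rw [signMatrix, signMatrix, Matrix.mul_diagonal, Matrix.diagonal_mul]
  exact inc_eq_linkSign_mul K ((Δ.isDegree_iff_of_nonpos ha F.1).1 F.2.2).1
    ((Δ.isDegree_iff_of_nonpos ha G.1).1 G.2.2).1

/-- Relabelling, invertible diagonal sign matrices and transposition all preserve the rank. -/
lemma finrank_range_degreeD {a : Fin n → ℤ} (ha : ∀ j, a j ≤ 0) {t : ℕ} {d e : ℤ} (h : e + 1 = d)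
    (he : (t : ℤ) = e + 1 + (degreeSupport a).card) :
    Module.finrank K (LinearMap.range (Δ.degreeD K a t)) =
      Module.finrank K (LinearMap.range ((Δ.link (degreeSupport a)).boundary K d e h)) := by
  rw [boundary_eq_mulVecLin, degreeD]
  change (Δ.incMatrix K a t).rank = (Matrix.transpose _).rank
  rw [Matrix.rank_transpose, Δ.incMatrix_eq K ha (d := d) (by omega) he,
    Matrix.rank_mul_eq_left_of_isUnit_det _ _ (Δ.isUnit_det_signMatrix K a t),
    Matrix.rank_mul_eq_right_of_isUnit_det _ _ (Δ.isUnit_det_signMatrix K a (t + 1)),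
    Matrix.rank_submatrix]

/-- That boundaries of boundaries vanish in the link is read off from the Čech complex: the sign
matrices square to 1 and cancel. -/
lemma faceMatrix_mul_faceMatrix {a : Fin n → ℤ} (ha : ∀ j, a j ≤ 0) {t : ℕ} {d e f : ℤ}
    (hd : ((t + 1 + 1 : ℕ) : ℤ) = d + 1 + (degreeSupport a).card)
    (he : ((t + 1 : ℕ) : ℤ) = e + 1 + (degreeSupport a).card)
    (hf : (t : ℤ) = f + 1 + (degreeSupport a).card) :
    (Δ.link (degreeSupport a)).faceMatrix K d e * (Δ.link (degreeSupport a)).faceMatrix K e f =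
      0 := by
  have h : Δ.incMatrix K a (t + 1) * Δ.incMatrix K a t = 0 := by
    apply Matrix.mulVec_injective
    funext w
    rw [← Matrix.mulVec_mulVec, Matrix.zero_mulVec]
    exact Δ.degreeD_degreeD K w
  have hS := Δ.signMatrix_mul_self K a
  rw [Δ.incMatrix_eq K ha hd he, Δ.incMatrix_eq K ha he hf] at h
  have h' := congrArg (fun M => Δ.signMatrix K a (t + 1 + 1) * M * Δ.signMatrix K a t) h
  simp only [Matrix.mul_zero, Matrix.zero_mul] at h'
  rw [Matrix.mul_assoc, Matrix.mul_assoc, Matrix.mul_assoc, Matrix.mul_assoc, Matrix.mul_assoc, hS,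
    Matrix.mul_one, ← Matrix.mul_assoc (Δ.signMatrix K a (t + 1)) (Δ.signMatrix K a (t + 1)), hS,
    Matrix.one_mul, ← Matrix.mul_assoc, hS, Matrix.one_mul, Matrix.submatrix_mul_equiv] at h'
  ext G F
  have := congrFun (congrFun h' ((Δ.degreeFaceEquiv ha hd).symm G))
    ((Δ.degreeFaceEquiv ha hf).symm F)
  simpa using this

lemma isEmpty_face {d : ℤ} (h : d + 1 < 0) : IsEmpty (Δ.Face d) := ⟨fun F => by
  have := F.2.2
  omega⟩

lemma boundaries_link_le_cycles {a : Fin n → ℤ} (ha : ∀ j, a j ≤ 0) {i : ℕ} {d : ℤ}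
    (h : (i : ℤ) = d + 1 + (degreeSupport a).card) :
    (Δ.link (degreeSupport a)).boundaries K d ≤ (Δ.link (degreeSupport a)).cycles K d := by
  rintro _ ⟨w, rfl⟩
  rw [cycles, LinearMap.mem_ker]
  cases i with
  | zero =>
    have := (Δ.link (degreeSupport a)).isEmpty_face (d := d - 1) (by omega)
    exact Subsingleton.elim _ _
  | succ t =>
    rw [boundary_eq_mulVecLin, boundary_eq_mulVecLin, Matrix.mulVecLin_apply,
      Matrix.mulVecLin_apply, Matrix.mulVec_mulVec, ← Matrix.transpose_mul,
      Δ.faceMatrix_mul_faceMatrix K ha (t := t) (by omega) h (by omega), Matrix.transpose_zero,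
      Matrix.zero_mulVec]

lemma seqCoboundaries_degreeD_le (a : Fin n → ℤ) (i : ℕ) :
    seqCoboundaries (Δ.degreeD K a) i ≤ LinearMap.ker (Δ.degreeD K a i) := by
  cases i with
  | zero => exact bot_le
  | succ i =>
    rintro _ ⟨w, rfl⟩
    exact Δ.degreeD_degreeD K w

lemma finrank_seqCoboundaries_degreeD {a : Fin n → ℤ} (ha : ∀ j, a j ≤ 0) {i : ℕ} {d : ℤ}
    (h : (i : ℤ) = d + 1 + (degreeSupport a).card) :
    Module.finrank K (seqCoboundaries (Δ.degreeD K a) i) = Module.finrank K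
      (LinearMap.range ((Δ.link (degreeSupport a)).boundary K d (d - 1) (sub_add_cancel d 1))) := by
  cases i with
  | zero =>
    have := (Δ.link (degreeSupport a)).isEmpty_face (d := d - 1) (by omega)
    rw [seqCoboundaries, finrank_bot]
    exact Module.finrank_zero_of_subsingleton.symm
  | succ t => exact Δ.finrank_range_degreeD K ha _ (by omega)

/-- For a nonpositive degree, the cohomology is the reduced homology of a link. -/
lemma finrank_seqCohomology_degreeD_of_nonpos {a : Fin n → ℤ} (ha : ∀ j, a j ≤ 0) (i : ℕ) :
    Module.finrank K (seqCohomology (Δ.degreeD K a) i) =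
      Module.finrank K ((Δ.link (degreeSupport a)).reducedHomology K
        ((i : ℤ) - (degreeSupport a).card - 1)) := by
  -- On both sides the dimension is the number of faces minus the ranks of the incoming and outgoing
  -- maps. Transposition exchanges these two ranks, so rank–nullity gives the equality without a map
  -- between homology and cohomology.
  generalize hd : (i : ℤ) - (degreeSupport a).card - 1 = d
  have hi : (i : ℤ) = d + 1 + (degreeSupport a).card := by omega
  have h1 := Submodule.finrank_quotient_submoduleOf_add (Δ.seqCoboundaries_degreeD_le K a i)
  have h2 := Submodule.finrank_quotient_submoduleOf_add (Δ.boundaries_link_le_cycles K ha hi)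
  have h3 := (Δ.degreeD K a i).finrank_range_add_finrank_ker
  have h4 := ((Δ.link (degreeSupport a)).boundary K d (d - 1)
    (sub_add_cancel d 1)).finrank_range_add_finrank_ker
  have h5 := Δ.finrank_seqCoboundaries_degreeD K ha hi
  have h6 := Δ.finrank_range_degreeD K ha (d := d + 1) rfl hi
  have h7 := Fintype.card_congr (Δ.degreeFaceEquiv ha hi)
  rw [Module.finrank_fintype_fun_eq_card] at h3 h4
  change Module.finrank K (seqCohomology (Δ.degreeD K a) i) + _ = _ at h1
  change Module.finrank K ((Δ.link (degreeSupport a)).reducedHomology K d) + _ = _ at h2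
  change _ + Module.finrank K ((Δ.link (degreeSupport a)).cycles K d) = _ at h4
  change _ = Module.finrank K ((Δ.link (degreeSupport a)).boundaries K d) at h6
  rw [h5] at h1
  rw [h6] at h3
  rw [h7] at h3
  omega

lemma finrank_reducedHomology_link_of_notMem {F : Finset (Fin n)} (hF : F ∉ Δ.faces) (d : ℤ) :
    Module.finrank K ((Δ.link F).reducedHomology K d) = 0 := by
  have : IsEmpty ((Δ.link F).Face d) := ⟨fun G =>
    hF (Δ.down_closed Finset.subset_union_left (Δ.mem_link.1 G.2.1).1)⟩
  have : Subsingleton ((Δ.link F).reducedHomology K d) :=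
    (Submodule.mkQ_surjective _).subsingleton
  exact Module.finrank_zero_of_subsingleton

end FinSimplicialComplex

/-! ### Coefficients of the product series, and the theorem -/

open Classical in
lemma MvPowerSeries.coeff_prod_X_mul_inv {σ k : Type*} [Field k] (F : Finset σ) (b : σ →₀ ℕ) :
    coeff b (∏ j ∈ F, X j * (1 - X j)⁻¹ : MvPowerSeries σ k) = if b.support = F then 1 else 0 := by
  let g : Finset σ → MvPowerSeries σ k := fun F b => if b.support = F then 1 else 0
  have hg : ∀ F b, coeff b (g F) = if b.support = F then 1 else 0 := fun _ _ => rfl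
  -- After multiplication by `1 - X v` this is an identity of coefficients, with three cases: `b v =
  -- 0`, `b v = 1`, and `b v ≥ 2`, where the two terms on the left cancel.
  have hinsert : ∀ (F : Finset σ) (v : σ), v ∉ F → g (insert v F) = g F * (X v * (1 - X v)⁻¹) := by
    intro F v hv
    rw [← mul_assoc, MvPowerSeries.eq_mul_inv_iff_mul_eq (by simp), mul_sub, mul_one, X]
    ext b
    rw [map_sub, coeff_mul_monomial, coeff_mul_monomial, hg, hg, hg]
    have hle : Finsupp.single v 1 ≤ b ↔ v ∈ b.support := by
      rw [Finsupp.single_le_iff, Finsupp.mem_support_iff, Nat.one_le_iff_ne_zero]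
    have hsub : ∀ j, (b - Finsupp.single v 1 : σ →₀ ℕ) j = b j - if v = j then 1 else 0 := fun j => by
      rw [Finsupp.tsub_apply, Finsupp.single_apply]
    simp only [hle, mul_one]
    by_cases hb : v ∈ b.support
    · rw [if_pos hb, if_pos hb]
      have hbv := Finsupp.mem_support_iff.1 hb
      by_cases h1 : b v = 1
      · have hs : (b - Finsupp.single v 1).support = b.support.erase v := by
          ext j
          rw [Finset.mem_erase, Finsupp.mem_support_iff, Finsupp.mem_support_iff, hsub]
          by_cases hj : v = j
          · subst hj
            simp [h1]
          · simp [hj, Ne.symm hj]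
        rw [hs]
        have e1 : b.support.erase v ≠ insert v F := fun h =>
          Finset.notMem_erase v b.support (h ▸ Finset.mem_insert_self v F)
        rw [if_neg e1, sub_zero]
        refine if_congr ⟨?_, ?_⟩ rfl rfl
        · intro h
          rw [h, Finset.erase_insert hv]
        · intro h
          rw [← h, Finset.insert_erase hb]
      · have hs : (b - Finsupp.single v 1).support = b.support := by
          ext j
          rw [Finsupp.mem_support_iff, Finsupp.mem_support_iff, hsub]
          by_cases hj : v = j
          · subst hj
            simp only [if_true]
            omega
          · simp [hj]
        have e1 : b.support ≠ F := fun h => hv (h ▸ hb)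
        rw [hs, sub_self, if_neg e1]
    · rw [if_neg hb, if_neg hb, sub_zero, if_neg]
      exact fun h => hb (h ▸ Finset.mem_insert_self v F)
  have hprod : ∀ F : Finset σ, (∏ j ∈ F, X j * (1 - X j)⁻¹ : MvPowerSeries σ k) = g F := by
    intro F
    induction F using Finset.induction_on with
    | empty =>
      ext b
      rw [Finset.prod_empty, coeff_one, hg]
      simp only [Finsupp.support_eq_empty]
    | insert v F hv ih => rw [Finset.prod_insert hv, ih, hinsert F v hv, mul_comm]
  rw [hprod, hg]

theorem mainTheorem5 (K : Type u) [Field K] (n : ℕ) (Δ : FinSimplicialComplex n) (i : ℕ) :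
    Nonempty (Δ.LocalCoh K i ≃ₗ[Δ.stanleyReisnerRing K] Δ.cechCohomology K i) ∧
    ∀ φ : Δ.LocalCoh K i ≃ₗ[Δ.stanleyReisnerRing K] Δ.cechCohomology K i,
      DirectSum.IsInternal (Δ.localCohDegree K i φ) ∧
      (∀ a : Fin n → ℤ, Module.Finite K (Δ.localCohDegree K i φ a)) ∧
      hilbertSeries K (Δ.localCohDegree K i φ) =
        seriesInInverses (∑ F ∈ Δ.faces,
          MvPowerSeries.C
              (Module.finrank K ((Δ.link F).reducedHomology K ((i : ℤ) - (F.card : ℤ) - 1)) : ℚ) *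
            ∏ j ∈ F, MvPowerSeries.X j * (1 - MvPowerSeries.X j)⁻¹) := by
  classical
  refine ⟨Δ.nonempty_localCoh_equiv K i, fun φ => ⟨Δ.isInternal_localCohDegree K i φ,
    Δ.finite_localCohDegree K φ, funext fun a => ?_⟩⟩
  obtain ⟨e⟩ := Δ.nonempty_localCohDegree_equiv K φ a
  rw [hilbertSeries, seriesInInverses, ← e.finrank_eq]
  split_ifs with ha
  · have hs : (Finsupp.equivFunOnFinite.symm fun j => (-a j).toNat).support =
        FinSimplicialComplex.degreeSupport a := by
      ext j
      have := ha j
      rw [Finsupp.mem_support_iff, FinSimplicialComplex.mem_degreeSupport,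
        Finsupp.equivFunOnFinite_symm_apply_apply]
      omega
    rw [map_sum]
    simp only [MvPowerSeries.coeff_C_mul, MvPowerSeries.coeff_prod_X_mul_inv, hs, mul_ite, mul_one,
      mul_zero]
    -- Only the summand `F = supp a` is left. If the support is not a face the sum is empty of it,
    -- and the link has no faces at all.
    rw [Finset.sum_ite_eq, Δ.finrank_seqCohomology_degreeD_of_nonpos K ha]
    split_ifs with hF
    · rfl
    · rw [Δ.finrank_reducedHomology_link_of_notMem K hF, Nat.cast_zero]
  · obtain ⟨v, hv⟩ := not_forall.1 ha
    rw [Δ.finrank_seqCohomology_degreeD_of_pos K (not_le.1 hv), Nat.cast_zero]
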